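/- **Theorem (Uniqueness under small pressure).** Let $B\subset\mathbb{R}^2$ be the open unit disc with polar coordinates $(R,\theta)$ and unit vectors $e_R,e_\theta$. Let $M\in L^\infty(B,\mathbb{R}^{16})$, regarded as a field of linear maps on $\mathbb{R}^{2\times2}$, be symmetric for a.e. $x$, and suppose that for some constant $\nu>0$ one has $M(x)\xi\cdot\xi\ge\nu|\xi|^2$ for a.e. $x\in B$ and all $\xi\in\mathbb{R}^{2\times 2}$ (Frobenius inner product). For $u\in W^{1,2}(B,\mathbb{R}^2)$ put $$E(u)=\int_B M(x)\nabla u\cdot\nabla u\,dx .$$ Let $b\in\mathbb{R}^2$, $g\in W^{1,2}(S^1,\mathbb{R}^2)$ and $$\mathcal{A}^c=\{u\in W^{1,2}(B,\mathbb{R}^2):\ \det\nabla u=1 \text{ a.e. in } B,\ u|_{\partial B}=g+b \text{ in the sense of traces}\}.$$ Let $u\in\mathcal{A}^c$ be a stationary point of $E$ with corresponding pressure $\lambda$: that is, $\lambda\in L^1_{loc}(B)$ has a weak gradient in $L^1_{loc}(B)$ and, for all $\eta\in C_c^\infty(B,\mathbb{R}^2)$, the function $\lambda\,\mathrm{cof}\,\nabla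 u\cdot\nabla\eta$ is integrable and $$\int_B M(x)\nabla u\cdot\nabla\eta\,dx=-\int_B\lambda(x)\,\mathrm{cof}\,\nabla u\cdot\nabla\eta\,dx .$$ For a vector field $f$ on $B$ write $|f(x)|_\ast=\max\{|f(x)\cdot e_R|,|f(x)\cdot e_\theta|\}$, and let $\|f\|_{L^\infty(B,\mathbb{R}^2,dx/R)}$ be the essential supremum of $|f|_\ast$ with respect to the measure $dx/R$. 1. If $$\|R\,\nabla\lambda\|_{L^\infty(B,\mathbb{R}^2,dx/R)}\le\frac{\sqrt3\,\nu}{2\sqrt2},$$ then $u$ is a global minimizer of $E$ in $\mathcal{A}^c$. If moreover $|R\,\nabla\lambda(x)|_\ast<\frac{\sqrt3\,\nu}{2\sqrt2}$ on a measurable set $U\subset B$ of positive $dx/R$-measure, then $u$ is the unique global minimizer of $E$ in $\mathcal{A}^c$. 2. If $\lambda$ depends (up to a null set) only on $R$ or only on $\theta$, then both assertions of 1. hold with $\frac{\sqrt3\,\nu}{2\sqrt2}$ replaced by $\nu$. -/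

import Mathlib

open MeasureTheory Filter Topology
open scoped ContDiff ENNReal

noncomputable section

namespace SmallPressure

/-- The Euclidean plane. -/
abbrev Plane : Type := EuclideanSpace ℝ (Fin 2)

/-- Real `2 × 2` matrices. -/
abbrev Mat2 : Type := Matrix (Fin 2) (Fin 2) ℝ

/-- Fourth order tensors, i.e. linear maps on `2 × 2` matrices, with entries `T (i,j) (k,l)`. -/
abbrev Tensor4 : Type := Matrix (Fin 2 × Fin 2) (Fin 2 × Fin 2) ℝ

/-- The open unit disc `B`. -/
def disc : Set Plane := Metric.ball 0 1

/-- Lebesgue measure `dx` on the disc. -/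
def discMeasure : Measure Plane := volume.restrict disc

/-- The measure `dx / R` on the disc, where `R = ‖x‖`. -/
def discMeasureInvR : Measure Plane :=
  discMeasure.withDensity (fun x => ENNReal.ofReal (‖x‖⁻¹))

/-- The Frobenius inner product `A · B`. -/
def frob (A B : Mat2) : ℝ := ∑ i, ∑ j, A i j * B i j

/-- The cofactor matrix `cof A = (adj A)ᵀ`. -/
def cof (A : Mat2) : Mat2 := A.adjugate.transpose

/-- The action `T ξ` of a fourth order tensor on a matrix. -/
def tensorApply (T : Tensor4) (ξ : Mat2) : Mat2 :=
  Matrix.of fun i j => ∑ k, ∑ l, T (i, j) (k, l) * ξ k l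

/-! ### Weak derivatives and Sobolev spaces on the disc -/

/-- The classical partial derivative `∂ⱼ φ`. -/
def partialDeriv (j : Fin 2) (φ : Plane → ℝ) (x : Plane) : ℝ :=
  fderiv ℝ φ x (EuclideanSpace.single j 1)

/-- `φ ∈ C_c^∞(B)`. -/
def IsTestFunction (φ : Plane → ℝ) : Prop :=
  ContDiff ℝ ∞ φ ∧ HasCompactSupport φ ∧ tsupport φ ⊆ disc

/-- `d` is a weak partial derivative `∂ⱼ w` on the disc. -/
def HasWeakPartial (w : Plane → ℝ) (j : Fin 2) (d : Plane → ℝ) : Prop :=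
  LocallyIntegrableOn w disc ∧ LocallyIntegrableOn d disc ∧
    ∀ φ : Plane → ℝ, IsTestFunction φ →
      ∫ x in disc, w x * partialDeriv j φ x = -∫ x in disc, d x * φ x

/-- `w ∈ L¹_loc(B)` has both weak partial derivatives in `L¹_loc(B)`. -/
def WeaklyDifferentiable (w : Plane → ℝ) : Prop :=
  ∀ j, ∃ d, HasWeakPartial w j d

open Classical in
/-- The weak partial derivative `∂ⱼ w` (unique up to null sets; `0` if there is none). -/
def weakPartial (w : Plane → ℝ) (j : Fin 2) : Plane → ℝ :=
  if h : ∃ d, HasWeakPartial w j d then h.choose else 0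

/-- The weak gradient of a scalar function. -/
def weakGrad (w : Plane → ℝ) (x : Plane) : Plane :=
  WithLp.toLp 2 fun j => weakPartial w j x

/-- The weak gradient of a planar map, `(∇u)ᵢⱼ = ∂ⱼ uᵢ`. -/
def weakJacobian (u : Plane → Plane) (x : Plane) : Mat2 :=
  Matrix.of fun i j => weakPartial (fun y => u y i) j x

/-- The classical gradient of a planar map. -/
def classicalJacobian (η : Plane → Plane) (x : Plane) : Mat2 :=
  Matrix.of fun i j => partialDeriv j (fun y => η y i) x

/-- `w ∈ W^{1,2}(B)`. -/
def MemW12 (w : Plane → ℝ) : Prop :=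
  MemLp w 2 discMeasure ∧ WeaklyDifferentiable w ∧ ∀ j, MemLp (weakPartial w j) 2 discMeasure

/-! ### The boundary circle, parametrised by the angle `θ ∈ (-π, π]` -/

/-- The measure `dθ` on `(-π, π]`, i.e. arc length on `S¹`. -/
def angleMeasure : Measure ℝ := volume.restrict (Set.Ioc (-Real.pi) Real.pi)

/-- The point `(cos θ, sin θ)` of `S¹`. -/
def circlePoint (θ : ℝ) : Plane := !₂[Real.cos θ, Real.sin θ]

/-- `g ∈ W^{1,2}(S¹)`: both `g` and its weak derivative on the circle are square integrable. -/
def MemW12Circle (g : ℝ → ℝ) : Prop :=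
  MemLp g 2 angleMeasure ∧ ∃ g' : ℝ → ℝ, MemLp g' 2 angleMeasure ∧
    ∀ φ : ℝ → ℝ, ContDiff ℝ ∞ φ → Function.Periodic φ (2 * Real.pi) →
      ∫ θ, g θ * deriv φ θ ∂angleMeasure = -∫ θ, g' θ * φ θ ∂angleMeasure

/-- `h ∈ L²(S¹)` is the trace of `w ∈ W^{1,2}(B)` on `S¹ = ∂B`. The trace operator is the
continuous extension to `W^{1,2}(B)` of the restriction map on functions that are smooth up to the
boundary, so this says that some sequence of smooth functions tends to `w` in `W^{1,2}(B)` while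
its restrictions to `S¹` tend to `h` in `L²(S¹)`. -/
def HasTrace (w : Plane → ℝ) (h : ℝ → ℝ) : Prop :=
  ∃ φ : ℕ → Plane → ℝ, (∀ n, ContDiff ℝ ∞ (φ n)) ∧
    Tendsto (fun n => eLpNorm (fun x => φ n x - w x) 2 discMeasure) atTop (𝓝 0) ∧
    (∀ j, Tendsto (fun n => eLpNorm (fun x => partialDeriv j (φ n) x - weakPartial w j x) 2
      discMeasure) atTop (𝓝 0)) ∧
    Tendsto (fun n => eLpNorm (fun θ => φ n (circlePoint θ) - h θ) 2 angleMeasure) atTop (𝓝 0)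

/-! ### The variational problem -/

/-- The quadratic energy `E(u) = ∫_B M(x)∇u · ∇u dx`. -/
def energy (M : Plane → Tensor4) (u : Plane → Plane) : ℝ :=
  ∫ x in disc, frob (tensorApply (M x) (weakJacobian u x)) (weakJacobian u x)

/-- The admissible class: maps in `W^{1,2}(B, ℝ²)` with `det ∇u = 1` a.e. in `B` and
`u = g + b` on `∂B` in the sense of traces. -/
def admissible (g : ℝ → Plane) (b : Plane) : Set (Plane → Plane) :=
  {u | (∀ i, MemW12 (fun x => u x i)) ∧
    (∀ᵐ x ∂discMeasure, (weakJacobian u x).det = 1) ∧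
    ∀ i, HasTrace (fun x => u x i) (fun θ => g θ i + b i)}

/-- `u` minimises the energy in the admissible class. -/
def IsGlobalMinimizer (M : Plane → Tensor4) (g : ℝ → Plane) (b : Plane) (u : Plane → Plane) :
    Prop :=
  u ∈ admissible g b ∧ ∀ v ∈ admissible g b, energy M u ≤ energy M v

/-- `u` is the only minimiser of the energy in the admissible class (up to null sets). -/
def IsUniqueGlobalMinimizer (M : Plane → Tensor4) (g : ℝ → Plane) (b : Plane)
    (u : Plane → Plane) : Prop :=
  IsGlobalMinimizer M g b u ∧ ∀ v, IsGlobalMinimizer M g b v → v =ᵐ[discMeasure] u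

/-- `u` is a stationary point of the constrained problem with corresponding pressure `p`: the weak
Euler-Lagrange equation `∫_B M∇u·∇η dx = -∫_B p cof ∇u·∇η dx` holds for all
`η ∈ C_c^∞(B, ℝ²)`. The integral on the left always exists; that the one on the right exists is
part of the equation. -/
def IsStationaryWithPressure (M : Plane → Tensor4) (u : Plane → Plane) (p : Plane → ℝ) : Prop :=
  ∀ η : Plane → Plane, (∀ i, IsTestFunction (fun x => η x i)) →
    IntegrableOn (fun x => p x * frob (cof (weakJacobian u x)) (classicalJacobian η x)) disc ∧
    ∫ x in disc, frob (tensorApply (M x) (weakJacobian u x)) (classicalJacobian η x) =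
      -∫ x in disc, p x * frob (cof (weakJacobian u x)) (classicalJacobian η x)

/-! ### Size of the pressure gradient -/

/-- The radial component `f · e_R`. -/
def radialPart (f : Plane → Plane) (x : Plane) : ℝ :=
  (f x 0 * x 0 + f x 1 * x 1) / ‖x‖

/-- The angular component `f · e_θ`, where `e_θ = (-x₁, x₀) / ‖x‖`. -/
def angularPart (f : Plane → Plane) (x : Plane) : ℝ :=
  (f x 1 * x 0 - f x 0 * x 1) / ‖x‖

/-- The norm of `L^∞(B, ℝ², dx/R)`: the larger of the essential suprema of `|f · e_R|` and
`|f · e_θ|`. -/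
def polarSupNorm (f : Plane → Plane) : ℝ≥0∞ :=
  max (eLpNorm (radialPart f) ∞ discMeasureInvR) (eLpNorm (angularPart f) ∞ discMeasureInvR)

/-- The vector field `R ∇p`. -/
def scaledGrad (p : Plane → ℝ) (x : Plane) : Plane := ‖x‖ • weakGrad p x

/-- `|R ∇p| < C` on a measurable subset of the disc of positive `dx/R`-measure, the size of a
vector again being the larger of the moduli of its radial and angular components. -/
def StrictOnNontrivialSet (p : Plane → ℝ) (C : ℝ) : Prop :=
  ∃ U ⊆ disc, MeasurableSet U ∧ discMeasureInvR U ≠ 0 ∧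
    ∀ x ∈ U, max |radialPart (scaledGrad p) x| |angularPart (scaledGrad p) x| < C

/-- `p` depends only on the radius `R`. -/
def DependsOnlyOnRadius (p : Plane → ℝ) : Prop :=
  ∃ f : ℝ → ℝ, ∀ᵐ x ∂discMeasure, p x = f ‖x‖

/-- `p` depends only on the angle `θ`, i.e. on the direction `x / ‖x‖`. -/
def DependsOnlyOnAngle (p : Plane → ℝ) : Prop :=
  ∃ f : Plane → ℝ, ∀ᵐ x ∂discMeasure, p x = f (‖x‖⁻¹ • x)

end SmallPressure

end

/-!
For `v` in the admissible class put `η = v - u`, which vanishes on the boundary. Since `∇u` and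
`∇v` both have determinant `1`, `cof ∇u · ∇η = -det ∇η`, and the stationarity of `u` gives
`E(v) - E(u) = 2 ∫ p det ∇η + E(η)`. So `u` minimises `E` as soon as the pressure term is dominated
by `ν ∫ |∇η|²`.

Integrating by parts turns `∫ p det ∇η` into an integral of `∇p` against products of a component of
`η` with a derivative of the other one. In polar coordinates the radial derivative of `p` multiplies
angular derivatives only, and there `η` may be replaced by its deviation from its mean over circles
centred at the origin; the deviation is bounded in `L²(R⁻² dx)` by the angular derivative
(Wirtinger). The angular derivative of `p` annihilates the product of two such circular means, and
what is left again contains a deviation. Young's inequality with constant `5/4` bounds the whole by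
`13/8 · ‖R ∇p‖ ∫ |∇η|²`: the angular part of the Dirichlet integral gets the factor `1 + 5/8`, the
radial part `8/5`. This suffices, as `13√3 < 16√2`. If only one of the two derivatives of `p` is
present, the factor is `1`, and in the case of equality the deviation of `η` is forced to vanish.

Because `p` need not be bounded nor `η` smooth, `p` is truncated and `η` approximated by test
functions.
-/

noncomputable section

namespace SmallPressure

/-! ### Partial derivatives and test functions -/

lemma fderiv_apply_eq (φ : Plane → ℝ) (x v : Plane) :
    fderiv ℝ φ x v = v 0 * partialDeriv 0 φ x + v 1 * partialDeriv 1 φ x := by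
  have hv : v = v 0 • EuclideanSpace.single 0 1 + v 1 • EuclideanSpace.single 1 1 := by
    ext i
    fin_cases i <;> simp
  conv_lhs => rw [hv]
  simp [partialDeriv]

lemma Plane.norm_sq_eq (x : Plane) : ‖x‖ ^ 2 = x 0 ^ 2 + x 1 ^ 2 := by
  simp [EuclideanSpace.norm_sq_eq, Fin.sum_univ_two]

lemma differentiableAt_of_contDiff {E F : Type*} [NormedAddCommGroup E] [NormedSpace ℝ E]
    [NormedAddCommGroup F] [NormedSpace ℝ F] {φ : E → F} (h : ContDiff ℝ ∞ φ) (x : E) :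
    DifferentiableAt ℝ φ x :=
  h.differentiable (by simp) x

lemma contDiff_coord (i : Fin 2) : ContDiff ℝ ∞ (fun x : Plane => x i) :=
  (EuclideanSpace.proj (𝕜 := ℝ) i).contDiff

lemma contDiff_partialDeriv {φ : Plane → ℝ} (h : ContDiff ℝ ∞ φ) (j : Fin 2) :
    ContDiff ℝ ∞ (partialDeriv j φ) :=
  (contDiff_infty_iff_fderiv.1 h).2.clm_apply contDiff_const

lemma continuous_partialDeriv {φ : Plane → ℝ} (h : ContDiff ℝ ∞ φ) (j : Fin 2) :
    Continuous (partialDeriv j φ) :=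
  (contDiff_partialDeriv h j).continuous

@[simp] lemma partialDeriv_coord (i j : Fin 2) (x : Plane) :
    partialDeriv j (fun x : Plane => x i) x = if i = j then 1 else 0 := by
  have h : HasFDerivAt (fun x : Plane => x i) (EuclideanSpace.proj (𝕜 := ℝ) i) x :=
    (EuclideanSpace.proj (𝕜 := ℝ) i).hasFDerivAt
  simp [partialDeriv, h.fderiv]

section rules
variable {φ ψ : Plane → ℝ} {x : Plane} (j : Fin 2)

lemma partialDeriv_add (h : DifferentiableAt ℝ φ x) (h' : DifferentiableAt ℝ ψ x) :
    partialDeriv j (fun y => φ y + ψ y) x = partialDeriv j φ x + partialDeriv j ψ x := by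
  simp [partialDeriv, fderiv_fun_add h h']

lemma partialDeriv_sub (h : DifferentiableAt ℝ φ x) (h' : DifferentiableAt ℝ ψ x) :
    partialDeriv j (fun y => φ y - ψ y) x = partialDeriv j φ x - partialDeriv j ψ x := by
  simp [partialDeriv, fderiv_fun_sub h h']

lemma partialDeriv_mul (h : DifferentiableAt ℝ φ x) (h' : DifferentiableAt ℝ ψ x) :
    partialDeriv j (fun y => φ y * ψ y) x =
      partialDeriv j φ x * ψ x + φ x * partialDeriv j ψ x := by
  simp only [partialDeriv, fderiv_fun_mul h h', add_apply, smul_apply, smul_eq_mul]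
  ring

lemma partialDeriv_comp {f : ℝ → ℝ} (hf : DifferentiableAt ℝ f (φ x))
    (h : DifferentiableAt ℝ φ x) :
    partialDeriv j (fun y => f (φ y)) x = deriv f (φ x) * partialDeriv j φ x := by
  have hcomp := hf.hasDerivAt.comp_hasFDerivAt x h.hasFDerivAt
  rw [partialDeriv, show (fun y => f (φ y)) = f ∘ φ from rfl, hcomp.fderiv, smul_apply,
    smul_eq_mul, partialDeriv]

end rules

lemma partialDeriv_comm {φ : Plane → ℝ} (h : ContDiff ℝ ∞ φ) (i j : Fin 2) (x : Plane) :
    partialDeriv i (partialDeriv j φ) x = partialDeriv j (partialDeriv i φ) x := by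
  have hd : DifferentiableAt ℝ (fderiv ℝ φ) x :=
    differentiableAt_of_contDiff (contDiff_infty_iff_fderiv.1 h).2 x
  have second (i j : Fin 2) : partialDeriv i (partialDeriv j φ) x =
      fderiv ℝ (fderiv ℝ φ) x (EuclideanSpace.single i 1) (EuclideanSpace.single j 1) := by
    change fderiv ℝ (fun y => fderiv ℝ φ y (EuclideanSpace.single j 1)) x _ = _
    simp [(hd.hasFDerivAt.clm_apply
      (hasFDerivAt_const (EuclideanSpace.single j (1 : ℝ)) x)).fderiv]
  have hsymm : IsSymmSndFDerivAt ℝ φ x := h.contDiffAt.isSymmSndFDerivAt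
    (by simpa using (WithTop.coe_le_coe.2 (le_top : (2 : ℕ∞) ≤ ⊤)))
  rw [second, second, hsymm]

lemma hasCompactSupport_partialDeriv {φ : Plane → ℝ} (h : HasCompactSupport φ) (j : Fin 2) :
    HasCompactSupport (partialDeriv j φ) :=
  (h.fderiv ℝ).comp_left (g := fun L : Plane →L[ℝ] ℝ => L (EuclideanSpace.single j 1)) (by simp)

lemma tsupport_partialDeriv_subset (φ : Plane → ℝ) (j : Fin 2) :
    tsupport (partialDeriv j φ) ⊆ tsupport φ :=
  (closure_mono (Function.support_subset_iff'.2 fun x hx => by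
    simp [partialDeriv, Function.notMem_support.1 hx])).trans (tsupport_fderiv_subset ℝ (f := φ))

lemma integral_partialDeriv_eq_zero {φ : Plane → ℝ} (h : ContDiff ℝ ∞ φ)
    (hc : HasCompactSupport φ) (j : Fin 2) : ∫ x, partialDeriv j φ x = 0 := by
  have hint : Integrable (partialDeriv j φ) :=
    (continuous_partialDeriv h j).integrable_of_hasCompactSupport
      (hasCompactSupport_partialDeriv hc j)
  have hparts := integral_mul_fderiv_eq_neg_fderiv_mul_of_integrable
    (μ := (volume : Measure Plane)) (f := fun _ : Plane => (1 : ℝ)) (g := φ)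
    (v := EuclideanSpace.single j 1) (by simp) (by simp only [one_mul]; exact hint)
    (by simpa using h.continuous.integrable_of_hasCompactSupport hc)
    (fun x _ => by simp) (fun x _ => differentiableAt_of_contDiff h x)
  simpa [partialDeriv] using hparts

lemma isOpen_disc : IsOpen disc := Metric.isOpen_ball

lemma measurableSet_disc : MeasurableSet disc := isOpen_disc.measurableSet

namespace IsTestFunction
variable {φ ψ : Plane → ℝ}

lemma contDiff (h : IsTestFunction φ) : ContDiff ℝ ∞ φ := h.1

lemma hasCompactSupport (h : IsTestFunction φ) : HasCompactSupport φ := h.2.1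

lemma partialDeriv (h : IsTestFunction φ) (j : Fin 2) : IsTestFunction (partialDeriv j φ) :=
  ⟨contDiff_partialDeriv h.contDiff j, hasCompactSupport_partialDeriv h.hasCompactSupport j,
    (tsupport_partialDeriv_subset φ j).trans h.2.2⟩

lemma mul_left (h : IsTestFunction φ) (hψ : ContDiff ℝ ∞ ψ) :
    IsTestFunction (fun x => ψ x * φ x) :=
  ⟨hψ.mul h.contDiff, h.hasCompactSupport.mul_left, tsupport_mul_subset_right.trans h.2.2⟩

lemma mul_right (h : IsTestFunction φ) (hψ : ContDiff ℝ ∞ ψ) :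
    IsTestFunction (fun x => φ x * ψ x) := by
  simpa only [mul_comm] using h.mul_left hψ

lemma sub (h : IsTestFunction φ) (h' : IsTestFunction ψ) :
    IsTestFunction (fun x => φ x - ψ x) :=
  ⟨h.contDiff.sub h'.contDiff, h.hasCompactSupport.sub h'.hasCompactSupport,
    (tsupport_sub φ ψ).trans (Set.union_subset h.2.2 h'.2.2)⟩

lemma neg (h : IsTestFunction φ) : IsTestFunction (fun x => -φ x) := by
  simpa using h.mul_left (contDiff_const (c := (-1 : ℝ)))

lemma add (h : IsTestFunction φ) (h' : IsTestFunction ψ) :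
    IsTestFunction (fun x => φ x + ψ x) := by
  simpa using h.sub h'.neg

lemma eq_zero (h : IsTestFunction φ) {x : Plane} (hx : x ∉ disc) : φ x = 0 :=
  image_eq_zero_of_notMem_tsupport fun h' => hx (h.2.2 h')

lemma setIntegral_mul (h : IsTestFunction φ) (f : Plane → ℝ) :
    ∫ x in disc, f x * φ x = ∫ x, f x * φ x :=
  setIntegral_eq_integral_of_forall_compl_eq_zero fun x hx => by simp [h.eq_zero hx]

lemma exists_tsupport_subset_ball (h : IsTestFunction φ) :
    ∃ r ∈ Set.Ioo (0 : ℝ) 1, tsupport φ ⊆ Metric.ball 0 r :=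
  exists_pos_lt_subset_ball one_pos (isClosed_tsupport φ) h.2.2

lemma of_forall_eq_zero (h : ContDiff ℝ ∞ φ) {r : ℝ} (hr : r < 1)
    (h0 : ∀ x, r < ‖x‖ → φ x = 0) : IsTestFunction φ := by
  have hsub : tsupport φ ⊆ Metric.closedBall 0 r :=
    closure_minimal (fun x hx => by
      by_contra hx'
      exact hx (h0 x (by simpa using hx'))) Metric.isClosed_closedBall
  exact ⟨h, HasCompactSupport.of_support_subset_isCompact (isCompact_closedBall 0 r)
    (subset_closure.trans hsub), hsub.trans (Metric.closedBall_subset_ball hr)⟩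

end IsTestFunction

/-! ### Smooth dependence of integrals on a parameter -/

section parametric
universe u
variable {E F : Type u} [NormedAddCommGroup E] [NormedSpace ℝ E]
  [NormedAddCommGroup F] [NormedSpace ℝ F] {f : E → ℝ → F}

lemma contDiff_partial_fderiv (hf : ContDiff ℝ ∞ (fun q : E × ℝ => f q.1 q.2)) :
    ContDiff ℝ ∞ (fun q : E × ℝ => fderiv ℝ (fun y => f y q.2) q.1) := by
  have hcomp : ContDiff ℝ ∞ (Function.uncurry fun (q : E × ℝ) (y : E) => f y q.2) :=
    hf.comp (contDiff_snd.prodMk (contDiff_snd.comp contDiff_fst))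
  exact hcomp.fderiv contDiff_fst (by simp)

lemma hasFDerivAt_intervalIntegral [FiniteDimensional ℝ E]
    (hf : ContDiff ℝ ∞ (fun q : E × ℝ => f q.1 q.2)) (a b : ℝ) (x₀ : E) :
    HasFDerivAt (fun x => ∫ t in a..b, f x t) (∫ t in a..b, fderiv ℝ (fun y => f y t) x₀) x₀ := by
  have hcont (x : E) : Continuous fun t : ℝ => f x t :=
    hf.continuous.comp (by fun_prop : Continuous fun t : ℝ => (x, t))
  have hf' := (contDiff_partial_fderiv hf).continuous
  obtain ⟨C, hC⟩ := ((isCompact_closedBall x₀ 1).prod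
    (isCompact_uIcc (a := a) (b := b))).exists_bound_of_continuousOn hf'.continuousOn
  refine intervalIntegral.hasFDerivAt_integral_of_dominated_of_fderiv_le (𝕜 := ℝ) (μ := volume)
    (F' := fun x t => fderiv ℝ (fun y => f y t) x) (bound := fun _ => C)
    (Metric.ball_mem_nhds x₀ one_pos)
    (Eventually.of_forall fun x => (hcont x).aestronglyMeasurable)
    ((hcont x₀).intervalIntegrable a b)
    (hf'.comp (by fun_prop : Continuous fun t : ℝ => (x₀, t))).aestronglyMeasurable
    (Eventually.of_forall fun t ht x hx =>
      hC (x, t) ⟨Metric.ball_subset_closedBall hx, Set.uIoc_subset_uIcc ht⟩)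
    (by simp) (Eventually.of_forall fun t _ x _ => ?_)
  exact (differentiableAt_of_contDiff
    (hf.comp (contDiff_id.prodMk contDiff_const) : ContDiff ℝ ∞ fun y => f y t) x).hasFDerivAt

lemma contDiff_intervalIntegral [FiniteDimensional ℝ E]
    (hf : ContDiff ℝ ∞ (fun q : E × ℝ => f q.1 q.2)) (a b : ℝ) :
    ContDiff ℝ ∞ (fun x => ∫ t in a..b, f x t) := by
  refine contDiff_infty.2 fun n => ?_
  induction n generalizing F with
  | zero =>
    exact contDiff_zero.2 (continuous_iff_continuousAt.2 fun x =>
      (hasFDerivAt_intervalIntegral hf a b x).continuousAt)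
  | succ n ih =>
    rw [Nat.cast_add, Nat.cast_one, contDiff_succ_iff_fderiv]
    refine ⟨fun x => (hasFDerivAt_intervalIntegral hf a b x).differentiableAt, by simp, ?_⟩
    rw [funext fun x => (hasFDerivAt_intervalIntegral hf a b x).fderiv]
    exact ih (contDiff_partial_fderiv hf)

end parametric

/-! ### Rotations and circular means -/

/-- The rotation of the plane by the angle `α`. -/
def rot (α : ℝ) : Plane ≃ₗᵢ[ℝ] Plane :=
  LinearIsometry.toLinearIsometryEquiv
    { toFun := fun x =>
        !₂[Real.cos α * x 0 - Real.sin α * x 1, Real.sin α * x 0 + Real.cos α * x 1]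
      map_add' := fun x y => by ext i; fin_cases i <;> simp <;> ring
      map_smul' := fun c x => by ext i; fin_cases i <;> simp <;> ring
      norm_map' := fun x => by
        refine (sq_eq_sq₀ (norm_nonneg _) (norm_nonneg _)).1 ?_
        simp only [Plane.norm_sq_eq, LinearMap.coe_mk, AddHom.coe_mk, Matrix.cons_val_zero,
          Matrix.cons_val_one]
        linear_combination (x 0 ^ 2 + x 1 ^ 2) * Real.sin_sq_add_cos_sq α } rfl

@[simp] lemma rot_apply_zero (α : ℝ) (x : Plane) :
    rot α x 0 = Real.cos α * x 0 - Real.sin α * x 1 := rfl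

@[simp] lemma rot_apply_one (α : ℝ) (x : Plane) :
    rot α x 1 = Real.sin α * x 0 + Real.cos α * x 1 := rfl

lemma rot_rot (α β : ℝ) (x : Plane) : rot α (rot β x) = rot (α + β) x := by
  ext i
  fin_cases i <;>
    simp only [Fin.zero_eta, Fin.mk_one, rot_apply_zero, rot_apply_one, Real.cos_add,
      Real.sin_add] <;> ring

@[simp] lemma rot_zero (x : Plane) : rot 0 x = x := by
  ext i
  fin_cases i <;> simp

lemma periodic_rot (x : Plane) : Function.Periodic (fun α => rot α x) (2 * Real.pi) := by
  intro α
  ext i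
  fin_cases i <;> simp

lemma rot_eq_smul_add_smul (α : ℝ) (x : Plane) :
    rot α x = Real.cos α • x + Real.sin α • (!₂[-x 1, x 0] : Plane) := by
  ext i
  fin_cases i <;> simp [sub_eq_add_neg, add_comm]

lemma contDiff_rot : ContDiff ℝ ∞ (fun q : Plane × ℝ => rot q.2 q.1) := by
  simp only [rot_eq_smul_add_smul]
  have hperp : ContDiff ℝ ∞ (fun x : Plane => (!₂[-x 1, x 0] : Plane)) :=
    contDiff_euclidean.2 (Fin.forall_fin_two.2 ⟨(contDiff_coord 1).neg, contDiff_coord 0⟩)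
  exact ((Real.contDiff_cos.comp contDiff_snd).smul contDiff_fst).add
    ((Real.contDiff_sin.comp contDiff_snd).smul (hperp.comp contDiff_fst))

lemma continuous_rot_left (x : Plane) : Continuous fun α => rot α x := by
  simp only [rot_eq_smul_add_smul]
  fun_prop

lemma norm_rot (α : ℝ) (x : Plane) : ‖rot α x‖ = ‖x‖ := (rot α).norm_map x

lemma rot_mem_disc {α : ℝ} {x : Plane} : rot α x ∈ disc ↔ x ∈ disc := by
  simp [disc]

/-- The Euler derivative `x · ∇φ`, which is `R ∂_R φ` in polar coordinates. -/
def eulerDeriv (φ : Plane → ℝ) (x : Plane) : ℝ :=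
  x 0 * partialDeriv 0 φ x + x 1 * partialDeriv 1 φ x

/-- The angular derivative `∂_θ φ`. -/
def angularDeriv (φ : Plane → ℝ) (x : Plane) : ℝ :=
  x 0 * partialDeriv 1 φ x - x 1 * partialDeriv 0 φ x

lemma eulerDeriv_eq_fderiv (φ : Plane → ℝ) (x : Plane) : eulerDeriv φ x = fderiv ℝ φ x x :=
  (fderiv_apply_eq φ x x).symm

lemma eulerDeriv_sq_add_angularDeriv_sq (φ : Plane → ℝ) (x : Plane) :
    eulerDeriv φ x ^ 2 + angularDeriv φ x ^ 2 =
      ‖x‖ ^ 2 * (partialDeriv 0 φ x ^ 2 + partialDeriv 1 φ x ^ 2) := by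
  rw [Plane.norm_sq_eq, eulerDeriv, angularDeriv]
  ring

lemma contDiff_eulerDeriv {φ : Plane → ℝ} (h : ContDiff ℝ ∞ φ) : ContDiff ℝ ∞ (eulerDeriv φ) :=
  ((contDiff_coord 0).mul (contDiff_partialDeriv h 0)).add
    ((contDiff_coord 1).mul (contDiff_partialDeriv h 1))

lemma contDiff_angularDeriv {φ : Plane → ℝ} (h : ContDiff ℝ ∞ φ) :
    ContDiff ℝ ∞ (angularDeriv φ) :=
  ((contDiff_coord 0).mul (contDiff_partialDeriv h 1)).sub
    ((contDiff_coord 1).mul (contDiff_partialDeriv h 0))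

lemma eulerDeriv_sub {φ ψ : Plane → ℝ} (hφ : ContDiff ℝ ∞ φ) (hψ : ContDiff ℝ ∞ ψ) (x : Plane) :
    eulerDeriv (fun y => φ y - ψ y) x = eulerDeriv φ x - eulerDeriv ψ x := by
  simp only [eulerDeriv, partialDeriv_sub _ (differentiableAt_of_contDiff hφ x)
    (differentiableAt_of_contDiff hψ x)]
  ring

lemma eulerDeriv_comp_rot {φ : Plane → ℝ} (h : ContDiff ℝ ∞ φ) (α : ℝ) (x : Plane) :
    eulerDeriv (fun y => φ (rot α y)) x = eulerDeriv φ (rot α x) := by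
  have hcomp : HasFDerivAt (fun y => φ (rot α y)) ((fderiv ℝ φ (rot α x)).comp
      ((rot α).toContinuousLinearEquiv : Plane →L[ℝ] Plane)) x :=
    (differentiableAt_of_contDiff h _).hasFDerivAt.comp x
      ((rot α).toContinuousLinearEquiv : Plane →L[ℝ] Plane).hasFDerivAt
  rw [eulerDeriv_eq_fderiv, eulerDeriv_eq_fderiv, hcomp.fderiv]
  rfl

lemma hasDerivAt_comp_rot {φ : Plane → ℝ} (h : ContDiff ℝ ∞ φ) (x : Plane) (α : ℝ) :
    HasDerivAt (fun α => φ (rot α x)) (angularDeriv φ (rot α x)) α := by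
  have hrot : HasDerivAt (fun α => rot α x)
      (-Real.sin α • x + Real.cos α • (!₂[-x 1, x 0] : Plane)) α := by
    simp only [rot_eq_smul_add_smul]
    exact ((Real.hasDerivAt_cos α).smul_const x).add ((Real.hasDerivAt_sin α).smul_const _)
  refine ((differentiableAt_of_contDiff h (rot α x)).hasFDerivAt.comp_hasDerivAt α
    hrot).congr_deriv ?_
  simp only [fderiv_apply_eq, angularDeriv, rot_apply_zero, rot_apply_one, PiLp.add_apply,
    PiLp.smul_apply, smul_eq_mul, Matrix.cons_val_zero, Matrix.cons_val_one]
  ring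

/-- The mean of `φ` over the circle through `x` centred at the origin. -/
def circMean (φ : Plane → ℝ) (x : Plane) : ℝ :=
  (2 * Real.pi)⁻¹ * ∫ α in (-Real.pi)..Real.pi, φ (rot α x)

lemma circMean_rot (φ : Plane → ℝ) (β : ℝ) (x : Plane) :
    circMean φ (rot β x) = circMean φ x := by
  have hper : Function.Periodic (fun α => φ (rot α x)) (2 * Real.pi) := fun α => by
    simp only [periodic_rot x α]
  have hshift := hper.intervalIntegral_add_eq (-Real.pi + β) (-Real.pi)
  simp only [circMean, rot_rot]
  rw [intervalIntegral.integral_comp_add_right (fun α => φ (rot α x)),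
    show Real.pi + β = -Real.pi + β + 2 * Real.pi by ring, hshift,
    show -Real.pi + 2 * Real.pi = Real.pi by ring]

lemma integral_sub_circMean {φ : Plane → ℝ} (h : Continuous φ) (x : Plane) :
    ∫ α in (-Real.pi)..Real.pi, (φ (rot α x) - circMean φ x) = 0 := by
  have hint : IntervalIntegrable (fun α => φ (rot α x)) volume (-Real.pi) Real.pi :=
    (h.comp (continuous_rot_left x)).intervalIntegrable _ _
  rw [intervalIntegral.integral_sub hint (by simp), intervalIntegral.integral_const, circMean,
    smul_eq_mul]
  field_simp
  ring

lemma contDiff_circMean {φ : Plane → ℝ} (h : ContDiff ℝ ∞ φ) : ContDiff ℝ ∞ (circMean φ) :=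
  contDiff_const.mul (contDiff_intervalIntegral (f := fun x α => φ (rot α x))
    (h.comp contDiff_rot) _ _)

lemma eulerDeriv_circMean {φ : Plane → ℝ} (h : ContDiff ℝ ∞ φ) (x : Plane) :
    eulerDeriv (circMean φ) x = circMean (eulerDeriv φ) x := by
  have hsmooth : ContDiff ℝ ∞ (fun q : Plane × ℝ => φ (rot q.2 q.1)) := h.comp contDiff_rot
  have hderiv := (hasFDerivAt_intervalIntegral (f := fun x α => φ (rot α x)) hsmooth
    (-Real.pi) Real.pi x).const_mul (2 * Real.pi)⁻¹
  have hint : IntervalIntegrable (fun α => fderiv ℝ (fun y => φ (rot α y)) x) volume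
      (-Real.pi) Real.pi :=
    ((contDiff_partial_fderiv (f := fun x α => φ (rot α x)) hsmooth).continuous.comp
      (by fun_prop : Continuous fun α : ℝ => (x, α))).intervalIntegrable _ _
  calc eulerDeriv (circMean φ) x
      = (2 * Real.pi)⁻¹ * (∫ α in (-Real.pi)..Real.pi, fderiv ℝ (fun y => φ (rot α y)) x) x := by
        rw [eulerDeriv_eq_fderiv, show fderiv ℝ (circMean φ) x = _ from hderiv.fderiv, smul_apply,
          smul_eq_mul]
    _ = circMean (eulerDeriv φ) x := by
        simp only [ContinuousLinearMap.intervalIntegral_apply hint, circMean,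
          ← eulerDeriv_comp_rot h, eulerDeriv_eq_fderiv]

lemma angularDeriv_circMean {φ : Plane → ℝ} (h : ContDiff ℝ ∞ φ) (x : Plane) :
    angularDeriv (circMean φ) x = 0 := by
  have hderiv := hasDerivAt_comp_rot (contDiff_circMean h) x 0
  simp only [circMean_rot, rot_zero] at hderiv
  exact hderiv.unique (hasDerivAt_const _ _)

lemma IsTestFunction.circMean {φ : Plane → ℝ} (h : IsTestFunction φ) :
    IsTestFunction (circMean φ) := by
  obtain ⟨r, hr, hsupp⟩ := h.exists_tsupport_subset_ball
  refine of_forall_eq_zero (contDiff_circMean h.contDiff) hr.2 fun x hx => ?_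
  have hzero (α : ℝ) : φ (rot α x) = 0 := image_eq_zero_of_notMem_tsupport fun h' => by
    have hlt := mem_ball_zero_iff.1 (hsupp h')
    rw [norm_rot] at hlt
    exact lt_asymm hx hlt
  simp [SmallPressure.circMean, hzero]

/-! ### Wirtinger's inequality -/

lemma norm_fourierCoeffOn_of_hasDerivAt {a b : ℝ} (hab : a < b) {f f' : ℝ → ℂ} {n : ℤ} (hn : n ≠ 0)
    (hf : ∀ t, HasDerivAt f (f' t) t) (hf' : IntervalIntegrable f' volume a b) (hper : f b = f a) :
    ‖fourierCoeffOn hab f n‖ =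
      (b - a) / (2 * Real.pi * |(n : ℝ)|) * ‖fourierCoeffOn hab f' n‖ := by
  rw [fourierCoeffOn_of_hasDerivAt hab hn (fun t _ => hf t) hf', hper, sub_self, mul_zero, zero_sub,
    norm_mul, norm_neg, norm_mul, ← Complex.ofReal_sub, Complex.norm_real, Real.norm_eq_abs,
    abs_of_pos (sub_pos.2 hab)]
  simp only [norm_div, norm_one, norm_mul, norm_neg, Complex.norm_I, Complex.norm_real,
    Complex.norm_ofNat, Complex.norm_intCast, Real.norm_eq_abs, abs_of_pos Real.pi_pos]
  ring

lemma wirtinger_inequality {a b : ℝ} (hab : a < b) {f f' : ℝ → ℂ}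
    (hf : ∀ t, HasDerivAt f (f' t) t) (hf' : Continuous f') (hper : f b = f a)
    (hmean : ∫ t in a..b, f t = 0) :
    ∫ t in a..b, ‖f t‖ ^ 2 ≤ ((b - a) / (2 * Real.pi)) ^ 2 * ∫ t in a..b, ‖f' t‖ ^ 2 := by
  have hmem {h : ℝ → ℂ} (hh : Continuous h) : MemLp h 2 (volume.restrict (Set.Ioc a b)) :=
    (memLp_two_iff_integrable_sq_norm hh.aestronglyMeasurable).2 (hh.norm.pow 2).integrableOn_Ioc
  have hfc : Continuous f := continuous_iff_continuousAt.2 fun t => (hf t).continuousAt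
  have hcoeff (n : ℤ) : ‖fourierCoeffOn hab f n‖ ^ 2 ≤
      ((b - a) / (2 * Real.pi)) ^ 2 * ‖fourierCoeffOn hab f' n‖ ^ 2 := by
    rw [← mul_pow]
    refine pow_le_pow_left₀ (norm_nonneg _) ?_ 2
    have hba := sub_pos.2 hab
    rcases eq_or_ne n 0 with rfl | hn
    · have hzero : fourierCoeffOn hab f 0 = 0 := by
        simp [fourierCoeffOn_eq_integral, hmean]
      rw [hzero, norm_zero]
      positivity
    · rw [norm_fourierCoeffOn_of_hasDerivAt hab hn hf (hf'.intervalIntegrable _ _) hper]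
      have hn1 : (1 : ℝ) ≤ |(n : ℝ)| := by exact_mod_cast Int.one_le_abs hn
      exact mul_le_mul_of_nonneg_right (div_le_div_of_nonneg_left hba.le (by positivity)
        (le_mul_of_one_le_right (by positivity) hn1)) (norm_nonneg _)
  have hparseval := hasSum_le hcoeff (hasSum_sq_fourierCoeffOn hab (hmem hfc))
    ((hasSum_sq_fourierCoeffOn hab (hmem hf')).mul_left (((b - a) / (2 * Real.pi)) ^ 2))
  rw [smul_eq_mul, smul_eq_mul, mul_left_comm] at hparseval
  exact le_of_mul_le_mul_left hparseval (inv_pos.2 (sub_pos.2 hab))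

lemma integral_sq_le_of_periodic {f f' : ℝ → ℝ} (hf : ∀ t, HasDerivAt f (f' t) t)
    (hf' : Continuous f') (hper : f Real.pi = f (-Real.pi))
    (hmean : ∫ t in (-Real.pi)..Real.pi, f t = 0) :
    ∫ t in (-Real.pi)..Real.pi, f t ^ 2 ≤ ∫ t in (-Real.pi)..Real.pi, f' t ^ 2 := by
  have hpi := Real.pi_pos
  have hle := wirtinger_inequality (by linarith : -Real.pi < Real.pi)
    (f := fun t => (f t : ℂ)) (f' := fun t => (f' t : ℂ)) (fun t => (hf t).ofReal_comp)
    (by fun_prop) (by rw [hper]) (by rw [intervalIntegral.integral_ofReal, hmean]; simp)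
  rwa [show (Real.pi - -Real.pi) / (2 * Real.pi) = 1 by field_simp; ring, one_pow, one_mul,
    funext fun t => show ‖(f t : ℂ)‖ ^ 2 = f t ^ 2 by simp,
    funext fun t => show ‖(f' t : ℂ)‖ ^ 2 = f' t ^ 2 by simp] at hle

/-! ### Rotation invariant weights -/

lemma lintegral_disc_comp_rot (h : Plane → ℝ≥0∞) (α : ℝ) :
    ∫⁻ x in disc, h (rot α x) = ∫⁻ x in disc, h x := by
  have hpre : (rot α) ⁻¹' disc = disc := Set.ext fun x => rot_mem_disc
  simpa only [hpre] using (rot α).measurePreserving.setLIntegral_comp_preimage_emb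
    (rot α).toHomeomorph.measurableEmbedding h disc

lemma lintegral_disc_eq_lintegral_rot {h : Plane → ℝ≥0∞} (hh : Measurable h) :
    ENNReal.ofReal (2 * Real.pi) * ∫⁻ x in disc, h x =
      ∫⁻ x in disc, ∫⁻ α in Set.Ioc (-Real.pi) Real.pi, h (rot α x) := by
  rw [lintegral_lintegral_swap (f := fun x α => h (rot α x))
    (hh.comp contDiff_rot.continuous.measurable).aemeasurable]
  simp only [lintegral_disc_comp_rot, lintegral_const, Measure.restrict_apply_univ, Real.volume_Ioc]
  rw [mul_comm, sub_neg_eq_add, two_mul]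

lemma lintegral_ofReal_mul_comp_rot {w g : Plane → ℝ} (hw0 : ∀ x, 0 ≤ w x)
    (hwr : ∀ α x, w (rot α x) = w x) (hg : Continuous g) (hg0 : ∀ x, 0 ≤ g x) (x : Plane) :
    ∫⁻ α in Set.Ioc (-Real.pi) Real.pi, ENNReal.ofReal (w (rot α x) * g (rot α x)) =
      ENNReal.ofReal (w x) * ENNReal.ofReal (∫ α in (-Real.pi)..Real.pi, g (rot α x)) := by
  have hc : Continuous fun α => g (rot α x) := hg.comp (continuous_rot_left x)
  rw [intervalIntegral.integral_of_le (by linarith [Real.pi_pos]),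
    ofReal_integral_eq_lintegral_ofReal hc.integrableOn_Ioc (Eventually.of_forall fun α => hg0 _),
    ← lintegral_const_mul _ hc.measurable.ennreal_ofReal]
  simp only [hwr, ENNReal.ofReal_mul (hw0 x)]

lemma integrable_and_integral_le_of_lintegral_ofReal_le {X : Type*} [MeasurableSpace X]
    {μ : Measure X} {f g : X → ℝ} (hf : AEStronglyMeasurable f μ) (hf0 : ∀ x, 0 ≤ f x)
    (hg0 : ∀ x, 0 ≤ g x) (hg : Integrable g μ)
    (hle : ∫⁻ x, ENNReal.ofReal (f x) ∂μ ≤ ∫⁻ x, ENNReal.ofReal (g x) ∂μ) :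
    Integrable f μ ∧ ∫ x, f x ∂μ ≤ ∫ x, g x ∂μ := by
  have hfin := (hasFiniteIntegral_iff_ofReal (Eventually.of_forall hg0)).1 hg.2
  refine ⟨⟨hf, (hasFiniteIntegral_iff_ofReal (Eventually.of_forall hf0)).2 (hle.trans_lt hfin)⟩, ?_⟩
  rw [integral_eq_lintegral_of_nonneg_ae (Eventually.of_forall hf0) hf,
    integral_eq_lintegral_of_nonneg_ae (Eventually.of_forall hg0) hg.1]
  exact ENNReal.toReal_mono hfin.ne hle

section weight
variable {w : Plane → ℝ} (hw : Measurable w) (hw0 : ∀ x, 0 ≤ w x)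
  (hwr : ∀ α x, w (rot α x) = w x)
include hw hw0 hwr

lemma weighted_integral_mono_of_circle {g₁ g₂ : Plane → ℝ} (hg₁ : Continuous g₁)
    (hg₂ : Continuous g₂) (h₁ : ∀ x, 0 ≤ g₁ x) (h₂ : ∀ x, 0 ≤ g₂ x)
    (h : ∀ x, ∫ α in (-Real.pi)..Real.pi, g₁ (rot α x) ≤ ∫ α in (-Real.pi)..Real.pi, g₂ (rot α x))
    (hint : IntegrableOn (fun x => w x * g₂ x) disc) :
    IntegrableOn (fun x => w x * g₁ x) disc ∧
      ∫ x in disc, w x * g₁ x ≤ ∫ x in disc, w x * g₂ x := by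
  have hmeas {g : Plane → ℝ} (hg : Continuous g) : Measurable fun x => ENNReal.ofReal (w x * g x) :=
    (hw.mul hg.measurable).ennreal_ofReal
  refine integrable_and_integral_le_of_lintegral_ofReal_le
    (hw.mul hg₁.measurable).aestronglyMeasurable (fun x => mul_nonneg (hw0 x) (h₁ x))
    (fun x => mul_nonneg (hw0 x) (h₂ x)) hint ?_
  have hc : ENNReal.ofReal (2 * Real.pi) ≠ 0 := by simp [Real.pi_pos]
  rw [← ENNReal.mul_le_mul_iff_right hc ENNReal.ofReal_ne_top,
    lintegral_disc_eq_lintegral_rot (hmeas hg₁), lintegral_disc_eq_lintegral_rot (hmeas hg₂)]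
  refine lintegral_mono fun x => ?_
  simp only [lintegral_ofReal_mul_comp_rot hw0 hwr hg₁ h₁,
    lintegral_ofReal_mul_comp_rot hw0 hwr hg₂ h₂]
  gcongr
  exact h x

lemma weighted_wirtinger {φ : Plane → ℝ} (hφ : ContDiff ℝ ∞ φ)
    (hint : IntegrableOn (fun x => w x * angularDeriv φ x ^ 2) disc) :
    IntegrableOn (fun x => w x * (φ x - circMean φ x) ^ 2) disc ∧
      ∫ x in disc, w x * (φ x - circMean φ x) ^ 2 ≤ ∫ x in disc, w x * angularDeriv φ x ^ 2 := by
  have hθ := (contDiff_angularDeriv hφ).continuous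
  refine weighted_integral_mono_of_circle hw hw0 hwr
    ((hφ.continuous.sub (contDiff_circMean hφ).continuous).pow 2) (hθ.pow 2)
    (fun x => sq_nonneg _) (fun x => sq_nonneg _) (fun x => ?_) hint
  simp only [circMean_rot]
  refine integral_sq_le_of_periodic (fun α => (hasDerivAt_comp_rot hφ x α).sub_const _)
    (hθ.comp (continuous_rot_left x)) ?_ (integral_sub_circMean hφ.continuous x)
  have hrot : rot Real.pi x = rot (-Real.pi) x := by
    have hper := periodic_rot x (-Real.pi)
    rwa [show -Real.pi + 2 * Real.pi = Real.pi by ring] at hper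
  rw [hrot]

/-- On each circle `(ψ + m)² + 3 (ψ - m)² = 4 ψ² - 4 m (ψ - m)` with `m = circMean ψ` constant, and
the last term has mean zero. -/
lemma weighted_circMean_sq_le {ψ : Plane → ℝ} (hψ : ContDiff ℝ ∞ ψ)
    (hint : IntegrableOn (fun x => w x * (4 * ψ x ^ 2)) disc) :
    IntegrableOn (fun x => w x * ((ψ x + circMean ψ x) ^ 2 + 3 * (ψ x - circMean ψ x) ^ 2)) disc ∧
      ∫ x in disc, w x * ((ψ x + circMean ψ x) ^ 2 + 3 * (ψ x - circMean ψ x) ^ 2) ≤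
        ∫ x in disc, w x * (4 * ψ x ^ 2) := by
  have hc := hψ.continuous
  have hm := (contDiff_circMean hψ).continuous
  refine weighted_integral_mono_of_circle hw hw0 hwr (by fun_prop) (by fun_prop)
    (fun x => by positivity) (fun x => by positivity) (fun x => le_of_eq ?_) hint
  have hcx : Continuous fun α => ψ (rot α x) := hc.comp (continuous_rot_left x)
  simp only [circMean_rot]
  calc ∫ α in (-Real.pi)..Real.pi,
        ((ψ (rot α x) + circMean ψ x) ^ 2 + 3 * (ψ (rot α x) - circMean ψ x) ^ 2)
      = ∫ α in (-Real.pi)..Real.pi,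
        (4 * ψ (rot α x) ^ 2 - 4 * circMean ψ x * (ψ (rot α x) - circMean ψ x)) := by
        congr with α
        ring
    _ = ∫ α in (-Real.pi)..Real.pi, 4 * ψ (rot α x) ^ 2 := by
        have hcsq : Continuous fun α => 4 * ψ (rot α x) ^ 2 := continuous_const.mul (hcx.pow 2)
        have hcsub : Continuous fun α => 4 * circMean ψ x * (ψ (rot α x) - circMean ψ x) :=
          continuous_const.mul (hcx.sub continuous_const)
        rw [intervalIntegral.integral_sub (hcsq.intervalIntegrable _ _)
          (hcsub.intervalIntegrable _ _),
          intervalIntegral.integral_const_mul (4 * circMean ψ x), integral_sub_circMean hc,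
          mul_zero, sub_zero]

end weight

/-! ### Integrability on the disc -/

instance : IsFiniteMeasure discMeasure :=
  ⟨by simp [discMeasure, disc]⟩

lemma integrableOn_disc_of_continuous {f : Plane → ℝ} (hf : Continuous f) :
    IntegrableOn f disc :=
  (hf.continuousOn.integrableOn_compact (isCompact_closedBall 0 1)).mono_set
    Metric.ball_subset_closedBall

lemma exists_bound_on_disc {f : Plane → ℝ} (hf : Continuous f) :
    ∃ C, ∀ x ∈ disc, |f x| ≤ C := by
  obtain ⟨C, hC⟩ := (isCompact_closedBall (0 : Plane) 1).exists_bound_of_continuousOn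
    hf.continuousOn
  exact ⟨C, fun x hx => hC x (Metric.ball_subset_closedBall hx)⟩

lemma integrable_discMeasure_of_bound {f : Plane → ℝ} (hf : AEStronglyMeasurable f discMeasure)
    {C : ℝ} (hC : ∀ x ∈ disc, |f x| ≤ C) : Integrable f discMeasure :=
  Integrable.of_bound hf C (ae_restrict_of_forall_mem measurableSet_disc hC)

lemma IsTestFunction.integrableOn_mul {f φ : Plane → ℝ} (hφ : IsTestFunction φ)
    (hf : LocallyIntegrableOn f disc) : IntegrableOn (fun x => f x * φ x) disc := by
  have htsupp : IntegrableOn (fun x => f x * φ x) (tsupport φ) :=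
    (hf.integrableOn_compact_subset hφ.2.2 hφ.hasCompactSupport).mul_continuousOn
      hφ.contDiff.continuous.continuousOn hφ.hasCompactSupport
  refine htsupp.of_forall_sdiff_eq_zero measurableSet_disc fun x hx => ?_
  rw [image_eq_zero_of_notMem_tsupport hx.2, mul_zero]

lemma ae_ne_zero : ∀ᵐ x ∂discMeasure, x ≠ 0 :=
  ae_restrict_of_ae (Measure.ae_ne volume 0)

/-! ### Radial and angular energies -/

/-- The weight `R⁻²`, equal to `0` at the origin. -/
def invSq (x : Plane) : ℝ := (‖x‖ ^ 2)⁻¹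

lemma measurable_invSq : Measurable invSq := by unfold invSq; fun_prop

lemma invSq_nonneg (x : Plane) : 0 ≤ invSq x := by unfold invSq; positivity

lemma invSq_rot (α : ℝ) (x : Plane) : invSq (rot α x) = invSq x := by simp [invSq]

lemma invSq_mul_norm_sq {x : Plane} (hx : x ≠ 0) : invSq x * ‖x‖ ^ 2 = 1 :=
  inv_mul_cancel₀ (by simpa using hx)

lemma invSq_mul_eulerDeriv_add_angularDeriv {φ : Plane → ℝ} {x : Plane} (hx : x ≠ 0) :
    invSq x * eulerDeriv φ x ^ 2 + invSq x * angularDeriv φ x ^ 2 =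
      partialDeriv 0 φ x ^ 2 + partialDeriv 1 φ x ^ 2 := by
  rw [← mul_add, eulerDeriv_sq_add_angularDeriv_sq, ← mul_assoc, invSq_mul_norm_sq hx, one_mul]

lemma invSq_mul_eulerDeriv_add_angularDeriv_le (φ : Plane → ℝ) (x : Plane) :
    invSq x * eulerDeriv φ x ^ 2 + invSq x * angularDeriv φ x ^ 2 ≤
      partialDeriv 0 φ x ^ 2 + partialDeriv 1 φ x ^ 2 := by
  rcases eq_or_ne x 0 with rfl | hx
  · simpa [invSq] using add_nonneg (sq_nonneg (partialDeriv 0 φ 0)) (sq_nonneg _)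
  · exact (invSq_mul_eulerDeriv_add_angularDeriv hx).le

/-- The Dirichlet integral `∫_B |∇φ|²`. -/
def dirichlet (φ : Plane → ℝ) : ℝ :=
  ∫ x in disc, (partialDeriv 0 φ x ^ 2 + partialDeriv 1 φ x ^ 2)

/-- The radial part `∫_B |∂_R φ|²` of the Dirichlet integral. -/
def radialEnergy (φ : Plane → ℝ) : ℝ := ∫ x in disc, invSq x * eulerDeriv φ x ^ 2

/-- The angular part `∫_B |R⁻¹ ∂_θ φ|²` of the Dirichlet integral. -/
def angularEnergy (φ : Plane → ℝ) : ℝ := ∫ x in disc, invSq x * angularDeriv φ x ^ 2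

/-- The weighted norm of the fluctuation of `φ` about its circular means. -/
def fluctuation (φ : Plane → ℝ) : ℝ := ∫ x in disc, invSq x * (φ x - circMean φ x) ^ 2

/-- The radial energy of the fluctuation of `φ` about its circular means. -/
def radialFluctuation (φ : Plane → ℝ) : ℝ :=
  ∫ x in disc, invSq x * (eulerDeriv φ x - circMean (eulerDeriv φ) x) ^ 2

/-- The radial energy of the sum of `φ` and its circular mean. -/
def radialSumEnergy (φ : Plane → ℝ) : ℝ :=
  ∫ x in disc, invSq x * (eulerDeriv φ x + circMean (eulerDeriv φ) x) ^ 2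

section smooth
variable {φ : Plane → ℝ} (hφ : ContDiff ℝ ∞ φ)
include hφ

lemma integrableOn_grad_sq :
    IntegrableOn (fun x => partialDeriv 0 φ x ^ 2 + partialDeriv 1 φ x ^ 2) disc :=
  integrableOn_disc_of_continuous
    (((continuous_partialDeriv hφ 0).pow 2).add ((continuous_partialDeriv hφ 1).pow 2))

lemma integrableOn_radialEnergy : IntegrableOn (fun x => invSq x * eulerDeriv φ x ^ 2) disc := by
  refine (integrableOn_grad_sq hφ).mono' (measurable_invSq.mul
    ((contDiff_eulerDeriv hφ).continuous.measurable.pow_const 2)).aestronglyMeasurable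
    (Eventually.of_forall fun x => ?_)
  have hle := invSq_mul_eulerDeriv_add_angularDeriv_le φ x
  rw [Real.norm_of_nonneg (mul_nonneg (invSq_nonneg x) (sq_nonneg _))]
  linarith [mul_nonneg (invSq_nonneg x) (sq_nonneg (angularDeriv φ x))]

lemma integrableOn_angularEnergy : IntegrableOn (fun x => invSq x * angularDeriv φ x ^ 2) disc := by
  refine (integrableOn_grad_sq hφ).mono' (measurable_invSq.mul
    ((contDiff_angularDeriv hφ).continuous.measurable.pow_const 2)).aestronglyMeasurable
    (Eventually.of_forall fun x => ?_)
  have hle := invSq_mul_eulerDeriv_add_angularDeriv_le φ x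
  rw [Real.norm_of_nonneg (mul_nonneg (invSq_nonneg x) (sq_nonneg _))]
  linarith [mul_nonneg (invSq_nonneg x) (sq_nonneg (eulerDeriv φ x))]

lemma radialEnergy_add_angularEnergy : radialEnergy φ + angularEnergy φ = dirichlet φ := by
  rw [radialEnergy, angularEnergy, dirichlet,
    ← integral_add (integrableOn_radialEnergy hφ) (integrableOn_angularEnergy hφ)]
  refine integral_congr_ae ?_
  filter_upwards [ae_ne_zero] with x hx using invSq_mul_eulerDeriv_add_angularDeriv hx

lemma integrableOn_fluctuation :
    IntegrableOn (fun x => invSq x * (φ x - circMean φ x) ^ 2) disc :=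
  (weighted_wirtinger measurable_invSq invSq_nonneg invSq_rot hφ (integrableOn_angularEnergy hφ)).1

lemma fluctuation_le_angularEnergy : fluctuation φ ≤ angularEnergy φ :=
  (weighted_wirtinger measurable_invSq invSq_nonneg invSq_rot hφ (integrableOn_angularEnergy hφ)).2

lemma integrableOn_four_mul_radialEnergy :
    IntegrableOn (fun x => invSq x * (4 * eulerDeriv φ x ^ 2)) disc := by
  simp only [mul_left_comm _ (4 : ℝ)]
  exact (integrableOn_radialEnergy hφ).const_mul 4

lemma integrableOn_radialSum_add_radialFluctuation :
    IntegrableOn (fun x => invSq x * ((eulerDeriv φ x + circMean (eulerDeriv φ) x) ^ 2 +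
      3 * (eulerDeriv φ x - circMean (eulerDeriv φ) x) ^ 2)) disc :=
  (weighted_circMean_sq_le measurable_invSq invSq_nonneg invSq_rot (contDiff_eulerDeriv hφ)
    (integrableOn_four_mul_radialEnergy hφ)).1

lemma integrableOn_radialSumEnergy :
    IntegrableOn (fun x => invSq x * (eulerDeriv φ x + circMean (eulerDeriv φ) x) ^ 2) disc := by
  have hE := (contDiff_eulerDeriv hφ).continuous
  have hm := (contDiff_circMean (contDiff_eulerDeriv hφ)).continuous
  refine (integrableOn_radialSum_add_radialFluctuation hφ).mono'
    (measurable_invSq.mul ((hE.add hm).measurable.pow_const 2)).aestronglyMeasurable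
    (Eventually.of_forall fun x => ?_)
  rw [Real.norm_of_nonneg (mul_nonneg (invSq_nonneg x) (sq_nonneg _))]
  exact mul_le_mul_of_nonneg_left (le_add_of_nonneg_right (by positivity)) (invSq_nonneg x)

lemma integrableOn_radialFluctuation :
    IntegrableOn (fun x => invSq x * (eulerDeriv φ x - circMean (eulerDeriv φ) x) ^ 2) disc := by
  have hE := (contDiff_eulerDeriv hφ).continuous
  have hm := (contDiff_circMean (contDiff_eulerDeriv hφ)).continuous
  refine (integrableOn_radialSum_add_radialFluctuation hφ).mono'
    (measurable_invSq.mul ((hE.sub hm).measurable.pow_const 2)).aestronglyMeasurable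
    (Eventually.of_forall fun x => ?_)
  rw [Real.norm_of_nonneg (mul_nonneg (invSq_nonneg x) (sq_nonneg _))]
  refine mul_le_mul_of_nonneg_left ?_ (invSq_nonneg x)
  linarith [sq_nonneg (eulerDeriv φ x + circMean (eulerDeriv φ) x),
    sq_nonneg (eulerDeriv φ x - circMean (eulerDeriv φ) x)]

lemma radialSumEnergy_add_le :
    radialSumEnergy φ + 3 * radialFluctuation φ ≤ 4 * radialEnergy φ := by
  have h := (weighted_circMean_sq_le measurable_invSq invSq_nonneg invSq_rot
    (contDiff_eulerDeriv hφ) (integrableOn_four_mul_radialEnergy hφ)).2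
  simp_rw [mul_add, mul_left_comm _ (3 : ℝ), mul_left_comm _ (4 : ℝ)] at h
  rwa [integral_add (integrableOn_radialSumEnergy hφ)
    ((integrableOn_radialFluctuation hφ).const_mul 3), integral_const_mul, integral_const_mul] at h

end smooth

lemma radialEnergy_nonneg (φ : Plane → ℝ) : 0 ≤ radialEnergy φ :=
  integral_nonneg fun x => mul_nonneg (invSq_nonneg x) (sq_nonneg _)

lemma angularEnergy_nonneg (φ : Plane → ℝ) : 0 ≤ angularEnergy φ :=
  integral_nonneg fun x => mul_nonneg (invSq_nonneg x) (sq_nonneg _)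

lemma fluctuation_nonneg (φ : Plane → ℝ) : 0 ≤ fluctuation φ :=
  integral_nonneg fun x => mul_nonneg (invSq_nonneg x) (sq_nonneg _)

lemma radialFluctuation_nonneg (φ : Plane → ℝ) : 0 ≤ radialFluctuation φ :=
  integral_nonneg fun x => mul_nonneg (invSq_nonneg x) (sq_nonneg _)

/-! ### The Jacobian bracket integrated against a function with a weak gradient -/

/-- The Jacobian determinant `∂₀a ∂₁b - ∂₁a ∂₀b`. -/
def bracket (a b : Plane → ℝ) (x : Plane) : ℝ :=
  partialDeriv 0 a x * partialDeriv 1 b x - partialDeriv 1 a x * partialDeriv 0 b x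

lemma norm_sq_mul_bracket (a b : Plane → ℝ) (x : Plane) :
    ‖x‖ ^ 2 * bracket a b x =
      eulerDeriv a x * angularDeriv b x - angularDeriv a x * eulerDeriv b x := by
  rw [Plane.norm_sq_eq, bracket, eulerDeriv, eulerDeriv, angularDeriv, angularDeriv]
  ring

lemma bracket_circMean {a b : Plane → ℝ} (ha : ContDiff ℝ ∞ a) (hb : ContDiff ℝ ∞ b)
    {x : Plane} (hx : x ≠ 0) : bracket (circMean a) (circMean b) x = 0 := by
  have h := norm_sq_mul_bracket (circMean a) (circMean b) x
  rw [angularDeriv_circMean ha, angularDeriv_circMean hb, mul_zero, zero_mul, sub_zero] at h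
  exact (mul_eq_zero.1 h).resolve_left (by simpa using hx)

lemma curl_mul_partialDeriv {f g : Plane → ℝ} (hf : ContDiff ℝ ∞ f) (hg : ContDiff ℝ ∞ g)
    (x : Plane) :
    partialDeriv 0 (fun y => f y * partialDeriv 1 g y) x -
      partialDeriv 1 (fun y => f y * partialDeriv 0 g y) x = bracket f g x := by
  have hf' := differentiableAt_of_contDiff hf x
  have hg' (j : Fin 2) := differentiableAt_of_contDiff (contDiff_partialDeriv hg j) x
  rw [partialDeriv_mul _ hf' (hg' 1), partialDeriv_mul _ hf' (hg' 0), partialDeriv_comm hg 0 1,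
    bracket]
  ring

/-- A vector field whose curl is `2 {a, b}`. It differs from `a ∇b - b ∇a` in that the
undifferentiated factors are replaced by their fluctuations about the circular means, which
Wirtinger's inequality controls; this is possible because the bracket of two radial functions
vanishes. -/
def bracketField (a b : Plane → ℝ) (j : Fin 2) (x : Plane) : ℝ :=
  (a x - circMean a x) * partialDeriv j (fun y => b y + circMean b y) x -
    (b x - circMean b x) * partialDeriv j (fun y => a y + circMean a y) x

section bracketField
variable {a b : Plane → ℝ} (ha : ContDiff ℝ ∞ a)
include ha

lemma isTestFunction_bracketField (hb : IsTestFunction b) (j : Fin 2) :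
    IsTestFunction (bracketField a b j) :=
  (((hb.add hb.circMean).partialDeriv j).mul_left (ha.sub (contDiff_circMean ha))).sub
    ((hb.sub hb.circMean).mul_right (contDiff_partialDeriv (ha.add (contDiff_circMean ha)) j))

lemma partialDeriv_add_circMean (j : Fin 2) (x : Plane) :
    partialDeriv j (fun y => a y + circMean a y) x =
      partialDeriv j a x + partialDeriv j (circMean a) x :=
  partialDeriv_add j (differentiableAt_of_contDiff ha x)
    (differentiableAt_of_contDiff (contDiff_circMean ha) x)

lemma partialDeriv_sub_circMean (j : Fin 2) (x : Plane) :
    partialDeriv j (fun y => a y - circMean a y) x =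
      partialDeriv j a x - partialDeriv j (circMean a) x :=
  partialDeriv_sub j (differentiableAt_of_contDiff ha x)
    (differentiableAt_of_contDiff (contDiff_circMean ha) x)

lemma curl_bracketField (hb : ContDiff ℝ ∞ b) {x : Plane} (hx : x ≠ 0) :
    partialDeriv 0 (bracketField a b 1) x - partialDeriv 1 (bracketField a b 0) x =
      2 * bracket a b x := by
  have ha' := contDiff_circMean ha
  have hb' := contDiff_circMean hb
  have hdiff {f g : Plane → ℝ} (hf : ContDiff ℝ ∞ f) (hg : ContDiff ℝ ∞ g) (j : Fin 2) :=
    differentiableAt_of_contDiff (hf.mul (contDiff_partialDeriv hg j)) x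
  have hsplit (i j : Fin 2) : partialDeriv i (bracketField a b j) x = _ :=
    partialDeriv_sub i (hdiff (ha.sub ha') (hb.add hb') j) (hdiff (hb.sub hb') (ha.add ha') j)
  have hab := curl_mul_partialDeriv (ha.sub ha') (hb.add hb') x
  have hba := curl_mul_partialDeriv (hb.sub hb') (ha.add ha') x
  have hcross : bracket (fun y => a y - circMean a y) (fun y => b y + circMean b y) x -
      bracket (fun y => b y - circMean b y) (fun y => a y + circMean a y) x =
        2 * bracket a b x - 2 * bracket (circMean a) (circMean b) x := by
    simp only [bracket, partialDeriv_add_circMean ha, partialDeriv_add_circMean hb,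
      partialDeriv_sub_circMean ha, partialDeriv_sub_circMean hb]
    ring
  rw [bracket_circMean ha hb hx] at hcross
  rw [hsplit, hsplit]
  linear_combination hab - hba + hcross

end bracketField

/-- The density `G₀ V₁ - G₁ V₀` for `V = bracketField a b` in terms of the radial part `gR = x · G`
and the angular part `gT` of `G`. -/
def polarDensity (gR gT a b : Plane → ℝ) (x : Plane) : ℝ :=
  invSq x * (gR x * ((a x - circMean a x) * angularDeriv b x -
      (b x - circMean b x) * angularDeriv a x) -
    gT x * ((a x - circMean a x) * (eulerDeriv b x + circMean (eulerDeriv b) x) -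
      (b x - circMean b x) * (eulerDeriv a x + circMean (eulerDeriv a) x)))

lemma mul_bracketField_sub_eq_polarDensity {G : Fin 2 → Plane → ℝ} {a b : Plane → ℝ}
    (ha : ContDiff ℝ ∞ a) (hb : ContDiff ℝ ∞ b) {x : Plane} (hx : x ≠ 0) :
    G 0 x * bracketField a b 1 x - G 1 x * bracketField a b 0 x =
      polarDensity (fun x => G 0 x * x 0 + G 1 x * x 1) (fun x => G 1 x * x 0 - G 0 x * x 1)
        a b x := by
  have hTa := angularDeriv_circMean ha x
  have hTb := angularDeriv_circMean hb x
  have hone := invSq_mul_norm_sq hx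
  rw [Plane.norm_sq_eq] at hone
  simp only [bracketField, polarDensity, partialDeriv_add_circMean ha,
    partialDeriv_add_circMean hb, ← eulerDeriv_circMean ha, ← eulerDeriv_circMean hb]
  simp only [eulerDeriv, angularDeriv] at hTa hTb ⊢
  linear_combination (-(G 0 x * ((a x - circMean a x) *
    (partialDeriv 1 b x + partialDeriv 1 (circMean b) x) - (b x - circMean b x) *
    (partialDeriv 1 a x + partialDeriv 1 (circMean a) x)) - G 1 x * ((a x - circMean a x) *
    (partialDeriv 0 b x + partialDeriv 0 (circMean b) x) - (b x - circMean b x) *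
    (partialDeriv 0 a x + partialDeriv 0 (circMean a) x)))) * hone +
    invSq x * (G 0 x * x 0 + G 1 x * x 1) * ((a x - circMean a x) * hTb -
      (b x - circMean b x) * hTa)

lemma two_mul_integral_mul_bracket {l : Plane → ℝ} {G : Fin 2 → Plane → ℝ}
    (hl : ∀ j, HasWeakPartial l j (G j)) {a b : Plane → ℝ} (ha : ContDiff ℝ ∞ a)
    (hb : IsTestFunction b) :
    2 * ∫ x in disc, l x * bracket a b x =
      -∫ x in disc, polarDensity (fun x => G 0 x * x 0 + G 1 x * x 1)
        (fun x => G 1 x * x 0 - G 0 x * x 1) a b x := by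
  have hV := isTestFunction_bracketField ha hb
  have hil (i j : Fin 2) := ((hV j).partialDeriv i).integrableOn_mul (hl 0).1
  have hiG (i j : Fin 2) := (hV j).integrableOn_mul (hl i).2.1
  calc 2 * ∫ x in disc, l x * bracket a b x
      = ∫ x in disc, (l x * partialDeriv 0 (bracketField a b 1) x -
          l x * partialDeriv 1 (bracketField a b 0) x) := by
        rw [← integral_const_mul]
        refine integral_congr_ae ?_
        filter_upwards [ae_ne_zero] with x hx
        rw [← mul_sub, curl_bracketField ha hb.contDiff hx, mul_left_comm]
    _ = -∫ x in disc, (G 0 x * bracketField a b 1 x - G 1 x * bracketField a b 0 x) := by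
        rw [integral_sub (hil 0 1) (hil 1 0), integral_sub (hiG 0 1) (hiG 1 0),
          (hl 0).2.2 _ (hV 1), (hl 1).2.2 _ (hV 0)]
        ring
    _ = _ := by
        congr 1
        refine integral_congr_ae ?_
        filter_upwards [ae_ne_zero] with x hx
          using mul_bracketField_sub_eq_polarDensity ha hb.contDiff hx

lemma abs_mul_le_young {s : ℝ} (hs : 0 < s) (x y : ℝ) :
    |x * y| ≤ (s * x ^ 2 + s⁻¹ * y ^ 2) / 2 := by
  have hsq : 0 ≤ s⁻¹ * (s * |x| - |y|) ^ 2 := by positivity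
  have hexp : s⁻¹ * (s * |x| - |y|) ^ 2 = s * x ^ 2 + s⁻¹ * y ^ 2 - 2 * |x * y| := by
    rw [abs_mul, ← sq_abs x, ← sq_abs y]
    field_simp
    ring
  linarith

lemma abs_mul_sub_mul_le_young {s t : ℝ} (hs : 0 < s) (ht : 0 < t) (x y z w : ℝ) :
    |x * y - z * w| ≤ (s * x ^ 2 + s⁻¹ * y ^ 2 + (t * z ^ 2 + t⁻¹ * w ^ 2)) / 2 := by
  rw [add_div]
  exact (abs_sub _ _).trans (add_le_add (abs_mul_le_young hs x y) (abs_mul_le_young ht z w))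

section linearCombination
variable {X : Type*} [MeasurableSpace X] {μ : Measure X} {f₁ f₂ f₃ f₄ : X → ℝ}
  (h₁ : Integrable f₁ μ) (h₂ : Integrable f₂ μ) (h₃ : Integrable f₃ μ) (h₄ : Integrable f₄ μ)
  (s₁ s₂ s₃ s₄ : ℝ)
include h₁ h₂ h₃ h₄

lemma integrable_linear_combination_four :
    Integrable (fun x => s₁ * f₁ x + s₂ * f₂ x + (s₃ * f₃ x + s₄ * f₄ x)) μ :=
  ((h₁.const_mul s₁).add (h₂.const_mul s₂)).add ((h₃.const_mul s₃).add (h₄.const_mul s₄))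

lemma integral_linear_combination_four :
    ∫ x, (s₁ * f₁ x + s₂ * f₂ x + (s₃ * f₃ x + s₄ * f₄ x)) ∂μ =
      s₁ * ∫ x, f₁ x ∂μ + s₂ * ∫ x, f₂ x ∂μ + (s₃ * ∫ x, f₃ x ∂μ + s₄ * ∫ x, f₄ x ∂μ) := by
  have h₁₂ : Integrable (fun x => s₁ * f₁ x + s₂ * f₂ x) μ :=
    (h₁.const_mul s₁).add (h₂.const_mul s₂)
  have h₃₄ : Integrable (fun x => s₃ * f₃ x + s₄ * f₄ x) μ :=
    (h₃.const_mul s₃).add (h₄.const_mul s₄)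
  rw [integral_add h₁₂ h₃₄, integral_add (h₁.const_mul s₁) (h₂.const_mul s₂),
    integral_add (h₃.const_mul s₃) (h₄.const_mul s₄)]
  simp only [integral_const_mul]

end linearCombination

/-- `|R ∂_R l| ≤ KR` and `|∂_θ l| ≤ KT` almost everywhere on the disc, in the weak sense. -/
def ScaledGradBound (l : Plane → ℝ) (KR KT : ℝ) : Prop :=
  ∃ G : Fin 2 → Plane → ℝ, (∀ j, HasWeakPartial l j (G j)) ∧
    (∀ᵐ x ∂discMeasure, |G 0 x * x 0 + G 1 x * x 1| ≤ KR) ∧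
    ∀ᵐ x ∂discMeasure, |G 1 x * x 0 - G 0 x * x 1| ≤ KT

instance : NeZero discMeasure :=
  ⟨Measure.restrict_eq_zero.not.2 (isOpen_disc.measure_pos volume ⟨0, by simp [disc]⟩).ne'⟩

lemma ScaledGradBound.nonneg {l : Plane → ℝ} {KR KT : ℝ} (hl : ScaledGradBound l KR KT) :
    0 ≤ KR ∧ 0 ≤ KT := by
  obtain ⟨G, -, hR, hT⟩ := hl
  obtain ⟨x, hxR, hxT⟩ := (hR.and hT).exists
  exact ⟨(abs_nonneg _).trans hxR, (abs_nonneg _).trans hxT⟩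

lemma abs_polarDensity_le {gR gT a b : Plane → ℝ} {KR KT : ℝ} {x : Plane} (hR : |gR x| ≤ KR)
    (hT : |gT x| ≤ KT) {s₁ s₂ s₃ s₄ : ℝ} (h₁ : 0 < s₁) (h₂ : 0 < s₂) (h₃ : 0 < s₃) (h₄ : 0 < s₄) :
    |polarDensity gR gT a b x| ≤
      KR / 2 * (s₁ * (invSq x * (a x - circMean a x) ^ 2) +
        s₁⁻¹ * (invSq x * angularDeriv b x ^ 2) +
        (s₂ * (invSq x * (b x - circMean b x) ^ 2) + s₂⁻¹ * (invSq x * angularDeriv a x ^ 2))) +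
      KT / 2 * (s₃ * (invSq x * (a x - circMean a x) ^ 2) +
        s₃⁻¹ * (invSq x * (eulerDeriv b x + circMean (eulerDeriv b) x) ^ 2) +
        (s₄ * (invSq x * (b x - circMean b x) ^ 2) +
          s₄⁻¹ * (invSq x * (eulerDeriv a x + circMean (eulerDeriv a) x) ^ 2))) := by
  have hKR := (abs_nonneg _).trans hR
  have hKT := (abs_nonneg _).trans hT
  have hyoungR := abs_mul_sub_mul_le_young h₁ h₂ (a x - circMean a x) (angularDeriv b x)
    (b x - circMean b x) (angularDeriv a x)
  have hyoungT := abs_mul_sub_mul_le_young h₃ h₄ (a x - circMean a x)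
    (eulerDeriv b x + circMean (eulerDeriv b) x) (b x - circMean b x)
    (eulerDeriv a x + circMean (eulerDeriv a) x)
  rw [polarDensity, abs_mul, abs_of_nonneg (invSq_nonneg x)]
  refine (mul_le_mul_of_nonneg_left ((abs_sub _ _).trans (add_le_add
    ((abs_mul _ _).trans_le (mul_le_mul hR hyoungR (abs_nonneg _) hKR))
    ((abs_mul _ _).trans_le (mul_le_mul hT hyoungT (abs_nonneg _) hKT))))
    (invSq_nonneg x)).trans (le_of_eq ?_)
  ring

section pairing
variable {l : Plane → ℝ} {KR KT : ℝ} (hl : ScaledGradBound l KR KT) {a b : Plane → ℝ}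
  (ha : ContDiff ℝ ∞ a) (hb : IsTestFunction b)
include hl ha hb

lemma two_mul_abs_integral_mul_bracket_le {s₁ s₂ s₃ s₄ : ℝ} (h₁ : 0 < s₁) (h₂ : 0 < s₂)
    (h₃ : 0 < s₃) (h₄ : 0 < s₄) :
    2 * |∫ x in disc, l x * bracket a b x| ≤
      KR / 2 * (s₁ * fluctuation a + s₁⁻¹ * angularEnergy b +
        (s₂ * fluctuation b + s₂⁻¹ * angularEnergy a)) +
      KT / 2 * (s₃ * fluctuation a + s₃⁻¹ * radialSumEnergy b +
        (s₄ * fluctuation b + s₄⁻¹ * radialSumEnergy a)) := by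
  obtain ⟨G, hG, hR, hT⟩ := hl
  have hFa := integrableOn_fluctuation ha
  have hFb := integrableOn_fluctuation hb.contDiff
  have hTa := integrableOn_angularEnergy ha
  have hTb := integrableOn_angularEnergy hb.contDiff
  have hPa := integrableOn_radialSumEnergy ha
  have hPb := integrableOn_radialSumEnergy hb.contDiff
  have hiR := (integrable_linear_combination_four hFa hTb hFb hTa s₁ s₁⁻¹ s₂ s₂⁻¹).const_mul
    (KR / 2)
  have hiT := (integrable_linear_combination_four hFa hPb hFb hPa s₃ s₃⁻¹ s₄ s₄⁻¹).const_mul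
    (KT / 2)
  have habs : 2 * |∫ x in disc, l x * bracket a b x| = |2 * ∫ x in disc, l x * bracket a b x| := by
    rw [abs_mul, abs_two]
  rw [habs, two_mul_integral_mul_bracket hG ha hb, abs_neg, ← Real.norm_eq_abs]
  refine le_trans (norm_integral_le_of_norm_le (hiR.add hiT) ?_) (le_of_eq ?_)
  · filter_upwards [hR, hT] with x hxR hxT using abs_polarDensity_le hxR hxT h₁ h₂ h₃ h₄
  · simp only [Pi.add_apply]
    rw [integral_add hiR hiT, integral_const_mul, integral_const_mul,
      integral_linear_combination_four hFa hTb hFb hTa,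
      integral_linear_combination_four hFa hPb hFb hPa]
    rfl

lemma two_mul_abs_integral_mul_bracket_self_le {c : ℝ} (hc : 0 < c) :
    2 * |∫ x in disc, l x * bracket a b x| ≤ KR * (angularEnergy a + angularEnergy b) +
      KT / 2 * (c * (fluctuation a + fluctuation b) +
        c⁻¹ * (radialSumEnergy a + radialSumEnergy b)) := by
  have h := two_mul_abs_integral_mul_bracket_le hl ha hb one_pos one_pos hc hc
  have hR := mul_le_mul_of_nonneg_left (add_le_add (fluctuation_le_angularEnergy ha)
    (fluctuation_le_angularEnergy hb.contDiff)) (div_nonneg hl.nonneg.1 zero_le_two)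
  rw [inv_one] at h
  linarith

end pairing

lemma dirichlet_nonneg (φ : Plane → ℝ) : 0 ≤ dirichlet φ :=
  integral_nonneg fun _ => add_nonneg (sq_nonneg _) (sq_nonneg _)

section dirichlet
variable {φ : Plane → ℝ} (hφ : ContDiff ℝ ∞ φ)
include hφ

lemma radialEnergy_le_dirichlet : radialEnergy φ ≤ dirichlet φ := by
  linarith [radialEnergy_add_angularEnergy hφ, angularEnergy_nonneg φ]

lemma angularEnergy_le_dirichlet : angularEnergy φ ≤ dirichlet φ := by
  linarith [radialEnergy_add_angularEnergy hφ, radialEnergy_nonneg φ]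

lemma fluctuation_le_dirichlet : fluctuation φ ≤ dirichlet φ :=
  (fluctuation_le_angularEnergy hφ).trans (angularEnergy_le_dirichlet hφ)

lemma radialSumEnergy_le_dirichlet : radialSumEnergy φ ≤ 4 * dirichlet φ := by
  linarith [radialSumEnergy_add_le hφ, radialFluctuation_nonneg φ, radialEnergy_le_dirichlet hφ]

end dirichlet

lemma abs_integral_mul_bracket_le_dirichlet {l : Plane → ℝ} {KR KT : ℝ}
    (hl : ScaledGradBound l KR KT) {a b : Plane → ℝ} (ha : ContDiff ℝ ∞ a) (hb : IsTestFunction b)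
    {c : ℝ} (hc : 0 < c) :
    |∫ x in disc, l x * bracket a b x| ≤
      2 * (KR + KT) * (c * dirichlet a + c⁻¹ * dirichlet b) := by
  obtain ⟨hKR, hKT⟩ := hl.nonneg
  have hbs := hb.contDiff
  have hci := inv_pos.2 hc
  have hpair := two_mul_abs_integral_mul_bracket_le hl ha hb hc hci hc hci
  rw [inv_inv] at hpair
  have hFa := mul_le_mul_of_nonneg_left (fluctuation_le_dirichlet ha) hc.le
  have hFb := mul_le_mul_of_nonneg_left (fluctuation_le_dirichlet hbs) hci.le
  have hTa := mul_le_mul_of_nonneg_left (angularEnergy_le_dirichlet ha) hc.le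
  have hTb := mul_le_mul_of_nonneg_left (angularEnergy_le_dirichlet hbs) hci.le
  have hSa := mul_le_mul_of_nonneg_left (radialSumEnergy_le_dirichlet ha) hc.le
  have hSb := mul_le_mul_of_nonneg_left (radialSumEnergy_le_dirichlet hbs) hci.le
  have hDa := mul_nonneg hc.le (dirichlet_nonneg a)
  have hDb := mul_nonneg hci.le (dirichlet_nonneg b)
  have hradial : c * fluctuation a + c⁻¹ * angularEnergy b +
      (c⁻¹ * fluctuation b + c * angularEnergy a) ≤
      8 * (c * dirichlet a + c⁻¹ * dirichlet b) := by linarith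
  have hangular : c * fluctuation a + c⁻¹ * radialSumEnergy b +
      (c⁻¹ * fluctuation b + c * radialSumEnergy a) ≤
      8 * (c * dirichlet a + c⁻¹ * dirichlet b) := by linarith
  linarith [mul_le_mul_of_nonneg_left hradial (div_nonneg hKR zero_le_two),
    mul_le_mul_of_nonneg_left hangular (div_nonneg hKT zero_le_two)]

/-! ### Mollification and the chain rule for weak derivatives -/

/-- The convolution `q ⋆ ρ`. -/
def mollify (ρ q : Plane → ℝ) (x : Plane) : ℝ := ∫ t, q t * ρ (x - t)

lemma contDiff_mollify {ρ q : Plane → ℝ} (hρ : ContDiff ℝ ∞ ρ) (hc : HasCompactSupport ρ)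
    (hq : Integrable q) : ContDiff ℝ ∞ (mollify ρ q) :=
  hc.contDiff_convolution_right (ContinuousLinearMap.mul ℝ ℝ) hq.locallyIntegrable hρ

lemma partialDeriv_mollify {ρ q : Plane → ℝ} (hρ : ContDiff ℝ ∞ ρ) (hc : HasCompactSupport ρ)
    (hq : Integrable q) (j : Fin 2) (x : Plane) :
    partialDeriv j (mollify ρ q) x = mollify (partialDeriv j ρ) q x := by
  have hderiv := hc.hasFDerivAt_convolution_right (ContinuousLinearMap.mul ℝ ℝ)
    hq.locallyIntegrable (hρ.of_le (by simp)) x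
  have hfderiv : fderiv ℝ (mollify ρ q) x = _ := hderiv.fderiv
  rw [partialDeriv, hfderiv, convolution_precompR_apply _ hq.locallyIntegrable (hc.fderiv ℝ)
    (hρ.continuous_fderiv (by simp))]
  rfl

lemma partialDeriv_comp_const_sub {φ : Plane → ℝ} (hφ : ContDiff ℝ ∞ φ) (j : Fin 2)
    (x y : Plane) :
    partialDeriv j (fun y => φ (x - y)) y = -partialDeriv j φ (x - y) := by
  have hderiv := (differentiableAt_of_contDiff hφ (x - y)).hasFDerivAt.comp y
    ((hasFDerivAt_id y).const_sub x)
  have hfderiv : fderiv ℝ (fun y => φ (x - y)) y = _ := hderiv.fderiv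
  simp [partialDeriv, hfderiv]

/-- The smooth bump function equal to `1` for `‖x‖ ≤ 1 / (2 (n + 1))` and supported in
`‖x‖ ≤ 1 / (n + 1)`. -/
def shrinkingBump (n : ℕ) : ContDiffBump (0 : Plane) where
  rIn := 1 / (2 * (n + 1))
  rOut := 1 / (n + 1)
  rIn_pos := by positivity
  rIn_lt_rOut := by
    have hn : (0 : ℝ) < n + 1 := by positivity
    exact one_div_lt_one_div_of_lt hn (by linarith)

/-- The smooth mollifier of mass one supported in `‖x‖ ≤ 1 / (n + 1)`. -/
def mollifier (n : ℕ) : Plane → ℝ := (shrinkingBump n).normed volume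

lemma contDiff_mollifier (n : ℕ) : ContDiff ℝ ∞ (mollifier n) :=
  (shrinkingBump n).contDiff_normed (n := ⊤)

lemma mollifier_nonneg (n : ℕ) (x : Plane) : 0 ≤ mollifier n x :=
  (shrinkingBump n).nonneg_normed x

lemma hasCompactSupport_mollifier (n : ℕ) : HasCompactSupport (mollifier n) :=
  (shrinkingBump n).hasCompactSupport_normed

lemma tsupport_mollifier (n : ℕ) :
    tsupport (mollifier n) = Metric.closedBall 0 (1 / (n + 1)) :=
  (shrinkingBump n).tsupport_normed_eq

lemma ae_tendsto_mollify {q : Plane → ℝ} (hq : Integrable q) :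
    ∀ᵐ x, Tendsto (fun n => mollify (mollifier n) q x) atTop (𝓝 (q x)) := by
  have hlim := ContDiffBump.ae_convolution_tendsto_right_of_locallyIntegrable
    (φ := shrinkingBump) (l := atTop) (K := 2) (g := q) (μ := volume)
    tendsto_one_div_add_atTop_nhds_zero_nat (Eventually.of_forall fun n => by
      simp only [shrinkingBump]
      apply le_of_eq
      field_simp) hq.locallyIntegrable
  filter_upwards [hlim] with x hx
  refine hx.congr fun n => ?_
  rw [convolution_lsmul_swap, mollify]
  simp only [mollifier, smul_eq_mul, mul_comm]

lemma abs_mollify_le {q : Plane → ℝ} {n : ℕ} {C : ℝ} {x : Plane}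
    (hC : ∀ᵐ y, ‖x - y‖ ≤ 1 / (n + 1) → |q y| ≤ C) :
    |mollify (mollifier n) q x| ≤ C := by
  have hmass : ∫ y, mollifier n (x - y) = 1 := by
    rw [integral_sub_left_eq_self (mollifier n)]
    exact (shrinkingBump n).integral_normed
  have hint : Integrable fun y => C * mollifier n (x - y) :=
    (((shrinkingBump n).integrable_normed (μ := volume)).comp_sub_left x).const_mul C
  have hle := norm_integral_le_of_norm_le (f := fun y => q y * mollifier n (x - y)) hint ?_
  · rwa [integral_const_mul, hmass, mul_one] at hle
  · filter_upwards [hC] with y hy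
    rw [norm_mul, Real.norm_of_nonneg (mollifier_nonneg n _), Real.norm_eq_abs]
    by_cases hxy : ‖x - y‖ ≤ 1 / (n + 1)
    · exact mul_le_mul_of_nonneg_right (hy hxy) (mollifier_nonneg n _)
    · have hzero : mollifier n (x - y) = 0 := by
        refine image_eq_zero_of_notMem_tsupport ?_
        rw [tsupport_mollifier]
        simpa using hxy
      rw [hzero, mul_zero, mul_zero]

/-- The mollification at scale `1 / (n + 1)` of the restriction of `q` to the closed ball of
radius `s`. For `s < 1` only the values of `q` on the disc matter. -/
def localMollify (s : ℝ) (n : ℕ) (q : Plane → ℝ) : Plane → ℝ :=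
  mollify (mollifier n) ((Metric.closedBall 0 s).indicator q)

section localMollify
variable {s : ℝ} (hs : s < 1) {q : Plane → ℝ}
include hs

lemma closedBall_subset_disc : Metric.closedBall (0 : Plane) s ⊆ disc :=
  Metric.closedBall_subset_ball hs

lemma integrable_indicator_closedBall (hq : LocallyIntegrableOn q disc) :
    Integrable ((Metric.closedBall 0 s).indicator q) :=
  (hq.integrableOn_compact_subset (closedBall_subset_disc hs)
    (isCompact_closedBall 0 s)).integrable_indicator Metric.isClosed_closedBall.measurableSet

lemma contDiff_localMollify (hq : LocallyIntegrableOn q disc) (n : ℕ) :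
    ContDiff ℝ ∞ (localMollify s n q) :=
  contDiff_mollify (contDiff_mollifier n) (hasCompactSupport_mollifier n)
    (integrable_indicator_closedBall hs hq)

lemma ae_tendsto_localMollify (hq : LocallyIntegrableOn q disc) :
    ∀ᵐ x, ‖x‖ ≤ s → Tendsto (fun n => localMollify s n q x) atTop (𝓝 (q x)) := by
  filter_upwards [ae_tendsto_mollify (integrable_indicator_closedBall hs hq)] with x hx hxs
  rwa [Set.indicator_of_mem (mem_closedBall_zero_iff.2 hxs)] at hx

lemma mollify_indicator_eq_setIntegral {ρ : Plane → ℝ} {x : Plane}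
    (hρ : ∀ y, s < ‖y‖ → ρ (x - y) = 0) :
    mollify ρ ((Metric.closedBall 0 s).indicator q) x = ∫ y in disc, q y * ρ (x - y) := by
  have hzero {y : Plane} (hy : y ∉ Metric.closedBall 0 s) : ρ (x - y) = 0 :=
    hρ y (by simpa using hy)
  rw [mollify, setIntegral_eq_integral_of_forall_compl_eq_zero fun y hy => by
    rw [hzero fun h => hy (closedBall_subset_disc hs h), mul_zero]]
  refine integral_congr_ae (Eventually.of_forall fun y => ?_)
  by_cases hy : y ∈ Metric.closedBall (0 : Plane) s
  · simp only [Set.indicator_of_mem hy]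
  · simp only [hzero hy, mul_zero]

lemma partialDeriv_localMollify {d : Plane → ℝ} {j : Fin 2} (hq : HasWeakPartial q j d) {n : ℕ}
    {x : Plane} (hx : ‖x‖ + 1 / (n + 1) ≤ s) :
    partialDeriv j (localMollify s n q) x = localMollify s n d x := by
  have hρ := contDiff_mollifier n
  have hsupp {y : Plane} (hy : s < ‖y‖) : x - y ∉ tsupport (mollifier n) := fun h => by
    rw [tsupport_mollifier, mem_closedBall_zero_iff] at h
    linarith [norm_le_norm_add_norm_sub x y]
  have htest : IsTestFunction fun y => mollifier n (x - y) :=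
    .of_forall_eq_zero (hρ.comp (contDiff_const.sub contDiff_id)) hs fun y hy =>
      image_eq_zero_of_notMem_tsupport (hsupp hy)
  have hweak := hq.2.2 _ htest
  simp only [partialDeriv_comp_const_sub hρ, mul_neg, integral_neg, neg_inj] at hweak
  rw [localMollify, localMollify, partialDeriv_mollify hρ (hasCompactSupport_mollifier n)
      (integrable_indicator_closedBall hs hq.1),
    mollify_indicator_eq_setIntegral hs fun y hy => image_eq_zero_of_notMem_tsupport fun h =>
      hsupp hy (tsupport_partialDeriv_subset _ j h),
    mollify_indicator_eq_setIntegral hs fun y hy => image_eq_zero_of_notMem_tsupport (hsupp hy),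
    hweak]

lemma abs_localMollify_le {K : ℝ} (hq : ∀ᵐ x ∂discMeasure, |q x| * ‖x‖ ≤ K) {δ : ℝ} (hδ : 0 < δ)
    {n : ℕ} (hn : 1 / (n + 1) ≤ δ / 2) {x : Plane} (hx : δ ≤ ‖x‖) (hxs : ‖x‖ + 1 / (n + 1) ≤ s) :
    |localMollify s n q x| ≤ K / (δ / 2) := by
  refine abs_mollify_le ?_
  filter_upwards [(ae_restrict_iff' measurableSet_disc).1 hq] with y hy hxy
  have hlower : δ / 2 ≤ ‖y‖ := by linarith [norm_le_norm_add_norm_sub y x, norm_sub_rev y x]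
  have hupper : y ∈ Metric.closedBall (0 : Plane) s :=
    mem_closedBall_zero_iff.2 (by linarith [norm_le_norm_add_norm_sub x y])
  rw [Set.indicator_of_mem hupper, le_div_iff₀ (by positivity)]
  exact (mul_le_mul_of_nonneg_left hlower (abs_nonneg _)).trans
    (hy (closedBall_subset_disc hs hupper))

end localMollify

lemma tendsto_integral_mul_of_bounded {X : Type*} [MeasurableSpace X] {μ : Measure X}
    {F : ℕ → X → ℝ} {F₀ ψ : X → ℝ} (hψ : Integrable ψ μ) (hF : ∀ n, AEStronglyMeasurable (F n) μ)
    {C : ℝ} (hbound : ∀ᶠ n in atTop, ∀ x, ψ x ≠ 0 → |F n x| ≤ C)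
    (hlim : ∀ᵐ x ∂μ, ψ x ≠ 0 → Tendsto (fun n => F n x) atTop (𝓝 (F₀ x))) :
    Tendsto (fun n => ∫ x, F n x * ψ x ∂μ) atTop (𝓝 (∫ x, F₀ x * ψ x ∂μ)) := by
  refine tendsto_integral_filter_of_dominated_convergence (fun x => C * |ψ x|)
    (Eventually.of_forall fun n => (hF n).mul hψ.1) ?_ (hψ.abs.const_mul C) ?_
  · filter_upwards [hbound] with n hn
    refine Eventually.of_forall fun x => ?_
    by_cases hx : ψ x = 0
    · simp [hx]
    · rw [norm_mul]
      exact mul_le_mul_of_nonneg_right (hn x hx) (abs_nonneg _)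
  · filter_upwards [hlim] with x hx
    by_cases h0 : ψ x = 0
    · simp [h0]
    · exact (hx h0).mul_const _

lemma tendsto_integral_comp_localMollify_mul {q : Plane → ℝ} {s : ℝ} (hs : s < 1)
    (hq : LocallyIntegrableOn q disc) {f : ℝ → ℝ} (hf : Continuous f) {C : ℝ} (hC : ∀ t, |f t| ≤ C)
    {ψ : Plane → ℝ} (hψ : Integrable ψ) (hsupp : ∀ x, ψ x ≠ 0 → ‖x‖ ≤ s) :
    Tendsto (fun n => ∫ x, f (localMollify s n q x) * ψ x) atTop (𝓝 (∫ x, f (q x) * ψ x)) := by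
  refine tendsto_integral_mul_of_bounded hψ (fun n =>
    (hf.comp (contDiff_localMollify hs hq n).continuous).aestronglyMeasurable)
    (Eventually.of_forall fun n x _ => hC _) ?_
  filter_upwards [ae_tendsto_localMollify hs hq] with x hx h0
  exact (hf.tendsto _).comp (hx (hsupp x h0))

section chainRule
variable {p d : Plane → ℝ} {j : Fin 2} (hp : HasWeakPartial p j d) {f : ℝ → ℝ}
  (hf : ContDiff ℝ ∞ f) {φ : Plane → ℝ} (hφ : IsTestFunction φ)
include hp hf hφ

lemma integral_comp_localMollify_mul_partialDeriv {s : ℝ} (hs : s < 1) {n : ℕ}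
    (hsupp : ∀ x, φ x ≠ 0 → ‖x‖ + 1 / (n + 1) ≤ s) :
    ∫ x, f (localMollify s n p x) * partialDeriv j φ x =
      -∫ x, deriv f (localMollify s n p x) * localMollify s n d x * φ x := by
  have hP := contDiff_localMollify hs hp.1 n
  have hQ := contDiff_localMollify hs hp.2.1 n
  have hfP : ContDiff ℝ ∞ fun x => f (localMollify s n p x) := hf.comp hP
  have hpt (x : Plane) : partialDeriv j (fun x => f (localMollify s n p x) * φ x) x =
      f (localMollify s n p x) * partialDeriv j φ x +
        deriv f (localMollify s n p x) * localMollify s n d x * φ x := by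
    rw [partialDeriv_mul _ (differentiableAt_of_contDiff hfP x)
      (differentiableAt_of_contDiff hφ.contDiff x),
      partialDeriv_comp _ (hf.differentiable (by simp) _) (differentiableAt_of_contDiff hP x)]
    by_cases hx : φ x = 0
    · simp only [hx, mul_zero, zero_add, add_zero]
    · rw [partialDeriv_localMollify hs hp (hsupp x hx), add_comm]
  have hint₁ := (hφ.partialDeriv j).mul_left hfP
  have hcont₂ : Continuous fun x =>
      deriv f (localMollify s n p x) * localMollify s n d x * φ x :=
    (((hf.continuous_deriv (by simp)).comp hP.continuous).mul hQ.continuous).mul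
      hφ.contDiff.continuous
  have hzero := integral_partialDeriv_eq_zero (hφ.mul_left hfP).contDiff
    (hφ.mul_left hfP).hasCompactSupport j
  simp only [hpt] at hzero
  rw [integral_add (hint₁.contDiff.continuous.integrable_of_hasCompactSupport
    hint₁.hasCompactSupport) (hcont₂.integrable_of_hasCompactSupport
      hφ.hasCompactSupport.mul_left)] at hzero
  exact eq_neg_of_add_eq_zero_left hzero

lemma integral_comp_mul_partialDeriv_of_eq_zero_near {K : ℝ}
    (hd : ∀ᵐ x ∂discMeasure, |d x| * ‖x‖ ≤ K) {C : ℝ} (hC : ∀ t, |f t| ≤ C)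
    (hf' : ∀ t, |deriv f t| ≤ 1) {δ : ℝ} (hδ : 0 < δ) (hφ0 : ∀ x, ‖x‖ < δ → φ x = 0) :
    ∫ x in disc, f (p x) * partialDeriv j φ x = -∫ x in disc, deriv f (p x) * d x * φ x := by
  obtain ⟨r, ⟨-, hr1⟩, hsupp⟩ := hφ.exists_tsupport_subset_ball
  obtain ⟨s, hrs, hs1⟩ := exists_between hr1
  have hnorm {x : Plane} (hx : x ∈ tsupport φ) : ‖x‖ < r := mem_ball_zero_iff.1 (hsupp hx)
  have hsmall : ∀ᶠ n : ℕ in atTop, (1 : ℝ) / (n + 1) < min (s - r) (δ / 2) :=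
    (tendsto_order.1 tendsto_one_div_add_atTop_nhds_zero_nat).2 _
      (lt_min (by linarith) (by linarith))
  have hinner {n : ℕ} (hn : (1 : ℝ) / (n + 1) < min (s - r) (δ / 2)) (x : Plane) (hx : φ x ≠ 0) :
      ‖x‖ + 1 / (n + 1) ≤ s := by
    linarith [hn.trans_le (min_le_left _ _), hnorm (subset_tsupport φ hx)]
  have hP := contDiff_localMollify hs1 hp.1
  have hQ := contDiff_localMollify hs1 hp.2.1
  have hlimP := ae_tendsto_localMollify hs1 hp.1
  have hlimQ := ae_tendsto_localMollify hs1 hp.2.1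
  have hf'c := hf.continuous_deriv (by simp)
  have hlim₁ : Tendsto (fun n => ∫ x, f (localMollify s n p x) * partialDeriv j φ x) atTop
      (𝓝 (∫ x, f (p x) * partialDeriv j φ x)) :=
    tendsto_integral_comp_localMollify_mul hs1 hp.1 hf.continuous hC
      ((hφ.partialDeriv j).contDiff.continuous.integrable_of_hasCompactSupport
        (hφ.partialDeriv j).hasCompactSupport) fun x hx =>
      (hnorm (tsupport_partialDeriv_subset φ j (subset_tsupport _ hx))).le.trans hrs.le
  have hlim₂ : Tendsto (fun n => ∫ x, deriv f (localMollify s n p x) * localMollify s n d x * φ x)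
      atTop (𝓝 (∫ x, deriv f (p x) * d x * φ x)) := by
    refine tendsto_integral_mul_of_bounded (C := 1 * (K / (δ / 2)))
      (hφ.contDiff.continuous.integrable_of_hasCompactSupport hφ.hasCompactSupport)
      (fun n => ((hf'c.comp (hP n).continuous).mul (hQ n).continuous).aestronglyMeasurable) ?_ ?_
    · filter_upwards [hsmall] with n hn x hx
      rw [abs_mul]
      exact mul_le_mul (hf' _) (abs_localMollify_le hs1 hd hδ (hn.le.trans (min_le_right _ _))
        (not_lt.1 fun h => hx (hφ0 x h)) (hinner hn x hx)) (abs_nonneg _) zero_le_one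
    · filter_upwards [hlimP, hlimQ] with x hxP hxQ h0
      have hxs := (hnorm (subset_tsupport φ h0)).le.trans hrs.le
      exact ((hf'c.tendsto _).comp (hxP hxs)).mul (hxQ hxs)
  rw [hφ.setIntegral_mul, (hφ.partialDeriv j).setIntegral_mul]
  refine tendsto_nhds_unique (hlim₁.congr' ?_) hlim₂.neg
  filter_upwards [hsmall] with n hn
  exact integral_comp_localMollify_mul_partialDeriv hp hf hφ hs1 (hinner hn)

end chainRule

lemma partialDeriv_comp_smul {φ : Plane → ℝ} (hφ : ContDiff ℝ ∞ φ) (c : ℝ) (j : Fin 2)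
    (x : Plane) : partialDeriv j (fun y => φ (c • y)) x = c * partialDeriv j φ (c • x) := by
  have hderiv := (differentiableAt_of_contDiff hφ (c • x)).hasFDerivAt.comp x
    ((hasFDerivAt_id x).const_smul c)
  have hfderiv : fderiv ℝ (fun y => φ (c • y)) x = _ := hderiv.fderiv
  simp [partialDeriv, hfderiv]

/-- The smooth bump function equal to `1` on the unit disc and supported in `‖x‖ ≤ 2`. -/
def unitBump : ContDiffBump (0 : Plane) := ⟨1, 2, one_pos, one_lt_two⟩

lemma contDiff_unitBump : ContDiff ℝ ∞ unitBump := unitBump.contDiff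

/-- A cutoff equal to `0` for `‖x‖ ≤ 1 / (n + 1)` and to `1` for `‖x‖ ≥ 2 / (n + 1)`, used to
remove the origin from the support of a test function. -/
def puncture (n : ℕ) (x : Plane) : ℝ := 1 - unitBump (((n : ℝ) + 1) • x)

lemma norm_succ_smul (n : ℕ) (x : Plane) : ‖((n : ℝ) + 1) • x‖ = (n + 1) * ‖x‖ := by
  rw [norm_smul, Real.norm_of_nonneg (by positivity)]

lemma contDiff_puncture (n : ℕ) : ContDiff ℝ ∞ (puncture n) :=
  contDiff_const.sub (contDiff_unitBump.comp (contDiff_const_smul _))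

lemma abs_puncture_le_one (n : ℕ) (x : Plane) : |puncture n x| ≤ 1 :=
  abs_le.2 ⟨by linarith [unitBump.le_one (x := ((n : ℝ) + 1) • x), puncture.eq_1 n x],
    sub_le_self _ unitBump.nonneg⟩

lemma puncture_eq_zero {n : ℕ} {x : Plane} (hx : ‖x‖ < 1 / (n + 1)) : puncture n x = 0 := by
  rw [puncture, unitBump.one_of_mem_closedBall, sub_self]
  rw [mem_closedBall_zero_iff, norm_succ_smul, mul_comm]
  exact ((lt_div_iff₀ (by positivity)).1 hx).le

lemma tendsto_puncture {x : Plane} (hx : x ≠ 0) :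
    Tendsto (fun n => puncture n x) atTop (𝓝 1) := by
  refine tendsto_const_nhds.congr' ?_
  filter_upwards [eventually_ge_atTop ⌈2 / ‖x‖⌉₊] with n hn
  have hle := (div_le_iff₀ (norm_pos_iff.2 hx)).1 (Nat.ceil_le.1 hn)
  rw [puncture, unitBump.zero_of_le_dist, sub_zero]
  rw [dist_zero_right, norm_succ_smul]
  exact hle.trans (mul_le_mul_of_nonneg_right (le_add_of_nonneg_right zero_le_one) (norm_nonneg _))

lemma partialDeriv_puncture (n : ℕ) (j : Fin 2) (x : Plane) :
    partialDeriv j (puncture n) x = -((n + 1) * partialDeriv j unitBump (((n : ℝ) + 1) • x)) := by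
  have hsub : partialDeriv j (puncture n) x = _ :=
    partialDeriv_sub j (differentiableAt_const (1 : ℝ)) (differentiableAt_of_contDiff
      (contDiff_unitBump.comp (contDiff_const_smul ((n : ℝ) + 1))) x)
  rw [hsub, partialDeriv_comp_smul contDiff_unitBump]
  simp [partialDeriv]

lemma tendsto_setIntegral_puncture_mul {F : Plane → ℝ} (hF : IntegrableOn F disc) :
    Tendsto (fun n => ∫ x in disc, puncture n x * F x) atTop (𝓝 (∫ x in disc, F x)) := by
  have hlim := tendsto_integral_mul_of_bounded (F₀ := fun _ => 1) hF
    (fun n => (contDiff_puncture n).continuous.aestronglyMeasurable)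
    (Eventually.of_forall fun n x _ => abs_puncture_le_one n x)
    (by filter_upwards [ae_ne_zero] with x hx _ using tendsto_puncture hx)
  simpa only [one_mul] using hlim

/-- In dimension two the gradients of the cutoffs have `L¹` norm of order `1 / n`. -/
lemma tendsto_setIntegral_mul_partialDeriv_puncture {g : Plane → ℝ} {M : ℝ}
    (hg : ∀ x ∈ disc, |g x| ≤ M) (j : Fin 2) :
    Tendsto (fun n => ∫ x in disc, g x * partialDeriv j (puncture n) x) atTop (𝓝 0) := by
  have hlim := tendsto_one_div_add_atTop_nhds_zero_nat.const_mul
    (M * ∫ x, |partialDeriv j unitBump x|)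
  rw [mul_zero] at hlim
  refine squeeze_zero_norm (fun n => ?_) hlim
  have hn : (0 : ℝ) < n + 1 := by positivity
  have hM : 0 ≤ M := (abs_nonneg _).trans (hg 0 (by simp [disc]))
  have hint : Integrable fun x =>
      M * ((n + 1) * |partialDeriv j unitBump (((n : ℝ) + 1) • x)|) :=
    (((((contDiff_partialDeriv contDiff_unitBump j).continuous.integrable_of_hasCompactSupport
      (hasCompactSupport_partialDeriv unitBump.hasCompactSupport j)).abs.comp_smul
        hn.ne').const_mul _).const_mul _)
  calc ‖∫ x in disc, g x * partialDeriv j (puncture n) x‖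
      ≤ ∫ x in disc, M * ((n + 1) * |partialDeriv j unitBump (((n : ℝ) + 1) • x)|) := by
        refine norm_integral_le_of_norm_le hint.integrableOn
          (ae_restrict_of_forall_mem measurableSet_disc fun x hx => ?_)
        rw [partialDeriv_puncture, norm_mul, norm_neg, norm_mul, Real.norm_of_nonneg hn.le]
        exact mul_le_mul_of_nonneg_right (hg x hx) (by positivity)
    _ ≤ ∫ x, M * ((n + 1) * |partialDeriv j unitBump (((n : ℝ) + 1) • x)|) :=
        setIntegral_le_integral hint (Eventually.of_forall fun x => by positivity)
    _ = (M * ∫ x, |partialDeriv j unitBump x|) * (1 / (n + 1)) := by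
        rw [integral_const_mul, integral_const_mul,
          Measure.integral_comp_smul volume (fun x => |partialDeriv j unitBump x|),
          finrank_euclideanSpace, Fintype.card_fin, smul_eq_mul, abs_of_pos (by positivity)]
        field_simp

/-- The origin is removable for bounded functions. -/
lemma hasWeakPartial_of_eq_zero_near {f d : Plane → ℝ} {j : Fin 2}
    (hf : AEStronglyMeasurable f discMeasure) {C : ℝ} (hC : ∀ x ∈ disc, |f x| ≤ C)
    (hd : LocallyIntegrableOn d disc)
    (hparts : ∀ φ, IsTestFunction φ → ∀ δ > 0, (∀ x, ‖x‖ < δ → φ x = 0) →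
      ∫ x in disc, f x * partialDeriv j φ x = -∫ x in disc, d x * φ x) :
    HasWeakPartial f j d := by
  have hfi : LocallyIntegrableOn f disc :=
    IntegrableOn.locallyIntegrableOn (integrable_discMeasure_of_bound hf hC)
  refine ⟨hfi, hd, fun φ hφ => ?_⟩
  obtain ⟨S, hS⟩ := exists_bound_on_disc hφ.contDiff.continuous
  have hbound (x : Plane) (hx : x ∈ disc) : |f x * φ x| ≤ C * S := by
    rw [abs_mul]
    exact mul_le_mul (hC x hx) (hS x hx) (abs_nonneg _) ((abs_nonneg _).trans (hC x hx))
  have hsplit (n : ℕ) : (∫ x in disc, puncture n x * (f x * partialDeriv j φ x)) +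
      ∫ x in disc, f x * φ x * partialDeriv j (puncture n) x =
        -∫ x in disc, puncture n x * (d x * φ x) := by
    have hχ := contDiff_puncture n
    have htested := hparts _ (hφ.mul_left hχ) (1 / (n + 1)) (by positivity) fun x hx => by
      rw [puncture_eq_zero hx, zero_mul]
    have hint₁ := ((hφ.partialDeriv j).mul_left hχ).integrableOn_mul hfi
    have hint₂ := (hφ.mul_left (contDiff_partialDeriv hχ j)).integrableOn_mul hfi
    simp only [partialDeriv_mul j (differentiableAt_of_contDiff hχ _)
      (differentiableAt_of_contDiff hφ.contDiff _), mul_add] at htested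
    rw [integral_add hint₂ hint₁] at htested
    simp only [mul_assoc, mul_left_comm (puncture n _), mul_comm (φ _)] at htested ⊢
    rw [← htested, add_comm]
  have hlim := (tendsto_setIntegral_puncture_mul ((hφ.partialDeriv j).integrableOn_mul hfi)).add
    (tendsto_setIntegral_mul_partialDeriv_puncture hbound j)
  simp only [hsplit, add_zero] at hlim
  exact tendsto_nhds_unique hlim (tendsto_setIntegral_puncture_mul (hφ.integrableOn_mul hd)).neg

lemma locallyIntegrableOn_disc_mul_of_bound {g d : Plane → ℝ}
    (hg : AEStronglyMeasurable g discMeasure) (hd : LocallyIntegrableOn d disc)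
    (hb : ∀ x, |g x| ≤ 1) : LocallyIntegrableOn (fun x => g x * d x) disc := by
  rw [locallyIntegrableOn_iff isOpen_disc.isLocallyClosed] at hd ⊢
  intro k hk hkc
  refine (hd k hk hkc).norm.mono' ((hg.mono_measure (Measure.restrict_mono hk le_rfl)).mul
    (hd k hk hkc).1) (Eventually.of_forall fun x => ?_)
  rw [norm_mul]
  exact mul_le_of_le_one_left (norm_nonneg _) (hb x)

lemma HasWeakPartial.comp {p d : Plane → ℝ} {j : Fin 2}
    (hp : HasWeakPartial p j d) {K : ℝ} (hd : ∀ᵐ x ∂discMeasure, |d x| * ‖x‖ ≤ K)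
    {f : ℝ → ℝ} (hf : ContDiff ℝ ∞ f) {C : ℝ} (hC : ∀ t, |f t| ≤ C)
    (hf' : ∀ t, |deriv f t| ≤ 1) :
    HasWeakPartial (fun x => f (p x)) j (fun x => deriv f (p x) * d x) := by
  have hpm : AEStronglyMeasurable p discMeasure := hp.1.aestronglyMeasurable
  refine hasWeakPartial_of_eq_zero_near (hf.continuous.comp_aestronglyMeasurable hpm)
    (fun x _ => hC _) (locallyIntegrableOn_disc_mul_of_bound
      ((hf.continuous_deriv (by simp)).comp_aestronglyMeasurable hpm) hp.2.1 fun x => hf' _) ?_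
  exact fun φ hφ δ hδ hφ0 =>
    integral_comp_mul_partialDeriv_of_eq_zero_near hp hf hφ hd hC hf' hδ hφ0

/-- A smooth bounded approximation of the identity function, converging pointwise as `n → ∞`. -/
def truncate (n : ℕ) (t : ℝ) : ℝ := (n + 1) * Real.arctan (t / (n + 1))

lemma contDiff_truncate (n : ℕ) : ContDiff ℝ ∞ (truncate n) :=
  contDiff_const.mul (Real.contDiff_arctan.comp (contDiff_id.div_const _))

lemma hasDerivAt_truncate (n : ℕ) (t : ℝ) :
    HasDerivAt (truncate n) (1 / (1 + (t / (n + 1)) ^ 2)) t := by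
  have harctan := (((hasDerivAt_id t).div_const ((n : ℝ) + 1)).arctan).const_mul ((n : ℝ) + 1)
  refine harctan.congr_deriv ?_
  have hn : (n : ℝ) + 1 ≠ 0 := by positivity
  simp only [id]
  field_simp

lemma abs_deriv_truncate_le (n : ℕ) (t : ℝ) : |deriv (truncate n) t| ≤ 1 := by
  rw [(hasDerivAt_truncate n t).deriv, abs_of_pos (by positivity), div_le_one (by positivity)]
  exact le_add_of_nonneg_right (sq_nonneg _)

lemma abs_truncate_le_const (n : ℕ) (t : ℝ) : |truncate n t| ≤ (n + 1) * (Real.pi / 2) := by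
  have hn : (0 : ℝ) < n + 1 := by positivity
  rw [truncate, abs_mul, abs_of_pos hn]
  exact mul_le_mul_of_nonneg_left
    (abs_le.2 ⟨(Real.neg_pi_div_two_lt_arctan _).le, (Real.arctan_lt_pi_div_two _).le⟩) hn.le

lemma abs_truncate_le (n : ℕ) (t : ℝ) : |truncate n t| ≤ |t| := by
  have hlip := Convex.norm_image_sub_le_of_norm_deriv_le (f := truncate n) (C := 1)
    (s := Set.univ) (x := 0) (y := t) (fun x _ => (hasDerivAt_truncate n x).differentiableAt)
    (fun x _ => abs_deriv_truncate_le n x) convex_univ (Set.mem_univ _) (Set.mem_univ _)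
  simpa [truncate] using hlip

lemma tendsto_truncate (t : ℝ) : Tendsto (fun n => truncate n t) atTop (𝓝 t) := by
  rcases eq_or_ne t 0 with rfl | ht
  · simp [truncate]
  have hn (n : ℕ) : (n : ℝ) + 1 ≠ 0 := by positivity
  have hslope := (Real.hasDerivAt_arctan 0).tendsto_slope_zero
  simp only [zero_add, Real.arctan_zero, sub_zero, smul_eq_mul] at hslope
  have hlim : Tendsto (fun n : ℕ => t / ((n : ℝ) + 1)) atTop (𝓝[≠] 0) := by
    refine tendsto_nhdsWithin_iff.2 ⟨?_, Eventually.of_forall fun n => div_ne_zero ht (hn n)⟩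
    simpa [div_eq_mul_inv] using tendsto_one_div_add_atTop_nhds_zero_nat.const_mul t
  have hscaled := (hslope.comp hlim).const_mul t
  norm_num at hscaled
  refine hscaled.congr fun n => ?_
  rw [truncate]
  field_simp [hn n]

/-! ### Functions of the radius or of the angle alone -/

section parameterDerivative
variable {h : Plane → ℝ → ℝ} (hh : ContDiff ℝ ∞ fun q : Plane × ℝ => h q.1 q.2)
include hh

lemma contDiff_deriv_right : ContDiff ℝ ∞ fun q : Plane × ℝ => deriv (h q.1) q.2 := by
  have hcomp : ContDiff ℝ ∞ (Function.uncurry fun (q : Plane × ℝ) (t : ℝ) => h q.1 t) :=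
    hh.comp ((contDiff_fst.comp contDiff_fst).prodMk contDiff_snd)
  exact (hcomp.fderiv contDiff_snd (by simp)).clm_apply contDiff_const

lemma hasDerivAt_setIntegral_mul_of_eq_zero {p : Plane → ℝ} (hp : LocallyIntegrableOn p disc)
    {r ε : ℝ} (hr : r < 1) (hε : 0 < ε) (hzero : ∀ x t, |t| < ε → r < ‖x‖ → h x t = 0) :
    HasDerivAt (fun t => ∫ x in disc, p x * h x t) (∫ x in disc, p x * deriv (h x) 0) 0 := by
  have hh' := (contDiff_deriv_right hh).continuous
  have hpm : AEStronglyMeasurable p discMeasure := hp.aestronglyMeasurable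
  have hslice (t : ℝ) : ContDiff ℝ ∞ fun x => h x t := hh.comp (contDiff_id.prodMk contDiff_const)
  have hderiv (x : Plane) (t : ℝ) : HasDerivAt (h x) (deriv (h x) t) t :=
    ((hh.comp (contDiff_const.prodMk contDiff_id) :
      ContDiff ℝ ∞ (fun t => h x t)).differentiable (by simp) t).hasDerivAt
  have hderiv_zero (x : Plane) (t : ℝ) (ht : |t| < ε) (hx : r < ‖x‖) : deriv (h x) t = 0 := by
    have hlocal : h x =ᶠ[𝓝 t] fun _ => 0 := by
      filter_upwards [continuous_abs.continuousAt.eventually_lt continuousAt_const ht] with u hu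
      exact hzero x u hu hx
    rw [hlocal.deriv_eq, deriv_const]
  obtain ⟨C, hC⟩ := ((isCompact_closedBall (0 : Plane) r).prod
    (isCompact_Icc (a := -ε) (b := ε))).exists_bound_of_continuousOn hh'.continuousOn
  have hbound : Integrable (fun x => |(Metric.closedBall (0 : Plane) r).indicator p x| * C)
      discMeasure :=
    ((integrable_indicator_closedBall hr hp).abs.mul_const C).integrableOn
  refine (hasDerivAt_integral_of_dominated_loc_of_deriv_le (𝕜 := ℝ) (μ := discMeasure)
    (F := fun t x => p x * h x t) (F' := fun t x => p x * deriv (h x) t)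
    (Metric.ball_mem_nhds (0 : ℝ) hε)
    (Eventually.of_forall fun t => hpm.mul (hslice t).continuous.aestronglyMeasurable)
    (IsTestFunction.integrableOn_mul (.of_forall_eq_zero (hslice 0) hr fun x hx =>
      hzero x 0 (by simpa using hε) hx) hp)
    (hpm.mul (hh'.comp (by fun_prop : Continuous fun x : Plane =>
      (x, (0 : ℝ)))).aestronglyMeasurable)
    (Eventually.of_forall fun x t ht => ?_) hbound
    (Eventually.of_forall fun x t _ => (hderiv x t).const_mul _)).2
  have ht' : |t| < ε := mem_ball_zero_iff.1 ht
  by_cases hx : x ∈ Metric.closedBall (0 : Plane) r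
  · rw [Set.indicator_of_mem hx, norm_mul]
    exact mul_le_mul_of_nonneg_left (hC (x, t) ⟨hx, (abs_lt.1 ht').1.le, (abs_lt.1 ht').2.le⟩)
      (abs_nonneg _)
  · rw [hderiv_zero x t ht' (by simpa using hx), mul_zero, norm_zero, Set.indicator_of_notMem hx,
      abs_zero, zero_mul]

end parameterDerivative

lemma setIntegral_disc_comp_rot (f : Plane → ℝ) (α : ℝ) :
    ∫ x in disc, f (rot α x) = ∫ x in disc, f x := by
  have hpre : (rot α) ⁻¹' disc = disc := Set.ext fun x => rot_mem_disc
  simpa only [hpre] using (rot α).measurePreserving.setIntegral_preimage_emb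
    (rot α).toHomeomorph.measurableEmbedding f disc

lemma DependsOnlyOnRadius.comp_rot_ae_eq {p : Plane → ℝ} (hrad : DependsOnlyOnRadius p) (α : ℝ) :
    ∀ᵐ x ∂discMeasure, p (rot α x) = p x := by
  obtain ⟨F, hF⟩ := hrad
  have hpre : (rot α) ⁻¹' disc = disc := Set.ext fun x => rot_mem_disc
  have hmp := (rot α).measurePreserving.restrict_preimage measurableSet_disc
  rw [hpre] at hmp
  filter_upwards [hF, hmp.quasiMeasurePreserving.ae hF] with x hx hrot
  rw [hx, hrot, norm_rot]

lemma DependsOnlyOnRadius.integral_mul_angularDeriv {p : Plane → ℝ} (hrad : DependsOnlyOnRadius p)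
    (hp : LocallyIntegrableOn p disc) {ψ : Plane → ℝ} (hψ : IsTestFunction ψ) :
    ∫ x in disc, p x * angularDeriv ψ x = 0 := by
  obtain ⟨r, hr, hsupp⟩ := hψ.exists_tsupport_subset_ball
  have hderiv := hasDerivAt_setIntegral_mul_of_eq_zero (h := fun x t => ψ (rot t x))
    (hψ.contDiff.comp contDiff_rot) hp hr.2 one_pos fun x t _ hx =>
      image_eq_zero_of_notMem_tsupport fun hmem => by
        have hlt := mem_ball_zero_iff.1 (hsupp hmem)
        rw [norm_rot] at hlt
        exact lt_asymm hx hlt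
  have hconst (t : ℝ) : ∫ x in disc, p x * ψ (rot t x) = ∫ x in disc, p x * ψ x := by
    rw [← setIntegral_disc_comp_rot (fun x => p x * ψ x) t]
    refine integral_congr_ae ?_
    filter_upwards [hrad.comp_rot_ae_eq t] with x hx
    simp only [hx]
  have hpoint (x : Plane) : deriv (fun t => ψ (rot t x)) 0 = angularDeriv ψ x := by
    rw [(hasDerivAt_comp_rot hψ.contDiff x 0).deriv, rot_zero]
  simp only [hconst, hpoint] at hderiv
  exact hderiv.unique (hasDerivAt_const _ _)

lemma DependsOnlyOnAngle.integral_mul_comp_smul {p : Plane → ℝ} (hang : DependsOnlyOnAngle p)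
    {ψ : Plane → ℝ} (hψ : IsTestFunction ψ) {c : ℝ} (hc : 0 < c)
    (hvanish : ∀ x ∉ disc, ψ (c • x) = 0) :
    ∫ x in disc, p x * ψ (c • x) = (c ^ 2)⁻¹ * ∫ x in disc, p x * ψ x := by
  obtain ⟨F, hF⟩ := hang
  have hextend (χ : Plane → ℝ) (hχ : ∀ x ∉ disc, χ x = 0) :
      ∫ x in disc, p x * χ x = ∫ x, F (‖x‖⁻¹ • x) * χ x := by
    rw [← setIntegral_eq_integral_of_forall_compl_eq_zero (s := disc)
      (f := fun x => F (‖x‖⁻¹ • x) * χ x) fun x hx => by rw [hχ x hx, mul_zero]]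
    refine integral_congr_ae ?_
    filter_upwards [hF] with x hx
    rw [hx]
  have hhomog (x : Plane) : F (‖x‖⁻¹ • x) * ψ (c • x) =
      (fun y : Plane => F (‖y‖⁻¹ • y) * ψ y) (c • x) := by
    simp only [norm_smul, Real.norm_of_nonneg hc.le, smul_smul]
    congr 3
    field_simp
  rw [hextend _ hvanish, hextend ψ fun x => hψ.eq_zero,
    integral_congr_ae (Eventually.of_forall hhomog),
    Measure.integral_comp_smul volume (fun y : Plane => F (‖y‖⁻¹ • y) * ψ y),
    finrank_euclideanSpace, Fintype.card_fin, smul_eq_mul, abs_of_pos (by positivity)]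

lemma DependsOnlyOnAngle.integral_mul_eulerDeriv {p : Plane → ℝ} (hang : DependsOnlyOnAngle p)
    (hp : LocallyIntegrableOn p disc) {ψ : Plane → ℝ} (hψ : IsTestFunction ψ) :
    ∫ x in disc, p x * eulerDeriv ψ x = -2 * ∫ x in disc, p x * ψ x := by
  obtain ⟨r, ⟨hr0, hr1⟩, hsupp⟩ := hψ.exists_tsupport_subset_ball
  obtain ⟨s, hrs, hs1⟩ := exists_between hr1
  have hs0 : 0 < s := hr0.trans hrs
  have hε : 0 < 1 - r / s := sub_pos.2 ((div_lt_one hs0).2 hrs)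
  have hvanish (x : Plane) (t : ℝ) (ht : |t| < 1 - r / s) (hx : s < ‖x‖) :
      ψ ((1 + t) • x) = 0 := by
    refine image_eq_zero_of_notMem_tsupport fun hmem => ?_
    have hlt := mem_ball_zero_iff.1 (hsupp hmem)
    have hfactor : r / s < 1 + t := by linarith [(abs_lt.1 ht).1]
    rw [norm_smul, Real.norm_of_nonneg ((div_pos hr0 hs0).trans hfactor).le] at hlt
    have hmul := mul_lt_mul'' hfactor hx (div_pos hr0 hs0).le hs0.le
    rw [div_mul_cancel₀ _ hs0.ne'] at hmul
    exact lt_asymm hlt hmul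
  have hsmooth : ContDiff ℝ ∞ fun q : Plane × ℝ => ψ ((1 + q.2) • q.1) :=
    hψ.contDiff.comp ((contDiff_const.add contDiff_snd).smul contDiff_fst)
  have hderiv := hasDerivAt_setIntegral_mul_of_eq_zero (h := fun x t => ψ ((1 + t) • x)) hsmooth
    hp hs1 hε hvanish
  have hpoint (x : Plane) : deriv (fun t : ℝ => ψ ((1 + t) • x)) 0 = eulerDeriv ψ x := by
    have hline : HasDerivAt (fun t : ℝ => (1 + t) • x) x 0 := by
      have hsmul := ((hasDerivAt_id (0 : ℝ)).const_add 1).smul_const x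
      rwa [one_smul] at hsmul
    have hfderiv := (differentiableAt_of_contDiff hψ.contDiff ((1 + (0 : ℝ)) • x)).hasFDerivAt
    refine (hfderiv.comp_hasDerivAt 0 hline).deriv.trans ?_
    rw [eulerDeriv_eq_fderiv, add_zero, one_smul]
  have hscale : (fun t => ∫ x in disc, p x * ψ ((1 + t) • x)) =ᶠ[𝓝 0]
      fun t => ((1 + t) ^ 2)⁻¹ * ∫ x in disc, p x * ψ x := by
    filter_upwards [Metric.ball_mem_nhds (0 : ℝ) hε] with t ht
    have ht' : |t| < 1 - r / s := mem_ball_zero_iff.1 ht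
    exact hang.integral_mul_comp_smul hψ (by linarith [(abs_lt.1 ht').1, div_pos hr0 hs0])
      fun x hx => hvanish x t ht' (hs1.trans_le (by simpa [disc] using hx))
  have hpow : HasDerivAt (fun t : ℝ => ((1 + t) ^ 2)⁻¹) (-2) 0 := by
    refine ((((hasDerivAt_id (0 : ℝ)).const_add 1).pow 2).inv (by simp)).congr_deriv ?_
    simp
  simp only [hpoint] at hderiv
  exact (hderiv.congr_of_eventuallyEq hscale.symm).unique (hpow.mul_const _)

lemma ae_eq_zero_of_forall_integral_mul_eq_zero {g : Plane → ℝ} (hg : LocallyIntegrableOn g disc)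
    (hzero : ∀ ψ, IsTestFunction ψ → ∫ x in disc, g x * ψ x = 0) :
    ∀ᵐ x ∂discMeasure, g x = 0 := by
  refine (ae_restrict_iff' measurableSet_disc).2
    (isOpen_disc.ae_eq_zero_of_integral_contDiff_smul_eq_zero hg fun ψ hψ hc hs => ?_)
  have htest : IsTestFunction ψ := ⟨hψ, hc, hs⟩
  rw [← hzero ψ htest, htest.setIntegral_mul]
  simp only [smul_eq_mul, mul_comm]

section coordinates
variable {p d : Plane → ℝ} {i : Fin 2} (hp : HasWeakPartial p i d)
include hp

lemma HasWeakPartial.locallyIntegrableOn_mul_coord (j : Fin 2) :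
    LocallyIntegrableOn (fun x => d x * x j) disc :=
  hp.2.1.mul_continuousOn (contDiff_coord j).continuous.continuousOn isOpen_disc.isLocallyClosed

lemma HasWeakPartial.integral_coord_mul {ψ : Plane → ℝ} (hψ : IsTestFunction ψ) (j : Fin 2) :
    ∫ x in disc, d x * x j * ψ x =
      -((if j = i then 1 else 0) * ∫ x in disc, p x * ψ x) -
        ∫ x in disc, p x * (x j * partialDeriv i ψ x) := by
  have hweak := hp.2.2 _ (hψ.mul_left (contDiff_coord j))
  have hint := ((hψ.partialDeriv i).mul_left (contDiff_coord j)).integrableOn_mul hp.1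
  simp only [partialDeriv_mul i (differentiableAt_of_contDiff (contDiff_coord j) _)
    (differentiableAt_of_contDiff hψ.contDiff _), partialDeriv_coord, mul_add,
    mul_left_comm (p _) (ite _ _ _)] at hweak
  rw [integral_add ((hψ.integrableOn_mul hp.1).const_mul _) hint, integral_const_mul] at hweak
  simp only [mul_assoc]
  linarith

end coordinates

section polarGradient
variable {p : Plane → ℝ} {G : Fin 2 → Plane → ℝ} (hp : ∀ j, HasWeakPartial p j (G j))
include hp

lemma DependsOnlyOnRadius.ae_angular_eq_zero (hrad : DependsOnlyOnRadius p) :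
    ∀ᵐ x ∂discMeasure, G 1 x * x 0 - G 0 x * x 1 = 0 := by
  have hloc (i j : Fin 2) := (hp i).locallyIntegrableOn_mul_coord j
  refine ae_eq_zero_of_forall_integral_mul_eq_zero ((hloc 1 0).sub (hloc 0 1)) fun ψ hψ => ?_
  have hzero := hrad.integral_mul_angularDeriv (hp 0).1 hψ
  have hint (i j : Fin 2) :=
    ((hψ.partialDeriv i).mul_left (contDiff_coord j)).integrableOn_mul (hp 0).1
  simp only [angularDeriv, mul_sub] at hzero
  rw [integral_sub (hint 1 0) (hint 0 1)] at hzero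
  simp only [sub_mul]
  rw [integral_sub (hψ.integrableOn_mul (hloc 1 0)) (hψ.integrableOn_mul (hloc 0 1)),
    (hp 1).integral_coord_mul hψ, (hp 0).integral_coord_mul hψ, if_neg zero_ne_one,
    if_neg one_ne_zero]
  linarith

lemma DependsOnlyOnAngle.ae_radial_eq_zero (hang : DependsOnlyOnAngle p) :
    ∀ᵐ x ∂discMeasure, G 0 x * x 0 + G 1 x * x 1 = 0 := by
  have hloc (i : Fin 2) := (hp i).locallyIntegrableOn_mul_coord i
  refine ae_eq_zero_of_forall_integral_mul_eq_zero ((hloc 0).add (hloc 1)) fun ψ hψ => ?_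
  have hscale := hang.integral_mul_eulerDeriv (hp 0).1 hψ
  have hint (i : Fin 2) :=
    ((hψ.partialDeriv i).mul_left (contDiff_coord i)).integrableOn_mul (hp 0).1
  simp only [eulerDeriv, mul_add] at hscale
  rw [integral_add (hint 0) (hint 1)] at hscale
  simp only [add_mul]
  rw [integral_add (hψ.integrableOn_mul (hloc 0)) (hψ.integrableOn_mul (hloc 1)),
    (hp 0).integral_coord_mul hψ, (hp 1).integral_coord_mul hψ, if_pos rfl, if_pos rfl]
  linarith

end polarGradient

/-! ### Convergence in `L²` -/

section L2
variable {X : Type*} [MeasurableSpace X] {μ : Measure X}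

lemma eLpNorm_two_eq_ofReal_sqrt {f : X → ℝ} (hf : MemLp f 2 μ) :
    eLpNorm f 2 μ = ENNReal.ofReal √(∫ x, f x ^ 2 ∂μ) := by
  rw [hf.eLpNorm_eq_integral_rpow_norm (by norm_num) (by norm_num)]
  simp [Real.sqrt_eq_rpow]

lemma tendsto_eLpNorm_two_iff {f : ℕ → X → ℝ} (hf : ∀ n, MemLp (f n) 2 μ) :
    Tendsto (fun n => eLpNorm (f n) 2 μ) atTop (𝓝 0) ↔
      Tendsto (fun n => ∫ x, f n x ^ 2 ∂μ) atTop (𝓝 0) := by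
  simp only [fun n => eLpNorm_two_eq_ofReal_sqrt (hf n)]
  constructor <;> intro h
  · have hsqrt := (ENNReal.tendsto_toReal ENNReal.zero_ne_top).comp h
    simp only [Function.comp_def, ENNReal.toReal_ofReal (Real.sqrt_nonneg _),
      ENNReal.toReal_zero] at hsqrt
    simpa only [fun n => Real.sq_sqrt (integral_nonneg fun x => sq_nonneg (f n x) :
      0 ≤ ∫ x, f n x ^ 2 ∂μ), ne_eq, two_ne_zero, not_false_eq_true, zero_pow] using hsqrt.pow 2
  · simpa only [Function.comp_def, Real.sqrt_zero, ENNReal.ofReal_zero] using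
      ENNReal.tendsto_ofReal ((Real.continuous_sqrt.tendsto 0).comp h)

/-- Convergence `f n → g` in `L²(μ)`, for functions rather than for their classes in `Lp`. -/
structure TendstoL2 (μ : Measure X) (f : ℕ → X → ℝ) (g : X → ℝ) : Prop where
  memLp_seq : ∀ n, MemLp (f n) 2 μ
  memLp_lim : MemLp g 2 μ
  tendsto : Tendsto (fun n => eLpNorm (fun x => f n x - g x) 2 μ) atTop (𝓝 0)

namespace TendstoL2
variable {f f' : ℕ → X → ℝ} {g g' : X → ℝ}

lemma const (hg : MemLp g 2 μ) : TendstoL2 μ (fun _ => g) g :=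
  ⟨fun _ => hg, hg, by simp⟩

lemma of_integral_sub_sq (hf : ∀ n, MemLp (f n) 2 μ) (hg : MemLp g 2 μ)
    (h : Tendsto (fun n => ∫ x, (f n x - g x) ^ 2 ∂μ) atTop (𝓝 0)) : TendstoL2 μ f g :=
  ⟨hf, hg, (tendsto_eLpNorm_two_iff fun n => (hf n).sub hg).2 h⟩

variable (h : TendstoL2 μ f g) (h' : TendstoL2 μ f' g')
include h

lemma tendsto_toLp :
    Tendsto (fun n => (h.memLp_seq n).toLp (f n)) atTop (𝓝 (h.memLp_lim.toLp g)) :=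
  (Lp.tendsto_Lp_iff_tendsto_eLpNorm'' f h.memLp_seq g h.memLp_lim).2 h.tendsto

include h' in
lemma sub : TendstoL2 μ (fun n x => f n x - f' n x) (fun x => g x - g' x) :=
  ⟨fun n => (h.memLp_seq n).sub (h'.memLp_seq n), h.memLp_lim.sub h'.memLp_lim,
    (Lp.tendsto_Lp_iff_tendsto_eLpNorm'' (fun n => f n - f' n)
      (fun n => (h.memLp_seq n).sub (h'.memLp_seq n)) (g - g')
      (h.memLp_lim.sub h'.memLp_lim)).1 (h.tendsto_toLp.sub h'.tendsto_toLp)⟩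

lemma mul_left {l : X → ℝ} (hl : MemLp l ∞ μ) :
    TendstoL2 μ (fun n x => l x * f n x) (fun x => l x * g x) := by
  refine ⟨fun n => (h.memLp_seq n).mul' hl, h.memLp_lim.mul' hl, ?_⟩
  have hbound : Tendsto (fun n => eLpNorm l ∞ μ * eLpNorm (fun x => f n x - g x) 2 μ) atTop
      (𝓝 0) := by
    simpa only [mul_zero] using
      ENNReal.Tendsto.const_mul (a := eLpNorm l ∞ μ) h.tendsto (Or.inr hl.2.ne)
  refine tendsto_of_tendsto_of_tendsto_of_le_of_le tendsto_const_nhds hbound (fun _ => zero_le)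
    fun n => ?_
  have hholder := eLpNorm_smul_le_mul_eLpNorm (p := ∞) (q := 2) (r := 2)
    ((h.memLp_seq n).sub h.memLp_lim).1 hl.1
  refine (congrArg (eLpNorm · 2 μ) (funext fun x => ?_)).trans_le hholder
  exact (mul_sub _ _ _).symm

include h' in
lemma tendsto_integral_mul :
    Tendsto (fun n => ∫ x, f n x * f' n x ∂μ) atTop (𝓝 (∫ x, g x * g' x ∂μ)) := by
  have inner_toLp {a b : X → ℝ} (ha : MemLp a 2 μ) (hb : MemLp b 2 μ) :
      inner ℝ (hb.toLp b) (ha.toLp a) = ∫ x, a x * b x ∂μ := by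
    rw [L2.inner_def]
    refine integral_congr_ae ?_
    filter_upwards [ha.coeFn_toLp, hb.coeFn_toLp] with x hax hbx
    rw [hax, hbx]
    rfl
  simpa only [inner_toLp] using h'.tendsto_toLp.inner (𝕜 := ℝ) h.tendsto_toLp

include h' in
lemma tendsto_integral_mul_mul {l : X → ℝ} (hl : MemLp l ∞ μ) :
    Tendsto (fun n => ∫ x, l x * (f n x * f' n x) ∂μ) atTop (𝓝 (∫ x, l x * (g x * g' x) ∂μ)) := by
  simpa only [mul_assoc] using (h.mul_left hl).tendsto_integral_mul h'

lemma tendsto_integral_sq :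
    Tendsto (fun n => ∫ x, f n x ^ 2 ∂μ) atTop (𝓝 (∫ x, g x ^ 2 ∂μ)) := by
  simpa only [sq] using h.tendsto_integral_mul h

lemma tendsto_integral_sub_sq :
    Tendsto (fun n => ∫ x, (f n x - g x) ^ 2 ∂μ) atTop (𝓝 0) :=
  (tendsto_eLpNorm_two_iff fun n => (h.memLp_seq n).sub h.memLp_lim).1 h.tendsto

lemma ae_eq_zero (hzero : Tendsto (fun n => ∫ x, f n x ^ 2 ∂μ) atTop (𝓝 0)) : g =ᵐ[μ] 0 := by
  have hsq := tendsto_nhds_unique h.tendsto_integral_sq hzero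
  rw [integral_eq_zero_iff_of_nonneg (fun x => sq_nonneg _) h.memLp_lim.integrable_sq] at hsq
  filter_upwards [hsq] with x hx
  exact pow_eq_zero_iff two_ne_zero |>.1 hx

end TendstoL2

end L2

lemma memLp_of_bound_on_disc {f : Plane → ℝ} (hf : AEStronglyMeasurable f discMeasure)
    {C : ℝ} (hC : ∀ x ∈ disc, |f x| ≤ C) (q : ℝ≥0∞) : MemLp f q discMeasure :=
  MemLp.of_bound hf C (ae_restrict_of_forall_mem measurableSet_disc hC)

lemma memLp_disc_of_continuous {f : Plane → ℝ} (hf : Continuous f) (q : ℝ≥0∞) :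
    MemLp f q discMeasure := by
  obtain ⟨C, hC⟩ := exists_bound_on_disc hf
  exact memLp_of_bound_on_disc hf.aestronglyMeasurable hC q

/-! ### The boundary layer -/

lemma continuous_circlePoint : Continuous circlePoint := by
  unfold circlePoint
  fun_prop

lemma norm_circlePoint (θ : ℝ) : ‖circlePoint θ‖ = 1 := by
  refine (pow_eq_one_iff_of_nonneg (norm_nonneg _) two_ne_zero).1 ?_
  rw [Plane.norm_sq_eq]
  exact Real.cos_sq_add_sin_sq θ

/-- The annulus of width `δ` inside the unit circle. -/
def annulus (δ : ℝ) : Set Plane := {x | 1 - δ < ‖x‖ ∧ ‖x‖ < 1}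

lemma measurableSet_annulus (δ : ℝ) : MeasurableSet (annulus δ) :=
  (measurableSet_lt measurable_const measurable_norm).inter
    (measurableSet_lt measurable_norm measurable_const)

lemma annulus_subset_disc (δ : ℝ) : annulus δ ⊆ disc := fun _ hx => mem_ball_zero_iff.2 hx.2

lemma integral_plane_eq_integral_polar (f : Plane → ℝ) :
    ∫ x, f x = ∫ q in Set.Ioi (0 : ℝ) ×ˢ Set.Ioo (-Real.pi) Real.pi,
      q.1 * f (q.1 • circlePoint q.2) := by
  have hmp := (PiLp.volume_preserving_toLp (Fin 2)).comp (volume_preserving_finTwoArrow ℝ).symm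
  have hemb : MeasurableEmbedding (WithLp.toLp 2 ∘ (MeasurableEquiv.finTwoArrow (α := ℝ)).symm) :=
    (MeasurableEquiv.finTwoArrow.symm.trans
      (MeasurableEquiv.toLp 2 (Fin 2 → ℝ))).measurableEmbedding
  rw [← hmp.integral_comp hemb, ← integral_comp_polarCoord_symm]
  refine integral_congr_ae (Eventually.of_forall fun q => ?_)
  simp only [smul_eq_mul]
  congr 2
  ext i
  fin_cases i <;> simp [circlePoint]

lemma integral_annulus {δ : ℝ} (hδ0 : 0 ≤ δ) (hδ1 : δ ≤ 1) {f : Plane → ℝ} (hf : Continuous f) :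
    ∫ x in annulus δ, f x =
      ∫ θ, (∫ R in (1 - δ)..1, R * f (R • circlePoint θ)) ∂angleMeasure := by
  have hmem (q : ℝ × ℝ) (hq : q ∈ Set.Ioi (0 : ℝ) ×ˢ Set.Ioo (-Real.pi) Real.pi) :
      q.1 • circlePoint q.2 ∈ annulus δ ↔ q ∈ Set.Ioo (1 - δ) 1 ×ˢ (Set.univ : Set ℝ) := by
    simp only [annulus, Set.mem_ofPred_eq, norm_smul, norm_circlePoint, mul_one,
      Real.norm_of_nonneg (le_of_lt hq.1), Set.mem_prod, Set.mem_Ioo, Set.mem_univ, and_true]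
  have hint : IntegrableOn (fun q : ℝ × ℝ => q.1 * f (q.1 • circlePoint q.2))
      (Set.Ioo (1 - δ) 1 ×ˢ Set.Ioo (-Real.pi) Real.pi) :=
    ((continuous_fst.mul (hf.comp (continuous_fst.smul (continuous_circlePoint.comp
      continuous_snd)))).continuousOn.integrableOn_compact
        (isCompact_Icc.prod isCompact_Icc)).mono_set
      (Set.prod_mono Set.Ioo_subset_Icc_self Set.Ioo_subset_Icc_self)
  have hinter : Set.Ioi (0 : ℝ) ×ˢ Set.Ioo (-Real.pi) Real.pi ∩ Set.Ioo (1 - δ) 1 ×ˢ Set.univ =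
      Set.Ioo (1 - δ) 1 ×ˢ Set.Ioo (-Real.pi) Real.pi := by
    rw [Set.prod_inter_prod, Set.inter_univ, Set.inter_eq_self_of_subset_right]
    exact fun R hR => (sub_nonneg.2 hδ1).trans_lt hR.1
  rw [← integral_indicator (measurableSet_annulus δ), integral_plane_eq_integral_polar,
    setIntegral_congr_fun (g := (Set.Ioo (1 - δ) 1 ×ˢ Set.univ).indicator fun q : ℝ × ℝ =>
      q.1 * f (q.1 • circlePoint q.2)) (measurableSet_Ioi.prod measurableSet_Ioo) fun q hq => ?_,
    setIntegral_indicator (measurableSet_Ioo.prod MeasurableSet.univ), hinter,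
    Measure.volume_eq_prod, ← setIntegral_prod_swap]
  · refine (setIntegral_prod _ hint.swap).trans ?_
    simp only [angleMeasure, intervalIntegral.integral_of_le (sub_le_self 1 hδ0),
      integral_Ioc_eq_integral_Ioo, Function.comp_apply, Prod.swap_prod_mk]
  · by_cases hq' : q.1 • circlePoint q.2 ∈ annulus δ
    · simp only [Set.indicator_of_mem hq', Set.indicator_of_mem ((hmem q hq).1 hq')]
    · simp only [Set.indicator_of_notMem hq', Set.indicator_of_notMem (mt (hmem q hq).2 hq'),
        mul_zero]

lemma integral_mul_sq_le_of_hasDerivAt {f f' : ℝ → ℝ} (hf : ∀ t, HasDerivAt f (f' t) t)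
    (hf' : Continuous f') {δ : ℝ} (hδ : 0 ≤ δ) (hδ2 : δ ≤ 1 / 2) :
    ∫ R in (1 - δ)..1, R * f R ^ 2 ≤
      2 * δ * f 1 ^ 2 + 8 * δ ^ 2 * ∫ R in (1 - δ)..1, R * f' R ^ 2 := by
  have hfc : Continuous f := continuous_iff_continuousAt.2 fun t => (hf t).continuousAt
  have hderiv (R : ℝ) : HasDerivAt (fun R => (R - (1 - δ)) * f R ^ 2)
      (f R ^ 2 + (R - (1 - δ)) * (2 * f R * f' R)) R := by
    refine (((hasDerivAt_id R).sub_const (1 - δ)).mul ((hf R).pow 2)).congr_deriv ?_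
    simp
  have hftc := intervalIntegral.integral_eq_sub_of_hasDerivAt (a := 1 - δ) (b := 1)
    (fun R _ => hderiv R) ((by fun_prop : Continuous fun R =>
      f R ^ 2 + (R - (1 - δ)) * (2 * f R * f' R)).intervalIntegrable _ _)
  have hpoint (R : ℝ) (hR : R ∈ Set.Icc (1 - δ) 1) :
      R * f R ^ 2 ≤ 2 * (f R ^ 2 + (R - (1 - δ)) * (2 * f R * f' R)) +
        8 * δ ^ 2 * (R * f' R ^ 2) := by
    have hfsq : R * f R ^ 2 ≤ f R ^ 2 := mul_le_of_le_one_left (sq_nonneg _) hR.2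
    have hcomplete := sq_nonneg (f R + 2 * ((R - (1 - δ)) * f' R))
    have hwidth : (R - (1 - δ)) ^ 2 * f' R ^ 2 ≤ δ ^ 2 * f' R ^ 2 :=
      mul_le_mul_of_nonneg_right
        (pow_le_pow_left₀ (sub_nonneg.2 hR.1) (by linarith [hR.2]) 2) (sq_nonneg _)
    have hradius : 1 / 2 * (δ ^ 2 * f' R ^ 2) ≤ R * (δ ^ 2 * f' R ^ 2) :=
      mul_le_mul_of_nonneg_right (by linarith [hR.1]) (by positivity)
    linarith
  have hftcint : IntervalIntegrable (fun R =>
      2 * (f R ^ 2 + (R - (1 - δ)) * (2 * f R * f' R))) volume (1 - δ) 1 :=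
    Continuous.intervalIntegrable (by fun_prop) _ _
  have hderivint : IntervalIntegrable (fun R => 8 * δ ^ 2 * (R * f' R ^ 2)) volume (1 - δ) 1 :=
    Continuous.intervalIntegrable (by fun_prop) _ _
  have hmono := intervalIntegral.integral_mono_on (sub_le_self 1 hδ)
    ((by fun_prop : Continuous fun R => R * f R ^ 2).intervalIntegrable _ _)
    (hftcint.add hderivint) hpoint
  rw [intervalIntegral.integral_add hftcint hderivint, intervalIntegral.integral_const_mul,
    intervalIntegral.integral_const_mul, hftc] at hmono
  refine hmono.trans_eq ?_
  ring

lemma sq_fderiv_circlePoint_le (φ : Plane → ℝ) (x : Plane) (θ : ℝ) :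
    fderiv ℝ φ x (circlePoint θ) ^ 2 ≤ partialDeriv 0 φ x ^ 2 + partialDeriv 1 φ x ^ 2 := by
  rw [fderiv_apply_eq]
  simp only [circlePoint, Matrix.cons_val_zero, Matrix.cons_val_one]
  nlinarith [sq_nonneg (Real.cos θ * partialDeriv 1 φ x - Real.sin θ * partialDeriv 0 φ x),
    Real.sin_sq_add_cos_sq θ, sq_nonneg (partialDeriv 0 φ x), sq_nonneg (partialDeriv 1 φ x)]

section boundaryLayer
variable {φ : Plane → ℝ} (hφ : ContDiff ℝ ∞ φ) {δ : ℝ} (hδ : 0 ≤ δ) (hδ2 : δ ≤ 1 / 2)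
include hφ hδ hδ2

lemma integral_ray_sq_le (θ : ℝ) :
    ∫ R in (1 - δ)..1, R * φ (R • circlePoint θ) ^ 2 ≤
      2 * δ * φ (circlePoint θ) ^ 2 + 8 * δ ^ 2 * ∫ R in (1 - δ)..1,
        R * (partialDeriv 0 φ (R • circlePoint θ) ^ 2 +
          partialDeriv 1 φ (R • circlePoint θ) ^ 2) := by
  have hline (R : ℝ) : HasDerivAt (fun R : ℝ => R • circlePoint θ) (circlePoint θ) R := by
    have hsmul := (hasDerivAt_id R).smul_const (circlePoint θ)
    rwa [one_smul] at hsmul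
  have hderiv (R : ℝ) : HasDerivAt (fun R : ℝ => φ (R • circlePoint θ))
      (fderiv ℝ φ (R • circlePoint θ) (circlePoint θ)) R :=
    (differentiableAt_of_contDiff hφ _).hasFDerivAt.comp_hasDerivAt R (hline R)
  have hlinec : Continuous fun R : ℝ => R • circlePoint θ := by fun_prop
  have hderivc : Continuous fun R : ℝ => fderiv ℝ φ (R • circlePoint θ) (circlePoint θ) :=
    ((hφ.continuous_fderiv (by simp)).comp hlinec).clm_apply continuous_const
  have hpartial (j : Fin 2) := (continuous_partialDeriv hφ j).comp hlinec
  have hray := integral_mul_sq_le_of_hasDerivAt hderiv hderivc hδ hδ2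
  rw [one_smul] at hray
  refine hray.trans (add_le_add_right (mul_le_mul_of_nonneg_left ?_ (by positivity)) _)
  exact intervalIntegral.integral_mono_on (sub_le_self 1 hδ)
    ((continuous_id.mul (hderivc.pow 2)).intervalIntegrable _ _)
    ((continuous_id.mul (((hpartial 0).pow 2).add ((hpartial 1).pow 2))).intervalIntegrable _ _)
    fun R hR => mul_le_mul_of_nonneg_left (sq_fderiv_circlePoint_le φ _ θ)
      (by linarith [hR.1] : (0 : ℝ) ≤ R)

lemma integral_annulus_sq_le :
    ∫ x in annulus δ, φ x ^ 2 ≤ 2 * δ * ∫ θ, φ (circlePoint θ) ^ 2 ∂angleMeasure +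
      8 * δ ^ 2 * ∫ x in annulus δ, (partialDeriv 0 φ x ^ 2 + partialDeriv 1 φ x ^ 2) := by
  have hgrad : Continuous fun x => partialDeriv 0 φ x ^ 2 + partialDeriv 1 φ x ^ 2 :=
    ((continuous_partialDeriv hφ 0).pow 2).add ((continuous_partialDeriv hφ 1).pow 2)
  have hint {f : ℝ → ℝ} (hf : Continuous f) : Integrable f angleMeasure := hf.integrableOn_Ioc
  have hrays {f : Plane → ℝ} (hf : Continuous f) :
      Integrable (fun θ => ∫ R in (1 - δ)..1, R * f (R • circlePoint θ)) angleMeasure :=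
    hint (intervalIntegral.continuous_parametric_intervalIntegral_of_continuous'
      (continuous_snd.mul (hf.comp (continuous_snd.smul
        (continuous_circlePoint.comp continuous_fst)))) _ _)
  have hsq : Continuous fun x => φ x ^ 2 := hφ.continuous.pow 2
  have hbdry : Integrable (fun θ => φ (circlePoint θ) ^ 2) angleMeasure :=
    hint (hsq.comp continuous_circlePoint)
  have hδ1 : δ ≤ 1 := by linarith
  rw [integral_annulus hδ hδ1 hsq, integral_annulus hδ hδ1 hgrad,
    ← integral_const_mul, ← integral_const_mul, ← integral_add (hbdry.const_mul _)
      ((hrays hgrad).const_mul _)]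
  exact integral_mono (hrays hsq)
    ((hbdry.const_mul _).add ((hrays hgrad).const_mul _)) (integral_ray_sq_le hφ hδ hδ2)

end boundaryLayer

/-! ### Functions with vanishing trace are limits of test functions -/

lemma deriv_smoothTransition_eq_zero {t : ℝ} (ht : t ∉ Set.Icc (0 : ℝ) 1) :
    deriv Real.smoothTransition t = 0 := by
  rw [Set.mem_Icc, not_and_or, not_le, not_le] at ht
  rcases ht with ht | ht
  · have hlocal : Real.smoothTransition =ᶠ[𝓝 t] fun _ => 0 := by
      filter_upwards [Iio_mem_nhds ht] with s hs
      exact Real.smoothTransition.zero_of_nonpos (le_of_lt hs)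
    rw [hlocal.deriv_eq, deriv_const]
  · have hlocal : Real.smoothTransition =ᶠ[𝓝 t] fun _ => 1 := by
      filter_upwards [Ioi_mem_nhds ht] with s hs
      exact Real.smoothTransition.one_of_one_le (le_of_lt hs)
    rw [hlocal.deriv_eq, deriv_const]

lemma exists_bound_deriv_smoothTransition : ∃ C, ∀ t, |deriv Real.smoothTransition t| ≤ C :=
  (HasCompactSupport.intro isCompact_Icc fun _ => deriv_smoothTransition_eq_zero)
    |>.exists_bound_of_continuous
      ((Real.smoothTransition.contDiff (n := 1)).continuous_deriv (by simp))

/-- A smooth cutoff function supported in the disc and equal to `1` off the annulus of width `δ`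
inside the unit circle. -/
def cutoff (δ : ℝ) (x : Plane) : ℝ := Real.smoothTransition ((1 - ‖x‖ ^ 2) / δ - 1 / 2)

lemma contDiff_cutoff (δ : ℝ) : ContDiff ℝ ∞ (cutoff δ) :=
  Real.smoothTransition.contDiff.comp
    (((contDiff_const.sub (contDiff_norm_sq ℝ)).div_const _).sub contDiff_const)

lemma cutoff_nonneg (δ : ℝ) (x : Plane) : 0 ≤ cutoff δ x := Real.smoothTransition.nonneg _

lemma cutoff_le_one (δ : ℝ) (x : Plane) : cutoff δ x ≤ 1 := Real.smoothTransition.le_one _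

lemma partialDeriv_cutoff (δ : ℝ) (j : Fin 2) (x : Plane) : partialDeriv j (cutoff δ) x =
    deriv Real.smoothTransition ((1 - ‖x‖ ^ 2) / δ - 1 / 2) * (-(2 * x j) / δ) := by
  have harg := (((hasStrictFDerivAt_norm_sq x).hasFDerivAt.const_sub 1).mul_const δ⁻¹).sub_const
    (1 / 2)
  have hcutoff : HasFDerivAt (cutoff δ) _ x :=
    ((Real.smoothTransition.contDiff (n := 1)).differentiable (by simp)
      ((1 - ‖x‖ ^ 2) / δ - 1 / 2)).hasDerivAt.comp_hasFDerivAt x harg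
  rw [partialDeriv, hcutoff.fderiv]
  simp [EuclideanSpace.inner_single_right]
  ring

lemma integral_disc_indicator_annulus (δ : ℝ) (f : Plane → ℝ) :
    ∫ x in disc, (annulus δ).indicator f x = ∫ x in annulus δ, f x := by
  rw [setIntegral_indicator (measurableSet_annulus δ),
    Set.inter_eq_self_of_subset_right (annulus_subset_disc δ)]

lemma tendsto_integral_annulus {f : Plane → ℝ} (hf : IntegrableOn f disc) {δ : ℕ → ℝ}
    (hδ : Antitone δ) (hδ0 : Tendsto δ atTop (𝓝 0)) :
    Tendsto (fun n => ∫ x in annulus (δ n), f x) atTop (𝓝 0) := by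
  have hempty : ⋂ n, annulus (δ n) = ∅ := by
    refine Set.eq_empty_of_forall_notMem fun x hx => ?_
    have hx' (n : ℕ) : 1 - δ n < ‖x‖ ∧ ‖x‖ < 1 := Set.mem_iInter.1 hx n
    obtain ⟨n, hn⟩ := ((tendsto_order.1 hδ0).2 (1 - ‖x‖) (sub_pos.2 (hx' 0).2)).exists
    linarith [(hx' n).1]
  have hlim := tendsto_setIntegral_of_antitone (μ := volume) (f := f)
    (s := fun n => annulus (δ n)) (fun n => measurableSet_annulus _)
    (fun m n hmn x hx => ⟨(sub_le_sub_left (hδ hmn) 1).trans_lt hx.1, hx.2⟩)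
    ⟨0, hf.mono_set (annulus_subset_disc _)⟩
  rwa [hempty, setIntegral_empty] at hlim

section cutoffEstimates
variable {δ : ℝ} (hδ : 0 < δ)
include hδ

lemma isTestFunction_cutoff : IsTestFunction (cutoff δ) := by
  refine .of_forall_eq_zero (contDiff_cutoff δ) (r := √(1 - δ / 2)) ?_ fun x hx => ?_
  · rw [Real.sqrt_lt' one_pos]
    linarith
  · rw [Real.sqrt_lt' ((Real.sqrt_nonneg _).trans_lt hx)] at hx
    refine Real.smoothTransition.zero_of_nonpos ?_
    rw [sub_nonpos, div_le_iff₀ hδ]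
    linarith

lemma abs_partialDeriv_cutoff_le {C : ℝ} (hC : ∀ t, |deriv Real.smoothTransition t| ≤ C)
    {x : Plane} (hx : x ∈ disc) (j : Fin 2) : |partialDeriv j (cutoff δ) x| ≤ 2 * C / δ := by
  have hxj : |x j| ≤ 1 := (PiLp.norm_apply_le x j).trans (mem_ball_zero_iff.1 hx).le
  rw [partialDeriv_cutoff, abs_mul, abs_div, abs_neg, abs_mul, abs_of_pos hδ, abs_two]
  calc _ ≤ C * (2 * 1 / δ) := mul_le_mul (hC _) (by gcongr) (by positivity)
        ((abs_nonneg _).trans (hC 0))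
    _ = 2 * C / δ := by ring

variable (hδ2 : δ < 1 / 2)
include hδ2

lemma one_lt_cutoff_arg {x : Plane} (hx : x ∈ disc) (hxa : x ∉ annulus δ) :
    1 < (1 - ‖x‖ ^ 2) / δ - 1 / 2 := by
  have hle : ‖x‖ ≤ 1 - δ := not_lt.1 fun h => hxa ⟨h, mem_ball_zero_iff.1 hx⟩
  have hsq : ‖x‖ ^ 2 ≤ (1 - δ) ^ 2 := pow_le_pow_left₀ (norm_nonneg _) hle 2
  rw [lt_sub_iff_add_lt, lt_div_iff₀ hδ]
  nlinarith

lemma one_sub_cutoff_mul_le_indicator (f : Plane → ℝ) {x : Plane} (hx : x ∈ disc) :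
    (1 - cutoff δ x) * f x ^ 2 ≤ (annulus δ).indicator (fun y => f y ^ 2) x := by
  by_cases hxa : x ∈ annulus δ
  · rw [Set.indicator_of_mem hxa]
    exact mul_le_of_le_one_left (sq_nonneg _) (sub_le_self 1 (cutoff_nonneg δ x))
  · rw [Set.indicator_of_notMem hxa, cutoff,
      Real.smoothTransition.one_of_one_le (one_lt_cutoff_arg hδ hδ2 hx hxa).le, sub_self, zero_mul]

lemma partialDeriv_cutoff_mul_sq_le_indicator {C : ℝ}
    (hC : ∀ t, |deriv Real.smoothTransition t| ≤ C) (f : Plane → ℝ) {x : Plane} (hx : x ∈ disc)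
    (j : Fin 2) :
    (partialDeriv j (cutoff δ) x * f x) ^ 2 ≤
      (2 * C / δ) ^ 2 * (annulus δ).indicator (fun y => f y ^ 2) x := by
  by_cases hxa : x ∈ annulus δ
  · rw [Set.indicator_of_mem hxa, mul_pow]
    exact mul_le_mul_of_nonneg_right
      (sq_le_sq.2 ((abs_partialDeriv_cutoff_le hδ hC hx j).trans (le_abs_self _))) (sq_nonneg _)
  · rw [Set.indicator_of_notMem hxa, partialDeriv_cutoff, deriv_smoothTransition_eq_zero fun h =>
      h.2.not_gt (one_lt_cutoff_arg hδ hδ2 hx hxa)]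
    simp

end cutoffEstimates

lemma sq_mul_sub_le {c : ℝ} (hc0 : 0 ≤ c) (hc1 : c ≤ 1) (a b : ℝ) :
    (c * a - b) ^ 2 ≤ (a - b) ^ 2 + (1 - c) * b ^ 2 := by
  nlinarith [mul_nonneg (sub_nonneg.2 hc1) (sq_nonneg (a - b)),
    mul_nonneg (mul_nonneg hc0 (sub_nonneg.2 hc1)) (sq_nonneg a)]

section cutoffIntegrals
variable {φ w d : Plane → ℝ} (hφ : ContDiff ℝ ∞ φ) (hw : MemLp w 2 discMeasure)
  (hd : MemLp d 2 discMeasure) {δ : ℝ}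

lemma integral_annulus_sq_le_add {f g : Plane → ℝ} (hf : MemLp f 2 discMeasure)
    (hg : MemLp g 2 discMeasure) :
    ∫ x in annulus δ, f x ^ 2 ≤
      2 * (∫ x in disc, (f x - g x) ^ 2) + 2 * ∫ x in annulus δ, g x ^ 2 := by
  have hsub := annulus_subset_disc δ
  have hdiff : IntegrableOn (fun x => (f x - g x) ^ 2) disc := (hf.sub hg).integrable_sq
  have hdiff' := (hdiff.mono_set hsub).const_mul 2
  have hg' := (IntegrableOn.mono_set hg.integrable_sq hsub).const_mul 2
  have hadd : ∫ x in annulus δ, f x ^ 2 ≤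
      ∫ x in annulus δ, (2 * (f x - g x) ^ 2 + 2 * g x ^ 2) := by
    refine integral_mono (IntegrableOn.mono_set hf.integrable_sq hsub) (hdiff'.add hg') fun x => ?_
    simpa only [sub_add_cancel, mul_add] using add_sq_le (a := f x - g x) (b := g x)
  rw [integral_add hdiff' hg', integral_const_mul, integral_const_mul] at hadd
  have hmono : ∫ x in annulus δ, (f x - g x) ^ 2 ≤ ∫ x in disc, (f x - g x) ^ 2 :=
    setIntegral_mono_set hdiff (Eventually.of_forall fun x => sq_nonneg _)
      (Eventually.of_forall hsub)
  linarith

lemma integrableOn_indicator_annulus_sq {f : Plane → ℝ} (hf : MemLp f 2 discMeasure) :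
    IntegrableOn ((annulus δ).indicator fun x => f x ^ 2) disc :=
  IntegrableOn.indicator hf.integrable_sq (measurableSet_annulus δ)

include hφ

lemma integral_annulus_sq_le_of_approx {G : Fin 2 → Plane → ℝ}
    (hG : ∀ i, MemLp (G i) 2 discMeasure) (hδ : 0 ≤ δ) (hδ2 : δ ≤ 1 / 2) :
    ∫ x in annulus δ, φ x ^ 2 ≤ 2 * δ * (∫ θ, φ (circlePoint θ) ^ 2 ∂angleMeasure) +
      8 * δ ^ 2 * ∑ i, (2 * (∫ x in disc, (partialDeriv i φ x - G i x) ^ 2) +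
        2 * ∫ x in annulus δ, G i x ^ 2) := by
  have hpartial (i : Fin 2) := memLp_disc_of_continuous (continuous_partialDeriv hφ i) 2
  have hint (i : Fin 2) : IntegrableOn (fun x => partialDeriv i φ x ^ 2) (annulus δ) :=
    IntegrableOn.mono_set (hpartial i).integrable_sq (annulus_subset_disc δ)
  refine (integral_annulus_sq_le hφ hδ hδ2).trans
    (add_le_add_right (mul_le_mul_of_nonneg_left ?_ (by positivity)) _)
  rw [integral_add (hint 0) (hint 1), Fin.sum_univ_two]
  exact add_le_add (integral_annulus_sq_le_add (hpartial 0) (hG 0))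
    (integral_annulus_sq_le_add (hpartial 1) (hG 1))

variable (hδ : 0 < δ) (hδ2 : δ < 1 / 2)
include hδ hδ2

include hw in
lemma integral_cutoff_mul_sub_sq_le :
    ∫ x in disc, (cutoff δ x * φ x - w x) ^ 2 ≤
      (∫ x in disc, (φ x - w x) ^ 2) + ∫ x in annulus δ, w x ^ 2 := by
  have hφw : IntegrableOn (fun x => (φ x - w x) ^ 2) disc :=
    ((memLp_disc_of_continuous hφ.continuous 2).sub hw).integrable_sq
  have hwa := integrableOn_indicator_annulus_sq (δ := δ) hw
  have hprod := memLp_disc_of_continuous ((contDiff_cutoff δ).mul hφ).continuous 2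
  rw [← integral_disc_indicator_annulus, ← integral_add hφw hwa]
  exact setIntegral_mono_on (hprod.sub hw).integrable_sq (hφw.add hwa) measurableSet_disc
    fun x hx => (sq_mul_sub_le (cutoff_nonneg δ x) (cutoff_le_one δ x) _ _).trans
      (add_le_add_right (one_sub_cutoff_mul_le_indicator hδ hδ2 w hx) _)

include hd in
lemma integral_partialDeriv_cutoff_mul_sub_sq_le {C : ℝ}
    (hC : ∀ t, |deriv Real.smoothTransition t| ≤ C) (j : Fin 2) :
    ∫ x in disc, (partialDeriv j (fun y => cutoff δ y * φ y) x - d x) ^ 2 ≤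
      2 * (∫ x in disc, (partialDeriv j φ x - d x) ^ 2) + 2 * (∫ x in annulus δ, d x ^ 2) +
        2 * (2 * C / δ) ^ 2 * ∫ x in annulus δ, φ x ^ 2 := by
  have hχ := contDiff_cutoff δ
  have hdiff : IntegrableOn (fun x => 2 * (partialDeriv j φ x - d x) ^ 2) disc :=
    ((memLp_disc_of_continuous (continuous_partialDeriv hφ j) 2).sub hd).integrable_sq.const_mul 2
  have hda := (integrableOn_indicator_annulus_sq (δ := δ) hd).const_mul 2
  have hφa := (integrableOn_indicator_annulus_sq (δ := δ)
    (memLp_disc_of_continuous hφ.continuous 2)).const_mul (2 * (2 * C / δ) ^ 2)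
  have hsum : IntegrableOn (fun x => 2 * (partialDeriv j φ x - d x) ^ 2 +
      2 * (annulus δ).indicator (fun x => d x ^ 2) x) disc := hdiff.add hda
  have hprod := memLp_disc_of_continuous (continuous_partialDeriv (hχ.mul hφ) j) 2
  rw [← integral_disc_indicator_annulus, ← integral_disc_indicator_annulus,
    ← integral_const_mul, ← integral_const_mul, ← integral_const_mul,
    ← integral_add hdiff hda, ← integral_add hsum hφa]
  refine setIntegral_mono_on (hprod.sub hd).integrable_sq (hsum.add hφa)
    measurableSet_disc fun x hx => ?_
  rw [partialDeriv_mul j (differentiableAt_of_contDiff hχ x) (differentiableAt_of_contDiff hφ x)]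
  have hsplit := add_sq_le (a := cutoff δ x * partialDeriv j φ x - d x)
    (b := partialDeriv j (cutoff δ) x * φ x)
  have hconvex := sq_mul_sub_le (cutoff_nonneg δ x) (cutoff_le_one δ x)
    (partialDeriv j φ x) (d x)
  have hone := one_sub_cutoff_mul_le_indicator hδ hδ2 d hx
  have hderiv := partialDeriv_cutoff_mul_sq_le_indicator hδ hδ2 hC φ hx j
  calc _ = (cutoff δ x * partialDeriv j φ x - d x + partialDeriv j (cutoff δ) x * φ x) ^ 2 := by
        ring
    _ ≤ _ := by linarith

end cutoffIntegrals

section testApproximation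
variable {φ : ℕ → Plane → ℝ} {w : Plane → ℝ} {d : Fin 2 → Plane → ℝ}
  (hφ : ∀ n, ContDiff ℝ ∞ (φ n))
  (hd : ∀ j, TendstoL2 discMeasure (fun n => partialDeriv j (φ n)) (d j))
include hφ hd

lemma tendsto_integral_annulus_sq_div {δ : ℕ → ℝ} (hδ : ∀ k, δ k ∈ Set.Ioo (0 : ℝ) (1 / 2))
    (hanti : Antitone δ) (hδ0 : Tendsto δ atTop (𝓝 0))
    (htr : ∀ k, ∫ θ, φ k (circlePoint θ) ^ 2 ∂angleMeasure ≤ δ k ^ 2) :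
    Tendsto (fun k => (δ k ^ 2)⁻¹ * ∫ x in annulus (δ k), φ k x ^ 2) atTop (𝓝 0) := by
  have hsum := tendsto_finsetSum Finset.univ fun i (_ : i ∈ (Finset.univ : Finset (Fin 2))) =>
    ((hd i).tendsto_integral_sub_sq.const_mul 2).add
      ((tendsto_integral_annulus (hd i).memLp_lim.integrable_sq hanti hδ0).const_mul 2)
  have hlim := (hδ0.const_mul 2).add (hsum.const_mul 8)
  simp only [mul_zero, add_zero, Finset.sum_const_zero, discMeasure] at hlim
  refine squeeze_zero (fun k => by positivity) (fun k => ?_) hlim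
  have hpos := (hδ k).1
  refine (mul_le_mul_of_nonneg_left ((integral_annulus_sq_le_of_approx (hφ k)
    (fun i => (hd i).memLp_lim) hpos.le (hδ k).2.le).trans (add_le_add_left
      (mul_le_mul_of_nonneg_left (htr k) (by positivity)) _)) (by positivity)).trans_eq ?_
  field_simp

lemma exists_test_approximation (hw : TendstoL2 discMeasure φ w)
    (htr : Tendsto (fun n => ∫ θ, φ n (circlePoint θ) ^ 2 ∂angleMeasure) atTop (𝓝 0)) :
    ∃ ψ : ℕ → Plane → ℝ, (∀ n, IsTestFunction (ψ n)) ∧ TendstoL2 discMeasure ψ w ∧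
      ∀ j, TendstoL2 discMeasure (fun n => partialDeriv j (ψ n)) (d j) := by
  obtain ⟨δ, hanti, hδ, hδ0⟩ := exists_seq_strictAnti_tendsto' (one_half_pos (α := ℝ))
  have hex (k : ℕ) : ∃ n ≥ k, ∫ θ, φ n (circlePoint θ) ^ 2 ∂angleMeasure ≤ δ k ^ 2 :=
    (((tendsto_order.1 htr).2 (δ k ^ 2) (pow_pos (hδ k).1 2)).and
      (eventually_ge_atTop k)).exists.imp fun _ hn => ⟨hn.2, hn.1.le⟩
  choose N hN htrN using hex
  have hNt : Tendsto N atTop atTop := tendsto_atTop_mono hN tendsto_id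
  obtain ⟨C, hC⟩ := exists_bound_deriv_smoothTransition
  have htest (k : ℕ) : IsTestFunction fun x => cutoff (δ k) x * φ (N k) x :=
    (isTestFunction_cutoff (hδ k).1).mul_right (hφ _)
  refine ⟨fun k x => cutoff (δ k) x * φ (N k) x, htest, ?_, fun j => ?_⟩
  · refine .of_integral_sub_sq (fun k => memLp_disc_of_continuous (htest k).1.continuous 2)
      hw.memLp_lim ?_
    have hlim := (hw.tendsto_integral_sub_sq.comp hNt).add
      (tendsto_integral_annulus hw.memLp_lim.integrable_sq hanti.antitone hδ0)
    rw [add_zero] at hlim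
    exact squeeze_zero (fun k => integral_nonneg fun x => sq_nonneg _)
      (fun k => integral_cutoff_mul_sub_sq_le (hφ (N k)) hw.memLp_lim (hδ k).1 (hδ k).2) hlim
  · refine .of_integral_sub_sq (fun k => memLp_disc_of_continuous
      (continuous_partialDeriv (htest k).1 j) 2) (hd j).memLp_lim ?_
    have hdN (i : Fin 2) : TendstoL2 discMeasure (fun k => partialDeriv i (φ (N k))) (d i) :=
      ⟨fun k => (hd i).memLp_seq _, (hd i).memLp_lim, (hd i).tendsto.comp hNt⟩
    have hlayer := tendsto_integral_annulus_sq_div (fun k => hφ (N k)) hdN hδ hanti.antitone hδ0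
      htrN
    have hlim := (((hdN j).tendsto_integral_sub_sq.const_mul 2).add
      ((tendsto_integral_annulus (hd j).memLp_lim.integrable_sq hanti.antitone hδ0).const_mul
        2)).add (hlayer.const_mul (2 * (2 * C) ^ 2))
    simp only [mul_zero, add_zero, discMeasure] at hlim
    refine squeeze_zero (fun k => integral_nonneg fun x => sq_nonneg _) (fun k =>
      (integral_partialDeriv_cutoff_mul_sub_sq_le (hφ (N k)) (hd j).memLp_lim (hδ k).1 (hδ k).2
        hC j).trans_eq ?_) hlim
    rw [div_pow]
    ring

end testApproximation

/-! ### Pointwise bounds for the pressure gradient -/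

lemma WeaklyDifferentiable.hasWeakPartial {p : Plane → ℝ} (hp : WeaklyDifferentiable p)
    (j : Fin 2) : HasWeakPartial p j (weakPartial p j) := by
  rw [weakPartial, dif_pos (hp j)]
  exact (hp j).choose_spec

lemma ae_discMeasure_of_ae_discMeasureInvR {P : Plane → Prop}
    (h : ∀ᵐ x ∂discMeasureInvR, P x) : ∀ᵐ x ∂discMeasure, P x := by
  rw [discMeasureInvR, ae_withDensity_iff (by fun_prop)] at h
  filter_upwards [h, ae_ne_zero] with x hx hx0
  refine hx ?_
  simpa using hx0

lemma radialPart_scaledGrad (p : Plane → ℝ) {x : Plane} (hx : x ≠ 0) :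
    radialPart (scaledGrad p) x = weakPartial p 0 x * x 0 + weakPartial p 1 x * x 1 := by
  have : ‖x‖ ≠ 0 := norm_ne_zero_iff.2 hx
  simp only [radialPart, scaledGrad, weakGrad, PiLp.smul_apply, smul_eq_mul]
  field_simp

lemma angularPart_scaledGrad (p : Plane → ℝ) {x : Plane} (hx : x ≠ 0) :
    angularPart (scaledGrad p) x = weakPartial p 1 x * x 0 - weakPartial p 0 x * x 1 := by
  have : ‖x‖ ≠ 0 := norm_ne_zero_iff.2 hx
  simp only [angularPart, scaledGrad, weakGrad, PiLp.smul_apply, smul_eq_mul]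
  field_simp

lemma ae_abs_le_of_eLpNorm_top_le {f : Plane → ℝ} {K : ℝ} (hK : 0 ≤ K)
    (h : eLpNorm f ∞ discMeasureInvR ≤ ENNReal.ofReal K) : ∀ᵐ x ∂discMeasure, |f x| ≤ K := by
  refine ae_discMeasure_of_ae_discMeasureInvR ?_
  rw [eLpNorm_exponent_top] at h
  filter_upwards [ae_le_eLpNormEssSup (f := f) (μ := discMeasureInvR)] with x hx
  have henorm := hx.trans h
  rwa [Real.enorm_eq_ofReal_abs, ENNReal.ofReal_le_ofReal_iff hK] at henorm

section polarSupNorm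

variable {p : Plane → ℝ} {K : ℝ} (hK : 0 ≤ K)
  (h : polarSupNorm (scaledGrad p) ≤ ENNReal.ofReal K)
include hK h

lemma ae_abs_radial_le_of_polarSupNorm_le :
    ∀ᵐ x ∂discMeasure, |weakPartial p 0 x * x 0 + weakPartial p 1 x * x 1| ≤ K := by
  filter_upwards [ae_abs_le_of_eLpNorm_top_le hK ((le_max_left _ _).trans h), ae_ne_zero]
    with x hx hx0
  rwa [radialPart_scaledGrad p hx0] at hx

lemma ae_abs_angular_le_of_polarSupNorm_le :
    ∀ᵐ x ∂discMeasure, |weakPartial p 1 x * x 0 - weakPartial p 0 x * x 1| ≤ K := by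
  filter_upwards [ae_abs_le_of_eLpNorm_top_le hK ((le_max_right _ _).trans h), ae_ne_zero]
    with x hx hx0
  rwa [angularPart_scaledGrad p hx0] at hx

variable (hp : WeaklyDifferentiable p)
include hp

lemma scaledGradBound_of_polarSupNorm_le : ScaledGradBound p K K :=
  ⟨_, hp.hasWeakPartial, ae_abs_radial_le_of_polarSupNorm_le hK h,
    ae_abs_angular_le_of_polarSupNorm_le hK h⟩

lemma DependsOnlyOnRadius.scaledGradBound (hrad : DependsOnlyOnRadius p) :
    ScaledGradBound p K 0 := by
  refine ⟨_, hp.hasWeakPartial, ae_abs_radial_le_of_polarSupNorm_le hK h, ?_⟩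
  filter_upwards [hrad.ae_angular_eq_zero hp.hasWeakPartial] with x hx
  rw [hx, abs_zero]

lemma DependsOnlyOnAngle.scaledGradBound (hang : DependsOnlyOnAngle p) :
    ScaledGradBound p 0 K := by
  refine ⟨_, hp.hasWeakPartial, ?_, ae_abs_angular_le_of_polarSupNorm_le hK h⟩
  filter_upwards [hang.ae_radial_eq_zero hp.hasWeakPartial] with x hx
  rw [hx, abs_zero]

end polarSupNorm

lemma abs_mul_norm_le_of_polar_bounds {G : Fin 2 → ℝ} {KR KT : ℝ} {x : Plane}
    (hR : |G 0 * x 0 + G 1 * x 1| ≤ KR) (hT : |G 1 * x 0 - G 0 * x 1| ≤ KT) (j : Fin 2) :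
    |G j| * ‖x‖ ≤ KR + KT := by
  have hKR := (abs_nonneg _).trans hR
  have hKT := (abs_nonneg _).trans hT
  have hpolar : (∑ i, G i ^ 2) * ‖x‖ ^ 2 =
      (G 0 * x 0 + G 1 * x 1) ^ 2 + (G 1 * x 0 - G 0 * x 1) ^ 2 := by
    rw [Plane.norm_sq_eq, Fin.sum_univ_two]; ring
  have hj : G j ^ 2 ≤ ∑ i, G i ^ 2 :=
    Finset.single_le_sum (fun i _ => sq_nonneg (G i)) (Finset.mem_univ j)
  refine abs_le_of_sq_le_sq' ?_ (add_nonneg hKR hKT) |>.2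
  calc (|G j| * ‖x‖) ^ 2 = G j ^ 2 * ‖x‖ ^ 2 := by rw [mul_pow, sq_abs]
    _ ≤ (∑ i, G i ^ 2) * ‖x‖ ^ 2 := mul_le_mul_of_nonneg_right hj (sq_nonneg _)
    _ ≤ KR ^ 2 + KT ^ 2 := hpolar.trans_le
      (add_le_add (sq_le_sq' (abs_le.1 hR).1 (abs_le.1 hR).2)
        (sq_le_sq' (abs_le.1 hT).1 (abs_le.1 hT).2))
    _ ≤ (KR + KT) ^ 2 := by nlinarith

lemma ScaledGradBound.truncate {p : Plane → ℝ} {KR KT : ℝ} (h : ScaledGradBound p KR KT)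
    (n : ℕ) : ScaledGradBound (fun x => truncate n (p x)) KR KT := by
  obtain ⟨G, hG, hR, hT⟩ := h
  have hbound (j : Fin 2) : ∀ᵐ x ∂discMeasure, |G j x| * ‖x‖ ≤ KR + KT := by
    filter_upwards [hR, hT] with x hx hx'
    exact abs_mul_norm_le_of_polar_bounds (G := fun i => G i x) hx hx' j
  have hshrink (x : Plane) {s K : ℝ} (hs : |s| ≤ K) :
      |deriv (SmallPressure.truncate n) (p x) * s| ≤ K := by
    rw [abs_mul]
    exact (mul_le_of_le_one_left (abs_nonneg _) (abs_deriv_truncate_le n _)).trans hs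
  refine ⟨fun j x => deriv (SmallPressure.truncate n) (p x) * G j x, fun j =>
    (hG j).comp (hbound j) (contDiff_truncate n) (abs_truncate_le_const n)
      (abs_deriv_truncate_le n), ?_, ?_⟩
  · filter_upwards [hR] with x hx
    rw [mul_assoc, mul_assoc, ← mul_add]
    exact hshrink x hx
  · filter_upwards [hT] with x hx
    rw [mul_assoc, mul_assoc, ← mul_sub]
    exact hshrink x hx

lemma memLp_truncate {p : Plane → ℝ} (hp : AEStronglyMeasurable p discMeasure) (n : ℕ) :
    MemLp (fun x => truncate n (p x)) ∞ discMeasure :=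
  memLp_of_bound_on_disc ((contDiff_truncate n).continuous.comp_aestronglyMeasurable hp)
    (fun x _ => abs_truncate_le_const n (p x)) ∞

/-! ### Square integrable matrix fields -/

lemma frob_eq (A B : Mat2) :
    frob A B = A 0 0 * B 0 0 + A 0 1 * B 0 1 + (A 1 0 * B 1 0 + A 1 1 * B 1 1) := by
  simp only [frob, Fin.sum_univ_two]

lemma cof_eq (A : Mat2) : cof A = !![A 1 1, -A 1 0; -A 0 1, A 0 0] := by
  ext i j
  fin_cases i <;> fin_cases j <;> simp [cof, Matrix.adjugate_fin_two]

lemma frob_cof_eq (A B : Mat2) : frob (cof A) B =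
    A 1 1 * B 0 0 - A 1 0 * B 0 1 - A 0 1 * B 1 0 + A 0 0 * B 1 1 := by
  rw [frob_eq, cof_eq]
  simp only [Matrix.of_apply, Matrix.cons_val', Matrix.cons_val_zero, Matrix.cons_val_one,
    Matrix.cons_val_fin_one]
  ring

lemma det_add_eq (A B : Mat2) : (A + B).det = A.det + frob (cof A) B + B.det := by
  simp only [Matrix.det_fin_two, frob_cof_eq, Matrix.add_apply]
  ring

lemma frob_self_nonneg (A : Mat2) : 0 ≤ frob A A :=
  Finset.sum_nonneg fun i _ => Finset.sum_nonneg fun j _ => mul_self_nonneg (A i j)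

/-- A matrix field on the disc whose entries are square integrable. -/
def MatMemL2 (A : Plane → Mat2) : Prop := ∀ i j, MemLp (fun x => A x i j) 2 discMeasure

/-- Entrywise convergence in `L²` of matrix fields on the disc. -/
def MatTendsto (F : ℕ → Plane → Mat2) (A : Plane → Mat2) : Prop :=
  ∀ i j, TendstoL2 discMeasure (fun n x => F n x i j) (fun x => A x i j)

section matrixFields

variable {A B : Plane → Mat2} {F F' : ℕ → Plane → Mat2}

lemma MatMemL2.tendsto (h : MatMemL2 A) : MatTendsto (fun _ => A) A :=
  fun i j => TendstoL2.const (h i j)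

lemma MatMemL2.sub (hA : MatMemL2 A) (hB : MatMemL2 B) : MatMemL2 (fun x => A x - B x) :=
  fun i j => (hA i j).sub (hB i j)

lemma MatTendsto.cof (h : MatTendsto F A) :
    MatTendsto (fun n x => cof (F n x)) (fun x => cof (A x)) := by
  have hneg (i j : Fin 2) := (h i j).mul_left (memLp_top_const (-1 : ℝ))
  intro i j
  fin_cases i <;> fin_cases j
  · simpa [cof_eq] using h 1 1
  · simpa [cof_eq] using hneg 1 0
  · simpa [cof_eq] using hneg 0 1
  · simpa [cof_eq] using h 0 0

lemma MatMemL2.cof (h : MatMemL2 A) : MatMemL2 (fun x => cof (A x)) :=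
  fun i j => (h.tendsto.cof i j).memLp_lim

lemma MatMemL2.integrable_mul_entry (hA : MatMemL2 A) (hB : MatMemL2 B)
    {l : Plane → ℝ} (hl : MemLp l ∞ discMeasure) (i j : Fin 2) :
    Integrable (fun x => l x * (A x i j * B x i j)) discMeasure := by
  have h : MemLp (fun x => l x * A x i j) 2 discMeasure := (hA i j).mul' hl
  simpa only [mul_assoc, Pi.mul_def] using h.integrable_mul (hB i j)

lemma MatMemL2.integrable_mul_frob (hA : MatMemL2 A) (hB : MatMemL2 B)
    {l : Plane → ℝ} (hl : MemLp l ∞ discMeasure) :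
    Integrable (fun x => l x * frob (A x) (B x)) discMeasure := by
  simp only [frob, Finset.mul_sum]
  exact integrable_finsetSum _ fun i _ => integrable_finsetSum _ fun j _ =>
    hA.integrable_mul_entry hB hl i j

lemma MatMemL2.integrable_frob (hA : MatMemL2 A) (hB : MatMemL2 B) :
    Integrable (fun x => frob (A x) (B x)) discMeasure := by
  simpa using hA.integrable_mul_frob hB (memLp_top_const (1 : ℝ))

lemma MatMemL2.integral_mul_frob (hA : MatMemL2 A) (hB : MatMemL2 B)
    {l : Plane → ℝ} (hl : MemLp l ∞ discMeasure) :
    ∫ x, l x * frob (A x) (B x) ∂discMeasure =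
      ∑ i, ∑ j, ∫ x, l x * (A x i j * B x i j) ∂discMeasure := by
  simp only [frob, Finset.mul_sum]
  rw [integral_finsetSum _ fun i _ => integrable_finsetSum _ fun j _ =>
    hA.integrable_mul_entry hB hl i j]
  exact Finset.sum_congr rfl fun i _ =>
    integral_finsetSum _ fun j _ => hA.integrable_mul_entry hB hl i j

lemma MatTendsto.memL2 (h : MatTendsto F A) : MatMemL2 A := fun i j => (h i j).memLp_lim

lemma MatTendsto.memL2_seq (h : MatTendsto F A) (n : ℕ) : MatMemL2 (F n) :=
  fun i j => (h i j).memLp_seq n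

lemma MatTendsto.tendsto_integral_mul_frob (h : MatTendsto F A) (h' : MatTendsto F' B)
    {l : Plane → ℝ} (hl : MemLp l ∞ discMeasure) :
    Tendsto (fun n => ∫ x, l x * frob (F n x) (F' n x) ∂discMeasure) atTop
      (𝓝 (∫ x, l x * frob (A x) (B x) ∂discMeasure)) := by
  simp only [h.memL2.integral_mul_frob h'.memL2 hl,
    fun n => (h.memL2_seq n).integral_mul_frob (h'.memL2_seq n) hl]
  exact tendsto_finsetSum _ fun i _ => tendsto_finsetSum _ fun j _ =>
    (h i j).tendsto_integral_mul_mul (h' i j) hl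

lemma MatTendsto.tendsto_integral_frob (h : MatTendsto F A) (h' : MatTendsto F' B) :
    Tendsto (fun n => ∫ x, frob (F n x) (F' n x) ∂discMeasure) atTop
      (𝓝 (∫ x, frob (A x) (B x) ∂discMeasure)) := by
  simpa using h.tendsto_integral_mul_frob h' (memLp_top_const (1 : ℝ))

end matrixFields

/-! ### The pairing of the pressure with cofactors and determinants -/

/-- The square of the `L²` norm of a matrix field on the disc. -/
def normSqL2 (A : Plane → Mat2) : ℝ := ∫ x, frob (A x) (A x) ∂discMeasure

lemma MatTendsto.tendsto_normSqL2 {F : ℕ → Plane → Mat2} {A : Plane → Mat2}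
    (h : MatTendsto F A) : Tendsto (fun n => normSqL2 (F n)) atTop (𝓝 (normSqL2 A)) :=
  h.tendsto_integral_frob h

/-- `U` is an `L²` limit of gradients of maps that are smooth up to the boundary, i.e. the gradient
of a map in `W^{1,2}(B, ℝ²)`. -/
def IsSobolevGradient (U : Plane → Mat2) : Prop :=
  ∃ w : ℕ → Plane → Plane, (∀ n i, ContDiff ℝ ∞ fun x => w n x i) ∧
    MatTendsto (fun n => classicalJacobian (w n)) U

lemma IsSobolevGradient.memL2 {U : Plane → Mat2} (hU : IsSobolevGradient U) : MatMemL2 U := by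
  obtain ⟨w, -, hw⟩ := hU
  exact hw.memL2

/-- The maps `η n ∈ C_c^∞(B, ℝ²)` tend to `w` in `L²` and their gradients tend to `D`, so that
`w ∈ W₀^{1,2}(B, ℝ²)` with gradient `D`. -/
structure IsTestApproximation (η : ℕ → Plane → Plane) (w : Plane → Plane)
    (D : Plane → Mat2) : Prop where
  test : ∀ n i, IsTestFunction fun x => η n x i
  tendsto : ∀ i, TendstoL2 discMeasure (fun n x => η n x i) fun x => w x i
  tendsto_jacobian : MatTendsto (fun n => classicalJacobian (η n)) D

lemma det_classicalJacobian (η : Plane → Plane) (x : Plane) :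
    (classicalJacobian η x).det = bracket (fun y => η y 0) (fun y => η y 1) x := by
  simp only [Matrix.det_fin_two, classicalJacobian, bracket, Matrix.of_apply]

lemma frob_cof_classicalJacobian (w η : Plane → Plane) (x : Plane) :
    frob (cof (classicalJacobian w x)) (classicalJacobian η x) =
      bracket (fun y => w y 0) (fun y => η y 1) x -
        bracket (fun y => w y 1) (fun y => η y 0) x := by
  simp only [frob_cof_eq, classicalJacobian, bracket, Matrix.of_apply]
  ring

lemma det_eq_half_frob_cof (A : Mat2) : A.det = 1 / 2 * frob (cof A) A := by
  rw [frob_cof_eq, Matrix.det_fin_two]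
  ring

lemma continuous_bracket {a b : Plane → ℝ} (ha : ContDiff ℝ ∞ a) (hb : ContDiff ℝ ∞ b) :
    Continuous (bracket a b) :=
  ((continuous_partialDeriv ha 0).mul (continuous_partialDeriv hb 1)).sub
    ((continuous_partialDeriv ha 1).mul (continuous_partialDeriv hb 0))

lemma sum_dirichlet {η : Plane → Plane} (hη : ∀ i, ContDiff ℝ ∞ fun x => η x i) :
    ∑ i, dirichlet (fun x => η x i) = normSqL2 (classicalJacobian η) := by
  simp only [dirichlet, normSqL2, discMeasure]
  rw [← integral_finsetSum _ fun i _ => integrableOn_grad_sq (hη i)]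
  simp only [frob, classicalJacobian, Matrix.of_apply, Fin.sum_univ_two, sq]

lemma matMemL2_classicalJacobian {η : Plane → Plane}
    (hη : ∀ i, ContDiff ℝ ∞ fun x => η x i) : MatMemL2 (classicalJacobian η) := fun i j =>
  memLp_disc_of_continuous (continuous_partialDeriv (hη i) j) 2

lemma classicalJacobian_sub {w η : Plane → Plane} (hw : ∀ i, ContDiff ℝ ∞ fun x => w x i)
    (hη : ∀ i, ContDiff ℝ ∞ fun x => η x i) (x : Plane) :
    classicalJacobian (fun y => w y - η y) x = classicalJacobian w x - classicalJacobian η x := by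
  ext i j
  exact partialDeriv_sub j (differentiableAt_of_contDiff (hw i) x)
    (differentiableAt_of_contDiff (hη i) x)

/-- The scalar quantity whose sum over the two components of `η` bounds `2 |∫ l det ∇η|` when
`|R ∂_R l| ≤ KR` and `|∂_θ l| ≤ KT`; `c` is the constant of Young's inequality. -/
def pressureBound (KR KT c : ℝ) (φ : Plane → ℝ) : ℝ :=
  KR * angularEnergy φ + KT / 2 * (c * fluctuation φ + c⁻¹ * radialSumEnergy φ)

section boundedPressure

variable {l : Plane → ℝ} (hlm : MemLp l ∞ discMeasure)
include hlm

lemma integrable_mul_bracket {a b : Plane → ℝ} (ha : ContDiff ℝ ∞ a) (hb : ContDiff ℝ ∞ b) :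
    Integrable (fun x => l x * bracket a b x) discMeasure :=
  hlm.integrable_mul (memLp_disc_of_continuous (continuous_bracket ha hb) 1)

lemma MatMemL2.integrable_mul_det {A : Plane → Mat2} (hA : MatMemL2 A) :
    Integrable (fun x => l x * (A x).det) discMeasure := by
  simp only [det_eq_half_frob_cof, mul_left_comm (l _)]
  exact (hA.cof.integrable_mul_frob hA hlm).const_mul (1 / 2)

lemma MatTendsto.tendsto_integral_mul_det {F : ℕ → Plane → Mat2} {A : Plane → Mat2}
    (h : MatTendsto F A) :
    Tendsto (fun n => ∫ x, l x * (F n x).det ∂discMeasure) atTop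
      (𝓝 (∫ x, l x * (A x).det ∂discMeasure)) := by
  simp only [det_eq_half_frob_cof, mul_left_comm (l _), integral_const_mul]
  exact (h.cof.tendsto_integral_mul_frob h hlm).const_mul _

variable {KR KT : ℝ} (hl : ScaledGradBound l KR KT)
include hl

lemma abs_integral_mul_frob_cof_le {w η : Plane → Plane}
    (hw : ∀ i, ContDiff ℝ ∞ fun x => w x i) (hη : ∀ i, IsTestFunction fun x => η x i)
    {c : ℝ} (hc : 0 < c) :
    |∫ x, l x * frob (cof (classicalJacobian w x)) (classicalJacobian η x) ∂discMeasure| ≤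
      2 * (KR + KT) * (c * normSqL2 (classicalJacobian w) +
        c⁻¹ * normSqL2 (classicalJacobian η)) := by
  have h₀₁ := abs_integral_mul_bracket_le_dirichlet hl (hw 0) (hη 1) hc
  have h₁₀ := abs_integral_mul_bracket_le_dirichlet hl (hw 1) (hη 0) hc
  simp only [← sum_dirichlet hw, ← sum_dirichlet fun i => (hη i).contDiff, Fin.sum_univ_two,
    frob_cof_classicalJacobian, mul_sub]
  rw [integral_sub (integrable_mul_bracket hlm (hw 0) (hη 1).contDiff)
    (integrable_mul_bracket hlm (hw 1) (hη 0).contDiff)]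
  refine (abs_sub _ _).trans ((add_le_add h₀₁ h₁₀).trans_eq ?_)
  ring

lemma IsSobolevGradient.abs_integral_mul_frob_cof_le {U : Plane → Mat2}
    (hU : IsSobolevGradient U) {η : Plane → Plane} (hη : ∀ i, IsTestFunction fun x => η x i)
    {c : ℝ} (hc : 0 < c) :
    |∫ x, l x * frob (cof (U x)) (classicalJacobian η x) ∂discMeasure| ≤
      2 * (KR + KT) * (c * normSqL2 U + c⁻¹ * normSqL2 (classicalJacobian η)) := by
  obtain ⟨w, hw, hwU⟩ := hU
  have hJ := (matMemL2_classicalJacobian fun i => (hη i).contDiff).tendsto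
  exact le_of_tendsto_of_tendsto' (hwU.cof.tendsto_integral_mul_frob hJ hlm).abs
    ((hwU.tendsto_normSqL2.const_mul c).add_const _ |>.const_mul _) fun n =>
      SmallPressure.abs_integral_mul_frob_cof_le hlm hl (hw n) hη hc

section testApproximation

variable {η : ℕ → Plane → Plane} {w : Plane → Plane} {D : Plane → Mat2}
  (hη : IsTestApproximation η w D)
include hη

lemma IsTestApproximation.abs_integral_mul_frob_cof_sub_le {U : Plane → Mat2}
    (hU : IsSobolevGradient U) (k : ℕ) {c : ℝ} (hc : 0 < c) :
    |∫ x, l x * frob (cof (U x)) (classicalJacobian (η k) x - D x) ∂discMeasure| ≤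
      2 * (KR + KT) * (c * normSqL2 U +
        c⁻¹ * normSqL2 fun x => classicalJacobian (η k) x - D x) := by
  have hJ : MatTendsto (fun n x => classicalJacobian (η k) x - classicalJacobian (η n) x)
      (fun x => classicalJacobian (η k) x - D x) := fun i j =>
    (TendstoL2.const ((hη.tendsto_jacobian i j).memLp_seq k)).sub (hη.tendsto_jacobian i j)
  refine le_of_tendsto_of_tendsto' (hU.memL2.cof.tendsto.tendsto_integral_mul_frob hJ hlm).abs
    ((hJ.tendsto_normSqL2.const_mul _).const_add _ |>.const_mul _) fun n => ?_
  have hkn := hU.abs_integral_mul_frob_cof_le hlm hl (η := fun x => η k x - η n x)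
    (fun i => (hη.test k i).sub (hη.test n i)) hc
  simpa only [normSqL2, classicalJacobian_sub (fun i => (hη.test k i).contDiff)
    fun i => (hη.test n i).contDiff] using hkn

lemma IsTestApproximation.two_mul_abs_integral_mul_det_le {c β : ℝ} (hc : 0 < c)
    (hβ : ∃ᶠ n in atTop, ∑ i, pressureBound KR KT c (fun x => η n x i) ≤ β) :
    2 * |∫ x, l x * (D x).det ∂discMeasure| ≤ β := by
  refine le_of_tendsto_of_frequently
    ((hη.tendsto_jacobian.tendsto_integral_mul_det hlm).abs.const_mul 2)
    (hβ.mono fun n hn => le_trans ?_ hn)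
  simp only [det_classicalJacobian, Fin.sum_univ_two, pressureBound]
  refine (two_mul_abs_integral_mul_bracket_self_le hl (hη.test n 0).contDiff (hη.test n 1)
    hc).trans_eq ?_
  ring

lemma IsTestApproximation.two_mul_abs_integral_mul_frob_cof_le {U : Plane → Mat2}
    (hU : IsSobolevGradient U) (hdet : ∀ᵐ x ∂discMeasure, frob (cof (U x)) (D x) = -(D x).det)
    {c β : ℝ} (hc : 0 < c)
    (hβ : ∃ᶠ n in atTop, ∑ i, pressureBound KR KT c (fun x => η n x i) ≤ β) (k : ℕ)
    {s : ℝ} (hs : 0 < s) :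
    2 * |∫ x, l x * frob (cof (U x)) (classicalJacobian (η k) x) ∂discMeasure| ≤
      β + 4 * (KR + KT) * (s * normSqL2 U +
        s⁻¹ * normSqL2 fun x => classicalJacobian (η k) x - D x) := by
  have hJ := hη.tendsto_jacobian
  have hsplit : ∫ x, l x * frob (cof (U x)) (classicalJacobian (η k) x) ∂discMeasure =
      (∫ x, l x * frob (cof (U x)) (classicalJacobian (η k) x - D x) ∂discMeasure) -
        ∫ x, l x * (D x).det ∂discMeasure := by
    rw [← integral_sub (hU.memL2.cof.integrable_mul_frob ((hJ.memL2_seq k).sub hJ.memL2) hlm)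
      (hJ.memL2.integrable_mul_det hlm)]
    refine integral_congr_ae ?_
    filter_upwards [hdet] with x hx
    simp only [frob_cof_eq, Matrix.sub_apply] at hx ⊢
    linear_combination l x * hx
  have hcof := hη.abs_integral_mul_frob_cof_sub_le hlm hl hU k hs
  have hdet_le := hη.two_mul_abs_integral_mul_det_le hlm hl hc hβ
  rw [hsplit]
  have htri := abs_sub (∫ x, l x * frob (cof (U x)) (classicalJacobian (η k) x - D x) ∂discMeasure)
    (∫ x, l x * (D x).det ∂discMeasure)
  linarith

end testApproximation

end boundedPressure

lemma tendsto_integral_truncate_mul {p F : Plane → ℝ} (hp : AEStronglyMeasurable p discMeasure)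
    (hF : AEStronglyMeasurable F discMeasure)
    (hint : Integrable (fun x => p x * F x) discMeasure) :
    Tendsto (fun n => ∫ x, truncate n (p x) * F x ∂discMeasure) atTop
      (𝓝 (∫ x, p x * F x ∂discMeasure)) := by
  refine tendsto_integral_of_dominated_convergence _
    (fun n => (memLp_truncate hp n).aestronglyMeasurable.mul hF) hint.norm
    (fun n => Eventually.of_forall fun x => ?_)
    (Eventually.of_forall fun x => (tendsto_truncate (p x)).mul_const _)
  rw [norm_mul, norm_mul]
  exact mul_le_mul_of_nonneg_right (abs_truncate_le n (p x)) (norm_nonneg _)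

lemma ScaledGradBound.aestronglyMeasurable {p : Plane → ℝ} {KR KT : ℝ}
    (hp : ScaledGradBound p KR KT) : AEStronglyMeasurable p discMeasure := by
  obtain ⟨G, hG, -, -⟩ := hp
  exact (hG 0).1.aestronglyMeasurable

lemma IsTestApproximation.two_mul_abs_integral_pressure_le {p : Plane → ℝ} {KR KT : ℝ}
    (hp : ScaledGradBound p KR KT) {η : ℕ → Plane → Plane} {w : Plane → Plane}
    {U D : Plane → Mat2} (hη : IsTestApproximation η w D) (hU : IsSobolevGradient U)
    (hdet : ∀ᵐ x ∂discMeasure, frob (cof (U x)) (D x) = -(D x).det) {c β : ℝ} (hc : 0 < c)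
    (hβ : ∃ᶠ n in atTop, ∑ i, pressureBound KR KT c (fun x => η n x i) ≤ β) (k : ℕ)
    (hint : Integrable (fun x => p x * frob (cof (U x)) (classicalJacobian (η k) x)) discMeasure)
    {s : ℝ} (hs : 0 < s) :
    2 * |∫ x, p x * frob (cof (U x)) (classicalJacobian (η k) x) ∂discMeasure| ≤
      β + 4 * (KR + KT) * (s * normSqL2 U +
        s⁻¹ * normSqL2 fun x => classicalJacobian (η k) x - D x) := by
  have hF := (hU.memL2.cof.integrable_frob (hη.tendsto_jacobian.memL2_seq k)).aestronglyMeasurable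
  have hpm := hp.aestronglyMeasurable
  exact le_of_tendsto' ((tendsto_integral_truncate_mul hpm hF hint).abs.const_mul 2) fun n =>
    hη.two_mul_abs_integral_mul_frob_cof_le (memLp_truncate hpm n) (hp.truncate n) hU hdet hc hβ
      k hs

/-! ### Comparison of a stationary point with a competitor -/

instance : IsFiniteMeasure angleMeasure := by
  unfold angleMeasure
  infer_instance

lemma HasTrace.exists_smooth {w : Plane → ℝ} {h : ℝ → ℝ} (hw : MemW12 w) (ht : HasTrace w h) :
    ∃ φ : ℕ → Plane → ℝ, (∀ n, ContDiff ℝ ∞ (φ n)) ∧ TendstoL2 discMeasure φ w ∧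
      (∀ j, TendstoL2 discMeasure (fun n => partialDeriv j (φ n)) (weakPartial w j)) ∧
      Tendsto (fun n => eLpNorm (fun θ => φ n (circlePoint θ) - h θ) 2 angleMeasure) atTop
        (𝓝 0) := by
  obtain ⟨φ, hφ, h₀, h₁, h₂⟩ := ht
  exact ⟨φ, hφ, ⟨fun n => memLp_disc_of_continuous (hφ n).continuous 2, hw.1, h₀⟩,
    fun j => ⟨fun n => memLp_disc_of_continuous (continuous_partialDeriv (hφ n) j) 2,
      hw.2.2 j, h₁ j⟩, h₂⟩

lemma memLp_angleMeasure_of_continuous {f : ℝ → ℝ} (hf : Continuous f) :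
    MemLp f 2 angleMeasure := by
  obtain ⟨C, hC⟩ := (isCompact_Icc (a := -Real.pi) (b := Real.pi)).exists_bound_of_continuousOn
    hf.continuousOn
  exact MemLp.of_bound hf.aestronglyMeasurable C
    (ae_restrict_of_forall_mem measurableSet_Ioc fun θ hθ => hC θ (Set.Ioc_subset_Icc_self hθ))

lemma tendsto_integral_angleMeasure_sub_sq {f f' : ℕ → ℝ → ℝ} (hf : ∀ n, Continuous (f n))
    (hf' : ∀ n, Continuous (f' n)) {h : ℝ → ℝ} (hh : AEStronglyMeasurable h angleMeasure)
    (hlim : Tendsto (fun n => eLpNorm (fun θ => f n θ - h θ) 2 angleMeasure) atTop (𝓝 0))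
    (hlim' : Tendsto (fun n => eLpNorm (fun θ => f' n θ - h θ) 2 angleMeasure) atTop (𝓝 0)) :
    Tendsto (fun n => ∫ θ, (f n θ - f' n θ) ^ 2 ∂angleMeasure) atTop (𝓝 0) := by
  refine (tendsto_eLpNorm_two_iff fun n =>
    memLp_angleMeasure_of_continuous ((hf n).sub (hf' n))).1 ?_
  have hsum := hlim.add hlim'
  rw [add_zero] at hsum
  refine tendsto_of_tendsto_of_tendsto_of_le_of_le tendsto_const_nhds hsum (fun _ => zero_le)
    fun n => ?_
  have htri := eLpNorm_sub_le (p := 2) ((hf n).aestronglyMeasurable.sub hh)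
    ((hf' n).aestronglyMeasurable.sub hh) (by norm_num)
  refine le_trans (le_of_eq ?_) htri
  congr 1
  ext θ
  simp only [Pi.sub_apply, sub_sub_sub_cancel_right]

lemma exists_test_of_hasTrace {u v : Plane → ℝ} (hu : MemW12 u) (hv : MemW12 v) {h : ℝ → ℝ}
    (hh : AEStronglyMeasurable h angleMeasure) (hut : HasTrace u h) (hvt : HasTrace v h) :
    ∃ ψ : ℕ → Plane → ℝ, (∀ n, IsTestFunction (ψ n)) ∧
      TendstoL2 discMeasure ψ (fun x => v x - u x) ∧
      ∀ j, TendstoL2 discMeasure (fun n => partialDeriv j (ψ n))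
        (fun x => weakPartial v j x - weakPartial u j x) := by
  obtain ⟨φ, hφ, hφv, hDφ, hφh⟩ := hvt.exists_smooth hv
  obtain ⟨χ, hχ, hχu, hDχ, hχh⟩ := hut.exists_smooth hu
  have hsub (j : Fin 2) : (fun n => partialDeriv j (fun x => φ n x - χ n x)) =
      fun n x => partialDeriv j (φ n) x - partialDeriv j (χ n) x := by
    ext n x
    exact partialDeriv_sub j (differentiableAt_of_contDiff (hφ n) x)
      (differentiableAt_of_contDiff (hχ n) x)
  refine exists_test_approximation (φ := fun n x => φ n x - χ n x)
    (d := fun j x => weakPartial v j x - weakPartial u j x)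
    (fun n => (hφ n).sub (hχ n)) (fun j => ?_) (hφv.sub hχu) ?_
  · rw [hsub j]
    exact (hDφ j).sub (hDχ j)
  · exact tendsto_integral_angleMeasure_sub_sq
      (fun n => (hφ n).continuous.comp continuous_circlePoint)
      (fun n => (hχ n).continuous.comp continuous_circlePoint) hh hφh hχh

section admissible

variable {g : ℝ → Plane} {b : Plane} {u v : Plane → Plane} (hu : u ∈ admissible g b)
include hu

lemma isSobolevGradient_weakJacobian : IsSobolevGradient (weakJacobian u) := by
  choose φ hφ _ hDφ _ using fun i => (hu.2.2 i).exists_smooth (hu.1 i)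
  exact ⟨fun n x => WithLp.toLp 2 fun i => φ i n x, fun n i => hφ i n, fun i j => hDφ i j⟩

variable (hv : v ∈ admissible g b)
include hv

lemma exists_isTestApproximation_sub
    (hg : ∀ i, AEStronglyMeasurable (fun θ => g θ i) angleMeasure) :
    ∃ η : ℕ → Plane → Plane, IsTestApproximation η (fun x => v x - u x)
      (fun x => weakJacobian v x - weakJacobian u x) := by
  choose ψ hψ hψ_lim hDψ using fun i => exists_test_of_hasTrace (hu.1 i) (hv.1 i)
    ((hg i).add_const (b i)) (hu.2.2 i) (hv.2.2 i)
  exact ⟨fun n x => WithLp.toLp 2 fun i => ψ i n x, fun n i => hψ i n, hψ_lim,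
    fun i j => hDψ i j⟩

/-- The determinant is quadratic, so the constraint turns the linear pressure term into a
determinant. -/
lemma ae_frob_cof_weakJacobian_sub : ∀ᵐ x ∂discMeasure,
    frob (cof (weakJacobian u x)) (weakJacobian v x - weakJacobian u x) =
      -(weakJacobian v x - weakJacobian u x).det := by
  filter_upwards [hu.2.1, hv.2.1] with x hux hvx
  have hdet := det_add_eq (weakJacobian u x) (weakJacobian v x - weakJacobian u x)
  rw [add_sub_cancel, hux, hvx] at hdet
  linarith

end admissible

lemma tensorApply_sub (T : Tensor4) (A B : Mat2) :
    tensorApply T (A - B) = tensorApply T A - tensorApply T B := by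
  ext i j
  simp only [tensorApply, Matrix.of_apply, Matrix.sub_apply, mul_sub, Finset.sum_sub_distrib]

lemma frob_sub_left (A B C : Mat2) : frob (A - B) C = frob A C - frob B C := by
  simp only [frob, Matrix.sub_apply, sub_mul, Finset.sum_sub_distrib]

lemma frob_sub_right (A B C : Mat2) : frob A (B - C) = frob A B - frob A C := by
  simp only [frob, Matrix.sub_apply, mul_sub, Finset.sum_sub_distrib]

lemma frob_tensorApply_comm {T : Tensor4} (hT : T.IsSymm) (A B : Mat2) :
    frob (tensorApply T A) B = frob (tensorApply T B) A := by
  have h (r s : Fin 2 × Fin 2) : T r s = T s r := hT.apply s r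
  simp only [frob, tensorApply, Matrix.of_apply, Fin.sum_univ_two]
  rw [h (0, 1) (0, 0), h (1, 0) (0, 0), h (1, 1) (0, 0), h (1, 0) (0, 1), h (1, 1) (0, 1),
    h (1, 1) (1, 0)]
  ring

section quadraticEnergy

variable {M : Plane → Tensor4} (hM : ∀ r s, MemLp (fun x => M x r s) ∞ discMeasure)
include hM

lemma MatMemL2.tensorApply {A : Plane → Mat2} (hA : MatMemL2 A) :
    MatMemL2 (fun x => tensorApply (M x) (A x)) := by
  intro i j
  simp only [SmallPressure.tensorApply, Matrix.of_apply]
  exact memLp_finsetSum _ fun k _ => memLp_finsetSum _ fun l _ => (hA k l).mul' (hM (i, j) (k, l))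

lemma integral_frob_tensorApply_eq (hsymm : ∀ᵐ x ∂discMeasure, (M x).IsSymm)
    {U V : Plane → Mat2} (hU : MatMemL2 U) (hV : MatMemL2 V) :
    ∫ x, frob (tensorApply (M x) (V x)) (V x) ∂discMeasure =
      (∫ x, frob (tensorApply (M x) (U x)) (U x) ∂discMeasure) +
        (∫ x, frob (tensorApply (M x) (V x - U x)) (V x - U x) ∂discMeasure) +
        2 * ∫ x, frob (tensorApply (M x) (U x)) (V x - U x) ∂discMeasure := by
  have hD := hV.sub hU
  have hUU := (hU.tensorApply hM).integrable_frob hU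
  have hDD := (hD.tensorApply hM).integrable_frob hD
  have hUD := ((hU.tensorApply hM).integrable_frob hD).const_mul 2
  have hsum : Integrable (fun x => frob (tensorApply (M x) (U x)) (U x) +
    frob (tensorApply (M x) (V x - U x)) (V x - U x)) discMeasure := hUU.add hDD
  rw [← integral_const_mul, ← integral_add hUU hDD, ← integral_add hsum hUD]
  refine integral_congr_ae ?_
  filter_upwards [hsymm] with x hx
  have hcomm := frob_tensorApply_comm hx (V x) (U x)
  simp only [tensorApply_sub, frob_sub_right, frob_sub_left]
  linarith

lemma mul_normSqL2_le {ν : ℝ}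
    (hconv : ∀ᵐ x ∂discMeasure, ∀ ξ : Mat2, ν * frob ξ ξ ≤ frob (tensorApply (M x) ξ) ξ)
    {D : Plane → Mat2} (hD : MatMemL2 D) :
    ν * normSqL2 D ≤ ∫ x, frob (tensorApply (M x) (D x)) (D x) ∂discMeasure := by
  rw [normSqL2, ← integral_const_mul]
  refine integral_mono_ae ((hD.integrable_frob hD).const_mul ν)
    ((hD.tensorApply hM).integrable_frob hD) ?_
  filter_upwards [hconv] with x hx
  exact hx _

variable {g : ℝ → Plane} {b : Plane} {u v : Plane → Plane} (hu : u ∈ admissible g b)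
  (hv : v ∈ admissible g b) {p : Plane → ℝ} (hup : IsStationaryWithPressure M u p)
  {KR KT : ℝ} (hp : ScaledGradBound p KR KT) {η : ℕ → Plane → Plane}
  (hη : IsTestApproximation η (fun x => v x - u x)
    (fun x => weakJacobian v x - weakJacobian u x))
  {c β : ℝ} (hc : 0 < c)
  (hβ : ∃ᶠ n in atTop, ∑ i, pressureBound KR KT c (fun x => η n x i) ≤ β)
include hu hv hup hp hη hc hβ

lemma two_mul_abs_integral_frob_tensorApply_le {s : ℝ} (hs : 0 < s) :
    2 * |∫ x, frob (tensorApply (M x) (weakJacobian u x))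
      (weakJacobian v x - weakJacobian u x) ∂discMeasure| ≤
      β + s * (4 * (KR + KT) * normSqL2 (weakJacobian u)) := by
  have hU := isSobolevGradient_weakJacobian hu
  have hJ := hη.tendsto_jacobian
  have herror : Tendsto (fun n => normSqL2 fun x =>
      classicalJacobian (η n) x - (weakJacobian v x - weakJacobian u x)) atTop (𝓝 0) := by
    have hsub : MatTendsto (fun n x => classicalJacobian (η n) x -
        (weakJacobian v x - weakJacobian u x)) (fun _ => 0) := fun i j => by
      simpa using (hJ i j).sub (TendstoL2.const (hJ.memL2 i j))
    simpa [normSqL2, frob] using hsub.tendsto_normSqL2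
  have hlim := ((hU.memL2.tensorApply hM).tendsto.tendsto_integral_frob hJ).abs.const_mul 2
  refine (le_of_tendsto_of_tendsto' hlim (((((herror.const_mul s⁻¹).const_add
    (s * normSqL2 (weakJacobian u))).const_mul (4 * (KR + KT))).const_add β))
      fun k => ?_).trans_eq (by ring)
  obtain ⟨hint, hEL⟩ := hup (η k) (hη.test k)
  rw [discMeasure, hEL, abs_neg]
  exact hη.two_mul_abs_integral_pressure_le hp hU (ae_frob_cof_weakJacobian_sub hu hv) hc hβ k
    hint hs

lemma energy_add_le (hsymm : ∀ᵐ x ∂discMeasure, (M x).IsSymm) {ν : ℝ}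
    (hconv : ∀ᵐ x ∂discMeasure, ∀ ξ : Mat2, ν * frob ξ ξ ≤ frob (tensorApply (M x) ξ) ξ) :
    energy M u + ν * normSqL2 (fun x => weakJacobian v x - weakJacobian u x) ≤
      energy M v + β := by
  have hcross : 2 * |∫ x, frob (tensorApply (M x) (weakJacobian u x))
      (weakJacobian v x - weakJacobian u x) ∂discMeasure| ≤ β := by
    have hs : Tendsto (fun s : ℝ => β + s * (4 * (KR + KT) * normSqL2 (weakJacobian u)))
        (𝓝[>] 0) (𝓝 β) := by
      have hcont : Continuous fun s : ℝ =>
        β + s * (4 * (KR + KT) * normSqL2 (weakJacobian u)) := by fun_prop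
      simpa using (hcont.tendsto 0).mono_left nhdsWithin_le_nhds
    exact ge_of_tendsto hs (eventually_mem_nhdsWithin.mono fun s hs =>
      two_mul_abs_integral_frob_tensorApply_le hM hu hv hup hp hη hc hβ hs)
  have hexpand := integral_frob_tensorApply_eq hM hsymm
    (isSobolevGradient_weakJacobian hu).memL2 (isSobolevGradient_weakJacobian hv).memL2
  have hcoercive := mul_normSqL2_le hM hconv hη.tendsto_jacobian.memL2
  have habs := neg_abs_le (∫ x, frob (tensorApply (M x) (weakJacobian u x))
    (weakJacobian v x - weakJacobian u x) ∂discMeasure)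
  change (∫ x, _ ∂discMeasure) + _ ≤ (∫ x, _ ∂discMeasure) + _
  linarith

end quadraticEnergy

/-! ### Poincaré inequalities -/

lemma integral_euler_divergence_eq_zero {φ : Plane → ℝ} (hφ : IsTestFunction φ) :
    ∫ x in disc, (2 * φ x ^ 2 + 2 * (φ x * eulerDeriv φ x)) = 0 := by
  let F (j : Fin 2) (x : Plane) : ℝ := x j * (φ x * φ x)
  have hF (j : Fin 2) : IsTestFunction (F j) :=
    (hφ.mul_left hφ.contDiff).mul_left (contDiff_coord j)
  have hzero (j : Fin 2) : ∫ x in disc, partialDeriv j (F j) x = 0 := by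
    rw [← integral_partialDeriv_eq_zero (hF j).contDiff (hF j).hasCompactSupport j]
    exact setIntegral_eq_integral_of_forall_compl_eq_zero fun x hx =>
      ((hF j).partialDeriv j).eq_zero hx
  have hint (j : Fin 2) : IntegrableOn (partialDeriv j (F j)) disc :=
    integrableOn_disc_of_continuous (continuous_partialDeriv (hF j).contDiff j)
  have hpartial (j : Fin 2) (x : Plane) :
      partialDeriv j (F j) x = φ x ^ 2 + 2 * (x j * (φ x * partialDeriv j φ x)) := by
    have hφx := differentiableAt_of_contDiff hφ.contDiff x
    have hφφ : DifferentiableAt ℝ (fun y => φ y * φ y) x := hφx.mul hφx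
    rw [partialDeriv_mul j (differentiableAt_of_contDiff (contDiff_coord j) x) hφφ,
      partialDeriv_mul j hφx hφx]
    simp only [partialDeriv_coord, if_true]
    ring
  calc ∫ x in disc, (2 * φ x ^ 2 + 2 * (φ x * eulerDeriv φ x))
      = ∫ x in disc, (partialDeriv 0 (F 0) x + partialDeriv 1 (F 1) x) := by
        simp only [hpartial, eulerDeriv]
        congr 1 with x
        ring
    _ = 0 := by rw [integral_add (hint 0) (hint 1), hzero, hzero, add_zero]

lemma eulerDeriv_sq_le_invSq_mul (φ : Plane → ℝ) {x : Plane} (hx : x ∈ disc) :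
    eulerDeriv φ x ^ 2 ≤ invSq x * eulerDeriv φ x ^ 2 := by
  rcases eq_or_ne x 0 with rfl | hx0
  · simp [eulerDeriv]
  · have hnorm : ‖x‖ ^ 2 ≤ 1 := pow_le_one₀ (norm_nonneg x) (mem_ball_zero_iff.1 hx).le
    have hone : 1 ≤ invSq x := by nlinarith [invSq_nonneg x, invSq_mul_norm_sq hx0]
    exact le_mul_of_one_le_left (sq_nonneg _) hone

lemma integral_sq_le_radialEnergy {φ : Plane → ℝ} (hφ : IsTestFunction φ) :
    ∫ x in disc, φ x ^ 2 ≤ radialEnergy φ := by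
  have hsq : IntegrableOn (fun x => φ x ^ 2) disc :=
    integrableOn_disc_of_continuous (hφ.contDiff.continuous.pow 2)
  have hdiv : IntegrableOn (fun x => 2 * φ x ^ 2 + 2 * (φ x * eulerDeriv φ x)) disc :=
    integrableOn_disc_of_continuous (((hφ.contDiff.continuous.pow 2).const_mul 2).add
      ((hφ.contDiff.continuous.mul (contDiff_eulerDeriv hφ.contDiff).continuous).const_mul 2))
  have hrad := integrableOn_radialEnergy hφ.contDiff
  rw [← sub_nonpos, radialEnergy, ← integral_sub hsq hrad,
    ← integral_euler_divergence_eq_zero hφ]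
  refine setIntegral_mono_on (hsq.sub hrad) hdiv measurableSet_disc fun x hx => ?_
  nlinarith [eulerDeriv_sq_le_invSq_mul φ hx, sq_nonneg (φ x + eulerDeriv φ x)]

lemma integral_sub_circMean_sq_le {φ : Plane → ℝ} (hφ : IsTestFunction φ) :
    ∫ x in disc, (φ x - circMean φ x) ^ 2 ≤ radialFluctuation φ := by
  refine (integral_sq_le_radialEnergy (hφ.sub hφ.circMean)).trans_eq ?_
  simp only [radialEnergy, radialFluctuation, eulerDeriv_sub hφ.contDiff hφ.circMean.contDiff,
    eulerDeriv_circMean hφ.contDiff]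

lemma ae_eq_of_tendsto_radialEnergy {η : ℕ → Plane → Plane} {u v : Plane → Plane}
    {D : Plane → Mat2} (hη : IsTestApproximation η (fun x => v x - u x) D)
    (h : Tendsto (fun n => ∑ i, radialEnergy fun x => η n x i) atTop (𝓝 0)) :
    v =ᵐ[discMeasure] u := by
  have hcoord (i : Fin 2) : (fun x => v x i - u x i) =ᵐ[discMeasure] 0 := by
    refine (hη.tendsto i).ae_eq_zero (squeeze_zero (fun n => integral_nonneg fun x => sq_nonneg _)
      (fun n => (integral_sq_le_radialEnergy (hη.test n i)).trans ?_) h)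
    exact Finset.single_le_sum (f := fun i => radialEnergy fun x => η n x i)
      (fun i _ => radialEnergy_nonneg _) (Finset.mem_univ i)
  filter_upwards [ae_all_iff.2 hcoord] with x hx
  ext i
  exact sub_eq_zero.1 (hx i)

/-! ### Compactness of the fluctuation -/

/-- The indicator function of the ball of radius `δ` about the origin, used to localise the
singular weight `R⁻²`. -/
def ballIndicator (δ : ℝ) : Plane → ℝ := (Metric.ball (0 : Plane) δ).indicator fun _ => 1

lemma measurable_ballIndicator (δ : ℝ) : Measurable (ballIndicator δ) :=
  measurable_const.indicator measurableSet_ball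

lemma ballIndicator_nonneg (δ : ℝ) (x : Plane) : 0 ≤ ballIndicator δ x :=
  Set.indicator_nonneg (fun _ _ => zero_le_one) x

lemma ballIndicator_le_one (δ : ℝ) (x : Plane) : ballIndicator δ x ≤ 1 :=
  Set.indicator_le_self' (fun _ _ => zero_le_one) x

lemma ballIndicator_rot (δ α : ℝ) (x : Plane) : ballIndicator δ (rot α x) = ballIndicator δ x := by
  simp only [ballIndicator, Set.indicator, mem_ball_zero_iff, norm_rot]

lemma abs_ballIndicator_le_one (δ : ℝ) (x : Plane) : |ballIndicator δ x| ≤ 1 := by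
  rw [abs_of_nonneg (ballIndicator_nonneg δ x)]
  exact ballIndicator_le_one δ x

lemma memLp_ballIndicator (δ : ℝ) : MemLp (ballIndicator δ) ∞ discMeasure :=
  memLp_of_bound_on_disc (measurable_ballIndicator δ).aestronglyMeasurable
    (fun x _ => abs_ballIndicator_le_one δ x) ∞

lemma integrable_ballIndicator_mul (δ : ℝ) {f : Plane → ℝ} (hf : Integrable f discMeasure) :
    Integrable (fun x => ballIndicator δ x * f x) discMeasure :=
  hf.bdd_mul (measurable_ballIndicator δ).aestronglyMeasurable
    (Eventually.of_forall (abs_ballIndicator_le_one δ))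

lemma invSq_le_ballIndicator_mul_add {δ : ℝ} (hδ : 0 < δ) (x : Plane) :
    invSq x ≤ ballIndicator δ x * invSq x + (δ ^ 2)⁻¹ := by
  by_cases hx : x ∈ Metric.ball (0 : Plane) δ
  · rw [ballIndicator, Set.indicator_of_mem hx, one_mul]
    exact le_add_of_nonneg_right (by positivity)
  · rw [ballIndicator, Set.indicator_of_notMem hx, zero_mul, zero_add]
    rw [mem_ball_zero_iff, not_lt] at hx
    exact inv_anti₀ (by positivity) (pow_le_pow_left₀ hδ.le hx 2)

lemma ballIndicator_wirtinger {φ : Plane → ℝ} (hφ : ContDiff ℝ ∞ φ) (δ : ℝ) :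
    IntegrableOn (fun x => ballIndicator δ x * invSq x * (φ x - circMean φ x) ^ 2) disc ∧
      ∫ x in disc, ballIndicator δ x * invSq x * (φ x - circMean φ x) ^ 2 ≤
        ∫ x in disc, ballIndicator δ x * (partialDeriv 0 φ x ^ 2 + partialDeriv 1 φ x ^ 2) := by
  have hint : IntegrableOn (fun x => ballIndicator δ x * invSq x * angularDeriv φ x ^ 2) disc := by
    simp only [mul_assoc]
    exact integrable_ballIndicator_mul δ (integrableOn_angularEnergy hφ)
  obtain ⟨hfluct, hle⟩ := weighted_wirtinger (w := fun x => ballIndicator δ x * invSq x)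
    ((measurable_ballIndicator δ).mul measurable_invSq)
    (fun x => mul_nonneg (ballIndicator_nonneg δ x) (invSq_nonneg x))
    (fun α x => by simp only [ballIndicator_rot, invSq_rot]) hφ hint
  refine ⟨hfluct, hle.trans (setIntegral_mono_on hint
    (integrable_ballIndicator_mul δ (integrableOn_grad_sq hφ)) measurableSet_disc fun x _ => ?_)⟩
  rw [mul_assoc]
  refine mul_le_mul_of_nonneg_left ?_ (ballIndicator_nonneg δ x)
  have hradial := mul_nonneg (invSq_nonneg x) (sq_nonneg (eulerDeriv φ x))
  linarith [invSq_mul_eulerDeriv_add_angularDeriv_le φ x]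

lemma fluctuation_le_integral_ballIndicator_add {φ : Plane → ℝ} (hφ : ContDiff ℝ ∞ φ) {δ : ℝ}
    (hδ : 0 < δ) :
    fluctuation φ ≤
      (∫ x in disc, ballIndicator δ x * (partialDeriv 0 φ x ^ 2 + partialDeriv 1 φ x ^ 2)) +
        (δ ^ 2)⁻¹ * ∫ x in disc, (φ x - circMean φ x) ^ 2 := by
  obtain ⟨hinner, hle⟩ := ballIndicator_wirtinger hφ δ
  have houter : IntegrableOn (fun x => (δ ^ 2)⁻¹ * (φ x - circMean φ x) ^ 2) disc :=
    integrableOn_disc_of_continuous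
      (((hφ.continuous.sub (contDiff_circMean hφ).continuous).pow 2).const_mul _)
  calc fluctuation φ
      ≤ ∫ x in disc, (ballIndicator δ x * invSq x * (φ x - circMean φ x) ^ 2 +
          (δ ^ 2)⁻¹ * (φ x - circMean φ x) ^ 2) := by
        refine setIntegral_mono_on (integrableOn_fluctuation hφ) (hinner.add houter)
          measurableSet_disc fun x _ => ?_
        rw [← add_mul]
        exact mul_le_mul_of_nonneg_right (invSq_le_ballIndicator_mul_add hδ x) (sq_nonneg _)
    _ = (∫ x in disc, ballIndicator δ x * invSq x * (φ x - circMean φ x) ^ 2) +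
          (δ ^ 2)⁻¹ * ∫ x in disc, (φ x - circMean φ x) ^ 2 := by
        rw [integral_add hinner houter, integral_const_mul]
    _ ≤ _ := by gcongr

lemma tendsto_integral_ballIndicator_mul {f : Plane → ℝ} (hf : Integrable f discMeasure) :
    Tendsto (fun n : ℕ => ∫ x, ballIndicator (1 / ((n : ℝ) + 1)) x * f x ∂discMeasure) atTop
      (𝓝 0) := by
  rw [← integral_zero Plane ℝ (μ := discMeasure)]
  refine tendsto_integral_of_dominated_convergence (fun x => ‖f x‖)
    (fun n => (integrable_ballIndicator_mul _ hf).1) hf.norm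
    (fun n => Eventually.of_forall fun x => ?_) ?_
  · rw [norm_mul]
    exact mul_le_of_le_one_left (norm_nonneg _) (abs_ballIndicator_le_one _ x)
  · filter_upwards [ae_ne_zero] with x hx
    refine tendsto_const_nhds.congr' ?_
    filter_upwards [tendsto_one_div_add_atTop_nhds_zero_nat.eventually
      (gt_mem_nhds (norm_pos_iff.2 hx))] with n hn
    rw [ballIndicator, Set.indicator_of_notMem (by simpa using hn.le), zero_mul]

section fluctuation
variable {η : ℕ → Plane → ℝ} {d : Fin 2 → Plane → ℝ}
  (hd : ∀ j, TendstoL2 discMeasure (fun n => partialDeriv j (η n)) (d j))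
include hd

lemma tendsto_integral_ballIndicator_mul_grad_sq (δ : ℝ) :
    Tendsto (fun n => ∫ x, ballIndicator δ x *
      (partialDeriv 0 (η n) x ^ 2 + partialDeriv 1 (η n) x ^ 2) ∂discMeasure) atTop
      (𝓝 (∫ x, ballIndicator δ x * (d 0 x ^ 2 + d 1 x ^ 2) ∂discMeasure)) := by
  have hsplit {a b : Plane → ℝ} (ha : MemLp a 2 discMeasure) (hb : MemLp b 2 discMeasure) :
      ∫ x, ballIndicator δ x * (a x ^ 2 + b x ^ 2) ∂discMeasure =
        (∫ x, ballIndicator δ x * (a x * a x) ∂discMeasure) +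
          ∫ x, ballIndicator δ x * (b x * b x) ∂discMeasure := by
    simp only [← sq]
    rw [← integral_add (integrable_ballIndicator_mul δ ha.integrable_sq)
      (integrable_ballIndicator_mul δ hb.integrable_sq)]
    simp only [mul_add]
  simp only [hsplit (hd 0).memLp_lim (hd 1).memLp_lim,
    fun n => hsplit ((hd 0).memLp_seq n) ((hd 1).memLp_seq n)]
  exact ((hd 0).tendsto_integral_mul_mul (hd 0) (memLp_ballIndicator δ)).add
    ((hd 1).tendsto_integral_mul_mul (hd 1) (memLp_ballIndicator δ))

/-- Near the origin the weight `R⁻²` is controlled by Wirtinger's inequality, uniformly along the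
sequence because its gradients converge in `L²`; elsewhere the weight is bounded. -/
lemma tendsto_fluctuation (hη : ∀ n, IsTestFunction (η n))
    (h : Tendsto (fun n => radialFluctuation (η n)) atTop (𝓝 0)) :
    Tendsto (fun n => fluctuation (η n)) atTop (𝓝 0) := by
  refine tendsto_order.2 ⟨fun a ha => Eventually.of_forall fun n =>
    ha.trans_le (fluctuation_nonneg _), fun ε hε => ?_⟩
  have hlim : Integrable (fun x => d 0 x ^ 2 + d 1 x ^ 2) discMeasure :=
    (hd 0).memLp_lim.integrable_sq.add (hd 1).memLp_lim.integrable_sq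
  obtain ⟨m, hm⟩ := ((tendsto_integral_ballIndicator_mul hlim).eventually (gt_mem_nhds hε)).exists
  set δ : ℝ := 1 / ((m : ℝ) + 1)
  have hδ : 0 < δ := Nat.one_div_pos_of_nat
  have hsum := (tendsto_integral_ballIndicator_mul_grad_sq hd δ).add (h.const_mul (δ ^ 2)⁻¹)
  rw [mul_zero, add_zero] at hsum
  filter_upwards [hsum.eventually (gt_mem_nhds hm)] with n hn
  refine lt_of_le_of_lt ((fluctuation_le_integral_ballIndicator_add (hη n).contDiff
    hδ).trans ?_) hn
  have hfluct := integral_sub_circMean_sq_le (hη n)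
  simp only [discMeasure]
  gcongr

end fluctuation

/-! ### Energy comparison -/

section pressureBound
variable {φ : Plane → ℝ} (hφ : ContDiff ℝ ∞ φ) {K : ℝ} (hK : 0 ≤ K)
include hφ

lemma pressureBound_radial_eq (K : ℝ) :
    pressureBound K 0 1 φ = K * dirichlet φ - K * radialEnergy φ := by
  rw [← radialEnergy_add_angularEnergy hφ, pressureBound]
  ring

include hK

lemma pressureBound_le_dirichlet :
    pressureBound K K (5 / 4) φ ≤ 13 / 8 * K * dirichlet φ := by
  rw [← radialEnergy_add_angularEnergy hφ, pressureBound]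
  have hfluct := mul_le_mul_of_nonneg_left (fluctuation_le_angularEnergy hφ) hK
  have hradial := mul_le_mul_of_nonneg_left (radialSumEnergy_add_le hφ) hK
  have hrf := mul_nonneg hK (radialFluctuation_nonneg φ)
  have hre := mul_nonneg hK (radialEnergy_nonneg φ)
  norm_num
  linarith

lemma pressureBound_angular_le :
    pressureBound 0 K 2 φ ≤ K * dirichlet φ - 3 / 4 * K * radialFluctuation φ := by
  rw [← radialEnergy_add_angularEnergy hφ, pressureBound]
  have hfluct := mul_le_mul_of_nonneg_left (fluctuation_le_angularEnergy hφ) hK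
  have hradial := mul_le_mul_of_nonneg_left (radialSumEnergy_add_le hφ) hK
  linarith

lemma pressureBound_angular_le_fluctuation :
    pressureBound 0 K 4 φ ≤ 2 * K * fluctuation φ + K / 2 * dirichlet φ := by
  have hradial := mul_le_mul_of_nonneg_left (radialSumEnergy_le_dirichlet hφ) hK
  rw [pressureBound]
  linarith

end pressureBound

lemma tendsto_zero_of_forall_frequently_le {A R : ℕ → ℝ} {L : ℝ} (hA : Tendsto A atTop (𝓝 L))
    (hR : ∀ n, 0 ≤ R n) (h : ∀ β, (∃ᶠ n in atTop, A n - R n ≤ β) → L ≤ β) :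
    Tendsto R atTop (𝓝 0) := by
  refine tendsto_order.2 ⟨fun a ha => Eventually.of_forall fun n => ha.trans_le (hR n),
    fun ε hε => ?_⟩
  by_contra hcon
  rw [not_eventually] at hcon
  have hAε := hA.eventually (gt_mem_nhds (show L < L + ε / 2 by linarith))
  have hle := h (L - ε / 2) ((hcon.and_eventually hAε).mono fun n hn => by linarith [hn.1, hn.2])
  linarith

section testApproximation
variable {η : ℕ → Plane → Plane} {w : Plane → Plane} {D : Plane → Mat2}
  (hη : IsTestApproximation η w D)
include hη

lemma IsTestApproximation.tendsto_sum_dirichlet :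
    Tendsto (fun n => ∑ i, dirichlet fun x => η n x i) atTop (𝓝 (normSqL2 D)) := by
  simp only [sum_dirichlet fun i => (hη.test _ i).contDiff]
  exact hη.tendsto_jacobian.tendsto_normSqL2

lemma IsTestApproximation.tendsto_sum_radialEnergy {C : ℝ}
    (h : Tendsto (fun n => ∑ i, C * dirichlet fun x => η n x i) atTop (𝓝 0)) (hC : 0 < C) :
    Tendsto (fun n => ∑ i, radialEnergy fun x => η n x i) atTop (𝓝 0) := by
  have hdir := h.const_mul C⁻¹
  simp only [← Finset.mul_sum, inv_mul_cancel_left₀ hC.ne', mul_zero] at hdir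
  exact squeeze_zero (fun n => Finset.sum_nonneg fun i _ => radialEnergy_nonneg _)
    (fun n => Finset.sum_le_sum fun i _ => radialEnergy_le_dirichlet (hη.test n i).contDiff) hdir

lemma IsTestApproximation.tendsto_fluctuation {C : ℝ} (hC : 0 < C)
    (h : Tendsto (fun n => ∑ i, C * radialFluctuation fun x => η n x i) atTop (𝓝 0)) (i : Fin 2) :
    Tendsto (fun n => fluctuation fun x => η n x i) atTop (𝓝 0) := by
  have hsum := h.const_mul C⁻¹
  simp only [← Finset.mul_sum, inv_mul_cancel_left₀ hC.ne', mul_zero] at hsum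
  refine SmallPressure.tendsto_fluctuation (fun j => hη.tendsto_jacobian i j)
    (fun n => hη.test n i) (squeeze_zero (fun n => radialFluctuation_nonneg _) (fun n => ?_) hsum)
  exact Finset.single_le_sum (f := fun i => radialFluctuation fun x => η n x i)
    (fun i _ => radialFluctuation_nonneg _) (Finset.mem_univ i)

end testApproximation

section comparison
variable {M : Plane → Tensor4} (hM : ∀ r s, MemLp (fun x => M x r s) ∞ discMeasure)
  (hsymm : ∀ᵐ x ∂discMeasure, (M x).IsSymm) {ν : ℝ}
  (hconv : ∀ᵐ x ∂discMeasure, ∀ ξ : Mat2, ν * frob ξ ξ ≤ frob (tensorApply (M x) ξ) ξ)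
  {b : Plane} {g : ℝ → Plane} {u v : Plane → Plane} (hu : u ∈ admissible g b)
  (hv : v ∈ admissible g b) {p : Plane → ℝ} (hup : IsStationaryWithPressure M u p)
include hM hsymm hconv hu hv hup

section remainder
variable {η : ℕ → Plane → Plane}
  (hη : IsTestApproximation η (fun x => v x - u x)
    (fun x => weakJacobian v x - weakJacobian u x))
include hη

lemma energy_le_and_tendsto_remainder {KR KT c : ℝ} (hc : 0 < c) (hp : ScaledGradBound p KR KT)
    {R : (Plane → ℝ) → ℝ} (hR : ∀ φ, 0 ≤ R φ)
    (hbound : ∀ φ, ContDiff ℝ ∞ φ → pressureBound KR KT c φ ≤ ν * dirichlet φ - R φ) :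
    energy M u ≤ energy M v ∧ (energy M v ≤ energy M u →
      Tendsto (fun n => ∑ i, R fun x => η n x i) atTop (𝓝 0)) := by
  have hdir := hη.tendsto_sum_dirichlet.const_mul ν
  have hRsum (n : ℕ) : 0 ≤ ∑ i, R fun x => η n x i := Finset.sum_nonneg fun i _ => hR _
  have hsum (n : ℕ) : ∑ i, pressureBound KR KT c (fun x => η n x i) ≤
      ν * (∑ i, dirichlet fun x => η n x i) - ∑ i, R fun x => η n x i := by
    rw [Finset.mul_sum, ← Finset.sum_sub_distrib]
    exact Finset.sum_le_sum fun i _ => hbound _ (hη.test n i).contDiff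
  refine ⟨le_of_forall_pos_le_add fun ε hε => ?_, fun hle => ?_⟩
  · have hev := hdir.eventually (gt_mem_nhds (lt_add_of_pos_right _ hε))
    have henergy := energy_add_le hM hu hv hup hp hη hc (hev.mono fun n hn =>
      ((hsum n).trans (sub_le_self _ (hRsum n))).trans hn.le).frequently hsymm hconv
    linarith
  · refine tendsto_zero_of_forall_frequently_le hdir hRsum fun β hβ => ?_
    have henergy := energy_add_le hM hu hv hup hp hη hc
      (hβ.mono fun n hn => (hsum n).trans hn) hsymm hconv
    linarith

lemma normSqL2_eq_zero_of_tendsto_fluctuation (hν : 0 < ν) (hp : ScaledGradBound p 0 ν)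
    (hle : energy M v ≤ energy M u)
    (hfluct : ∀ i, Tendsto (fun n => fluctuation fun x => η n x i) atTop (𝓝 0)) :
    normSqL2 (fun x => weakJacobian v x - weakJacobian u x) = 0 := by
  set L := normSqL2 fun x => weakJacobian v x - weakJacobian u x
  have hlim : Tendsto (fun n => 2 * ν * (∑ i, fluctuation fun x => η n x i) +
      ν / 2 * ∑ i, dirichlet fun x => η n x i) atTop (𝓝 (ν / 2 * L)) := by
    simpa using ((tendsto_finsetSum Finset.univ fun i _ => hfluct i).const_mul (2 * ν)).add
      (hη.tendsto_sum_dirichlet.const_mul (ν / 2))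
  have hhalf : ν * L ≤ ν / 2 * L := by
    refine le_of_forall_pos_le_add fun ε hε => ?_
    have hev := (hlim.eventually (gt_mem_nhds (lt_add_of_pos_right _ hε))).mono fun n hn =>
      calc ∑ i, pressureBound 0 ν 4 (fun x => η n x i)
          ≤ ∑ i, (2 * ν * fluctuation (fun x => η n x i) +
              ν / 2 * dirichlet fun x => η n x i) := Finset.sum_le_sum fun i _ =>
            pressureBound_angular_le_fluctuation (hη.test n i).contDiff hν.le
        _ ≤ ν / 2 * L + ε := by
            rw [Finset.sum_add_distrib, ← Finset.mul_sum, ← Finset.mul_sum]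
            exact hn.le
    linarith [energy_add_le hM hu hv hup hp hη four_pos hev.frequently hsymm hconv]
  have hL : 0 ≤ L := integral_nonneg fun x => frob_self_nonneg _
  nlinarith

end remainder

variable (hg : ∀ i, AEStronglyMeasurable (fun θ => g θ i) angleMeasure)
include hg

lemma energy_le_and_ae_eq_of_small {K : ℝ} (hK : 0 ≤ K) (hKν : 13 / 8 * K < ν)
    (hp : ScaledGradBound p K K) :
    energy M u ≤ energy M v ∧ (energy M v ≤ energy M u → v =ᵐ[discMeasure] u) := by
  obtain ⟨η, hη⟩ := exists_isTestApproximation_sub hu hv hg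
  refine (energy_le_and_tendsto_remainder hM hsymm hconv hu hv hup hη (by norm_num) hp
    (R := fun φ => (ν - 13 / 8 * K) * dirichlet φ)
    (fun φ => mul_nonneg (sub_nonneg.2 hKν.le) (dirichlet_nonneg φ))
    fun φ hφ => (pressureBound_le_dirichlet hφ hK).trans_eq (by ring)).imp_right
    fun hremainder hle => ?_
  exact ae_eq_of_tendsto_radialEnergy hη
    (hη.tendsto_sum_radialEnergy (hremainder hle) (sub_pos.2 hKν))

variable (hν : 0 < ν)
include hν

lemma energy_le_and_ae_eq_of_radial (hp : ScaledGradBound p ν 0) :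
    energy M u ≤ energy M v ∧ (energy M v ≤ energy M u → v =ᵐ[discMeasure] u) := by
  obtain ⟨η, hη⟩ := exists_isTestApproximation_sub hu hv hg
  refine (energy_le_and_tendsto_remainder hM hsymm hconv hu hv hup hη one_pos hp
    (R := fun φ => ν * radialEnergy φ) (fun φ => mul_nonneg hν.le (radialEnergy_nonneg φ))
    fun φ hφ => (pressureBound_radial_eq hφ ν).le).imp_right fun hremainder hle => ?_
  have hradial := (hremainder hle).const_mul ν⁻¹
  simp only [← Finset.mul_sum, inv_mul_cancel_left₀ hν.ne', mul_zero] at hradial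
  exact ae_eq_of_tendsto_radialEnergy hη hradial

/-- With Young constant `2` the radial part is used up exactly, so the remainder only controls the
fluctuations; once these vanish in the limit, the constant `4` leaves half of the Dirichlet
integral to spare. -/
lemma energy_le_and_ae_eq_of_angular (hp : ScaledGradBound p 0 ν) :
    energy M u ≤ energy M v ∧ (energy M v ≤ energy M u → v =ᵐ[discMeasure] u) := by
  obtain ⟨η, hη⟩ := exists_isTestApproximation_sub hu hv hg
  refine (energy_le_and_tendsto_remainder hM hsymm hconv hu hv hup hη two_pos hp
    (R := fun φ => 3 / 4 * ν * radialFluctuation φ)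
    (fun φ => mul_nonneg (by positivity) (radialFluctuation_nonneg φ))
    fun φ hφ => pressureBound_angular_le hφ hν.le).imp_right fun hremainder hle => ?_
  have hzero := normSqL2_eq_zero_of_tendsto_fluctuation hM hsymm hconv hu hv hup hη hν hp hle
    (hη.tendsto_fluctuation (by positivity) (hremainder hle))
  have hdir := hη.tendsto_sum_dirichlet
  rw [hzero] at hdir
  exact ae_eq_of_tendsto_radialEnergy hη
    (hη.tendsto_sum_radialEnergy (C := 1) (by simpa only [one_mul] using hdir) one_pos)

end comparison

lemma isUniqueGlobalMinimizer_of_forall {M : Plane → Tensor4} {g : ℝ → Plane} {b : Plane}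
    {u : Plane → Plane} (hu : u ∈ admissible g b)
    (h : ∀ v ∈ admissible g b, energy M u ≤ energy M v ∧
      (energy M v ≤ energy M u → v =ᵐ[discMeasure] u)) :
    IsUniqueGlobalMinimizer M g b u :=
  ⟨⟨hu, fun v hv => (h v hv).1⟩, fun v hv => (h v hv.1).2 (hv.2 u hu)⟩

lemma sqrt_three_mul_div_lt {ν : ℝ} (hν : 0 < ν) : √3 * ν / (2 * √2) < 8 / 13 * ν := by
  have hsqrt : 13 * √3 < 16 * √2 := by
    refine lt_of_pow_lt_pow_left₀ 2 (by positivity) ?_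
    rw [mul_pow, mul_pow, Real.sq_sqrt (by norm_num), Real.sq_sqrt (by norm_num)]
    norm_num
  rw [div_lt_iff₀ (by positivity)]
  nlinarith

end SmallPressure

end

open SmallPressure in
theorem mainTheorem9_general
    (M : Plane → Tensor4) (hM_bdd : ∀ r s, MemLp (fun x => M x r s) ∞ discMeasure)
    (hM_symm : ∀ᵐ x ∂discMeasure, (M x).IsSymm) (ν : ℝ) (hν : 0 < ν)
    (hM_conv : ∀ᵐ x ∂discMeasure, ∀ ξ : Mat2, ν * frob ξ ξ ≤ frob (tensorApply (M x) ξ) ξ)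
    (b : Plane) (g : ℝ → Plane) (hg : ∀ i, AEStronglyMeasurable (fun θ => g θ i) angleMeasure)
    (u : Plane → Plane) (hu : u ∈ admissible g b) (p : Plane → ℝ) (hp : WeaklyDifferentiable p)
    (hup : IsStationaryWithPressure M u p) :
    (polarSupNorm (scaledGrad p) < ENNReal.ofReal (8 / 13 * ν) →
      IsUniqueGlobalMinimizer M g b u) ∧
    (DependsOnlyOnRadius p ∨ DependsOnlyOnAngle p →
      polarSupNorm (scaledGrad p) ≤ ENNReal.ofReal ν → IsUniqueGlobalMinimizer M g b u) := by
  refine ⟨fun hK => isUniqueGlobalMinimizer_of_forall hu fun v hv => ?_,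
    fun hdep hK => isUniqueGlobalMinimizer_of_forall hu fun v hv => ?_⟩
  · have hKν : 13 / 8 * (polarSupNorm (scaledGrad p)).toReal < ν := by
      linarith [ENNReal.toReal_lt_of_lt_ofReal hK]
    exact energy_le_and_ae_eq_of_small hM_bdd hM_symm hM_conv hu hv hup hg ENNReal.toReal_nonneg
      hKν (scaledGradBound_of_polarSupNorm_le ENNReal.toReal_nonneg
        (ENNReal.ofReal_toReal hK.ne_top).ge hp)
  · rcases hdep with hrad | hang
    · exact energy_le_and_ae_eq_of_radial hM_bdd hM_symm hM_conv hu hv hup hg hν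
        (hrad.scaledGradBound hν.le hK hp)
    · exact energy_le_and_ae_eq_of_angular hM_bdd hM_symm hM_conv hu hv hup hg hν
        (hang.scaledGradBound hν.le hK hp)

theorem mainTheorem9
    (M : SmallPressure.Plane → SmallPressure.Tensor4)
    (hM_bdd : ∀ r s, MemLp (fun x => M x r s) ∞ SmallPressure.discMeasure)
    (hM_symm : ∀ᵐ x ∂SmallPressure.discMeasure, (M x).IsSymm)
    (ν : ℝ) (hν : 0 < ν)
    (hM_conv : ∀ᵐ x ∂SmallPressure.discMeasure, ∀ ξ : SmallPressure.Mat2,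
      ν * SmallPressure.frob ξ ξ ≤ SmallPressure.frob (SmallPressure.tensorApply (M x) ξ) ξ)
    (b : SmallPressure.Plane) (g : ℝ → SmallPressure.Plane)
    (hg : ∀ i, SmallPressure.MemW12Circle (fun θ => g θ i))
    (u : SmallPressure.Plane → SmallPressure.Plane) (hu : u ∈ SmallPressure.admissible g b)
    (p : SmallPressure.Plane → ℝ) (hp : SmallPressure.WeaklyDifferentiable p)
    (hup : SmallPressure.IsStationaryWithPressure M u p) :
    (SmallPressure.polarSupNorm (SmallPressure.scaledGrad p) ≤
        ENNReal.ofReal (√3 * ν / (2 * √2)) →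
      SmallPressure.IsGlobalMinimizer M g b u ∧
      (SmallPressure.StrictOnNontrivialSet p (√3 * ν / (2 * √2)) →
        SmallPressure.IsUniqueGlobalMinimizer M g b u)) ∧
    (SmallPressure.DependsOnlyOnRadius p ∨ SmallPressure.DependsOnlyOnAngle p →
      SmallPressure.polarSupNorm (SmallPressure.scaledGrad p) ≤ ENNReal.ofReal ν →
      SmallPressure.IsGlobalMinimizer M g b u ∧
      (SmallPressure.StrictOnNontrivialSet p ν →
        SmallPressure.IsUniqueGlobalMinimizer M g b u)) := by
  have h := mainTheorem9_general M hM_bdd hM_symm ν hν hM_conv b g (fun i => (hg i).1.1) u hu p hp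
    hup
  refine ⟨fun hK => ?_, fun hdep hK => ⟨(h.2 hdep hK).1, fun _ => h.2 hdep hK⟩⟩
  have hmin := h.1 (hK.trans_lt ((ENNReal.ofReal_lt_ofReal_iff (by positivity)).2
    (SmallPressure.sqrt_three_mul_div_lt hν)))
  exact ⟨hmin.1, fun _ => hmin⟩
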